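/- **Setting.** A two-stage SMART has participants $i=1,2,\dots$ with independent observed data $(L_i,A_{1i},R_i,A_{2i},Y_i)$, not necessarily identically distributed: baseline covariates $L_i$, first-stage assignment $A_{1i}\in\{-1,1\}$, response status $R_i\in\{0,1\}$, second-stage assignment $A_{2i}$, outcome $Y_i\in\mathbb R^{n_i}$ ($n_i$ nonrandom). Exactly the participants with $R_i=0$ and $A_{1i}\in S$, for a fixed $S\subseteq\{-1,1\}$, are re-randomized, to $A_{2i}\in\{-1,1\}$; for the others $A_{2i}$ is undefined. The embedded DTRs are the pairs $(a_1,a_2)$ with $a_1\in S$, $a_2=\pm1$, and $(a_1,\cdot)$ with $a_1\notin S$. The second-stage randomization probabilities depend only on $(A_{1i},R_i)$: $A_{2i}$ is independent of $L_i$ given $(A_{1i},R_i)$. Potential outcomes are $Y_i(a_1,a_2)$ and $R_i(a_1)$. The working model has measurable design matrices $X_i(a_1,a_2)$ ($n_i\times p$) and $Z_i(a_1,a_2)$ ($n_i\times q$), functions of $L_i$, and working covariance $V_i(a_1,a_2;\alpha)=Z_iG(\alpha)Z_i^\top+\sigma^2(\alpha)I_{n_i}$, where, for $\alpha$ in a parameter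 set $\mathcal A\subseteq\mathbb R^r$, $G(\alpha)$ is positive semidefinite and $\sigma^2(\alpha)>0$ ($G$, $\sigma^2$ Borel in $\alpha$). Nothing is assumed about how $V_i$ relates to the true covariance of $Y_i(a_1,a_2)$; the random-effects or covariance structure may be misspecified. Put $$\tilde W_i(a_1,a_2)=\frac{1\{A_{1i}=a_1\}}{P(A_{1i}=a_1)}\Big[R_i+\frac{1\{A_{2i}=a_2\}}{P(A_{2i}=a_2\mid A_{1i}=a_1,R_i=0)}(1-R_i)\Big],\qquad r_i(a_1,a_2;\beta)=Y_i-X_i(a_1,a_2)\beta,$$ where for $a_2=\cdot$ the event $A_{2i}=a_2$ means that $A_{2i}$ is undefined (so the conditional probability is $1$). With sums over the embedded DTRs, put $$U_i(\beta,\alpha)=\sum_{a_1,a_2}\tilde W_iX_i^\top V_i(\alpha)^{-1}r_i(\beta),\qquad H_i(\alpha)=\sum_{a_1,a_2}\tilde W_iX_i^\top V_i(\alpha)^{-1}X_i,$$ $$l_N(\beta,\alpha)=-\tfrac12\sum_{i\le N}\sum_{a_1,a_2}\tilde W_i\big(\log\det V_i(\alpha)+r_i(\beta)^\top V_i(\alpha)^{-1}r_i(\beta)\big),$$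 $$\hat\beta(\alpha)=\Big(\sum_{i\le N}H_i(\alpha)\Big)^{-1}\sum_{i\le N}\sum_{a_1,a_2}\tilde W_iX_i^\top V_i(\alpha)^{-1}Y_i$$ (an inverse that does not exist is read as $0$). Let $B\subseteq\mathbb R^p$ be the parameter space of $\beta$ and $\beta^*\in B$. With probability tending to one, the following hold: for each $\beta\in B$, $\hat\alpha(\beta)$ maximizes $l_N(\beta,\cdot)$ over $\mathcal A$; the random vector $\hat\alpha$ maximizes $\alpha\mapsto l_N(\hat\beta(\alpha),\alpha)$ over $\mathcal A$; $\hat\beta:=\hat\beta(\hat\alpha)\in B$ and $\hat\alpha=\hat\alpha(\hat\beta)$. Below, $\lim_N$ of averages of conditional expectations is a limit in probability with nonrandom value. **Theorem.** Assume the following. 1. *Correct marginal mean.* $Y_i(a_1,a_2)$ is integrable and $E[Y_i(a_1,a_2)\mid L_i]=X_i(a_1,a_2)\beta^*$ a.s., for each $i$ and each embedded DTR. 2. *Sequential randomization.* For each embedded DTR and each $a_1$: $Y_i(a_1,a_2)\perp A_{1i}\mid L_i$; $R_i(a_1)\perp A_{1i}\mid L_i$; $Y_i(a_1,a_2)\perp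 A_{2i}\mid(A_{1i},R_i,L_i)$. 3. *Consistency.* Almost surely $R_i=R_i(A_{1i})$; if $R_i=1$ then $Y_i=Y_i(A_{1i},a_2)$ for all embedded $(A_{1i},a_2)$; if $R_i=0$ then $Y_i=Y_i(A_{1i},A_{2i})$. 4. *Positivity.* For some $c>0$, $P(A_{1i}=a_1)\ge c$ and $P(A_{2i}=a_2\mid A_{1i}=a_1,R_i=0)\ge c$ for all $i$, all $a_1$, and all embedded $(a_1,a_2)$. 5. *Regularity.* There are $\alpha^*:B\to\mathcal A$ (extended arbitrarily outside $B$) and limits as below such that: - (a) for each $\beta\in B$, $\sqrt N\|\hat\alpha(\beta)-\alpha^*(\beta)\|=O_P(1)$; and for some $\delta>0$, $\|\hat\alpha(\beta)-\hat\alpha(\beta^*)\|\le K_N\|\beta-\beta^*\|$ for all $\beta\in B$ with $\|\beta-\beta^*\|<\delta$, where $K_N=O_P(1)$; - (b) $m(\beta)=\lim_N\frac1N\sum_{i\le N}E[U_i(\beta,\alpha^*(\beta))\mid L_i]$ exists for each $\beta\in B$, and $\sup_{\beta\in B}\big\|\frac1N\sum_{i\le N}U_i(\beta,\hat\alpha(\beta))-m(\beta)\big\|\xrightarrow{P}0$;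 - (c) $J(\beta)=\lim_N\frac1N\sum_{i\le N}E[H_i(\alpha^*(\beta))\mid L_i]$ exists for each $\beta\in B$, and for some $c'>0$, $v^\top J(\beta)v\ge c'\|v\|^2$ for all $\beta\in B$, $v\in\mathbb R^p$; the limit $I=\lim_N\frac1N\sum_{i\le N}E[U_i(\beta^*,\alpha^*)U_i(\beta^*,\alpha^*)^\top\mid L_i]$ exists, where $\alpha^*=\alpha^*(\beta^*)$; - (d) for some $\eta>0$, $(1+\|X_i\|^2+\|X_i\|\,\|Y_i(a_1,a_2)\|)(1+\|Z_i\|^2)$ is bounded in $L^{2+\eta}$ uniformly in $i$ and the embedded DTRs (Frobenius and Euclidean norms), and $G$, $\sigma^2$ are differentiable at $\alpha^*(\beta^*)$. Then, with $J=J(\beta^*)$: with probability tending to one $\hat\beta$ solves $\sum_{i\le N}U_i(\beta,\hat\alpha)=0$; $\hat\beta\xrightarrow{P}\beta^*$; and $\sqrt N(\hat\beta-\beta^*)$ converges in distribution to $N(0,J^{-1}IJ^{-1})$. -/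

import Mathlib

open MeasureTheory ProbabilityTheory Filter
open scoped Topology ENNReal NNReal Matrix

noncomputable section

namespace SMART

/-- Euclidean space of dimension `k`. -/
abbrev Vec (k : ℕ) : Type := EuclideanSpace ℝ (Fin k)

/-- A second-stage treatment: `some 1`, `some (-1)`, or `none` when no second-stage treatment
is assigned by randomization (the treatment is then "not defined"). -/
abbrev Stage2 : Type := Option ℤˣ

instance : MeasurableSpace Stage2 := ⊤

/-- The label `(a₁, a₂)` of a two-stage regimen, with `a₁ ∈ {-1, 1}`. The label `(a₁, none)` is
the regimen `(a₁, ·)` that is fully characterized by `a₁`. -/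
abbrev DTR : Type := ℤˣ × Stage2

/-- The regimens embedded in a two-stage SMART in which the slow responders to the first-stage
treatments in `S`, and only those participants, are randomized again. -/
def embeddedDTRs (S : Finset ℤˣ) : Finset DTR :=
  Finset.univ.filter fun d => (d.2 = none ↔ d.1 ∉ S)

/-- Data of a two-stage SMART with participants `0, 1, 2, …`; participant `i` has `n i`
(nonrandom) measurement occasions. The value `true` of the tailoring variable means `R = 1`
(responder) and `false` means `R = 0` (slow responder). -/
structure Trial (Ω 𝓛 : Type*) [MeasurableSpace Ω] [MeasurableSpace 𝓛] (n : ℕ → ℕ) where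
  /-- first-stage treatments whose slow responders are randomized again -/
  rerand : Finset ℤˣ
  /-- baseline covariates -/
  L : ℕ → Ω → 𝓛
  /-- potential longitudinal outcomes `Y_i(a₁, a₂)` (used only at embedded regimens) -/
  Ypot : ∀ i : ℕ, DTR → Ω → Vec (n i)
  /-- potential tailoring variable `R_i(a₁)` -/
  Rpot : ℕ → ℤˣ → Ω → Bool
  /-- first-stage assignment -/
  A1 : ℕ → Ω → ℤˣ
  /-- second-stage assignment -/
  A2 : ℕ → Ω → Stage2
  /-- observed tailoring variable -/
  R : ℕ → Ω → Bool
  /-- observed longitudinal outcome -/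
  Y : ∀ i : ℕ, Ω → Vec (n i)
  measurable_L : ∀ i, Measurable (L i)
  measurable_Ypot : ∀ i d, Measurable (Ypot i d)
  measurable_Rpot : ∀ i a, Measurable (Rpot i a)
  measurable_A1 : ∀ i, Measurable (A1 i)
  measurable_A2 : ∀ i, Measurable (A2 i)
  measurable_R : ∀ i, Measurable (R i)
  measurable_Y : ∀ i, Measurable (Y i)

/-- The working linear mixed model: fixed-effects designs `X_i(a₁, a₂)` and random-effects designs
`Z_i(a₁, a₂)`, both functions of the baseline covariates, and a parametrization
`α ↦ (G(α), σ²(α))`, over a parameter set, of the covariance matrix of the random effects and of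
the residual variance. -/
structure WorkingModel (𝓛 : Type*) [MeasurableSpace 𝓛] (n : ℕ → ℕ) (p q r : ℕ) where
  X : ∀ i : ℕ, DTR → 𝓛 → Matrix (Fin (n i)) (Fin p) ℝ
  Z : ∀ i : ℕ, DTR → 𝓛 → Matrix (Fin (n i)) (Fin q) ℝ
  params : Set (Vec r)
  G : Vec r → Matrix (Fin q) (Fin q) ℝ
  sigmaSq : Vec r → ℝ
  measurable_X : ∀ i d j k, Measurable fun l => X i d l j k
  measurable_Z : ∀ i d j k, Measurable fun l => Z i d l j k
  measurable_G : ∀ j k, Measurable fun α => G α j k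
  measurable_sigmaSq : Measurable sigmaSq
  G_posSemidef : ∀ α ∈ params, (G α).PosSemidef
  sigmaSq_pos : ∀ α ∈ params, 0 < sigmaSq α

section Objects

variable {Ω 𝓛 : Type*} [MeasurableSpace Ω] [MeasurableSpace 𝓛] {n : ℕ → ℕ} {p q r : ℕ}

/-- The σ-algebra generated by the baseline covariates of participant `i`. -/
abbrev Trial.sigmaL (T : Trial Ω 𝓛 n) (i : ℕ) : MeasurableSpace Ω :=
  MeasurableSpace.comap (T.L i) inferInstance

/-- The regimens embedded in the trial. -/
def Trial.dtrs (T : Trial Ω 𝓛 n) : Finset DTR := embeddedDTRs T.rerand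

/-- `P(A₁ᵢ = a₁)`. -/
def Trial.prob1 (T : Trial Ω 𝓛 n) (μ : Measure Ω) (i : ℕ) (a : ℤˣ) : ℝ :=
  (μ {ω | T.A1 i ω = a}).toReal

/-- `P(A₂ᵢ = a₂ | A₁ᵢ = a₁, Rᵢ = 0)`. -/
def Trial.prob2 (T : Trial Ω 𝓛 n) (μ : Measure Ω) (i : ℕ) (d : DTR) : ℝ :=
  ((ProbabilityTheory.cond μ {ω | T.A1 i ω = d.1 ∧ T.R i ω = false})
    {ω | T.A2 i ω = d.2}).toReal

/-- The weight `W_i^{(a₁,a₂)}(R)`. -/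
def Trial.weight (T : Trial Ω 𝓛 n) (μ : Measure Ω) (i : ℕ) (d : DTR) (R : Bool) : ℝ :=
  (T.prob1 μ i d.1)⁻¹ * (if R then 1 else (T.prob2 μ i d)⁻¹)

/-- The indicator that `(A₁, R, A₂)` is observable under the regimen `d`. -/
def observable (d : DTR) (a1 : ℤˣ) (R : Bool) (a2 : Stage2) : ℝ :=
  if a1 = d.1 ∧ (R = true ∨ a2 = d.2) then 1 else 0

/-- The product of the observability indicator and the weight. -/
def Trial.wTilde (T : Trial Ω 𝓛 n) (μ : Measure Ω) (i : ℕ) (d : DTR) (ω : Ω) : ℝ :=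
  observable d (T.A1 i ω) (T.R i ω) (T.A2 i ω) * T.weight μ i d (T.R i ω)

/-- The working marginal covariance `V_i(a₁, a₂; α) = Z G(α) Zᵀ + σ²(α) I`. -/
def WorkingModel.V (M : WorkingModel 𝓛 n p q r) (i : ℕ) (d : DTR) (l : 𝓛) (α : Vec r) :
    Matrix (Fin (n i)) (Fin (n i)) ℝ :=
  M.Z i d l * M.G α * (M.Z i d l)ᵀ + M.sigmaSq α • (1 : Matrix (Fin (n i)) (Fin (n i)) ℝ)

/-- The residual `r_i(a₁, a₂; β) = Y_i - X_i(a₁, a₂) β`. -/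
def residual (T : Trial Ω 𝓛 n) (M : WorkingModel 𝓛 n p q r) (i : ℕ) (d : DTR) (β : Vec p)
    (ω : Ω) : Fin (n i) → ℝ :=
  (T.Y i ω).ofLp - M.X i d (T.L i ω) *ᵥ β.ofLp

/-- The weighted log-pseudo-likelihood `l(β, α)` of the first `N` participants. -/
def pseudoLogLik (T : Trial Ω 𝓛 n) (M : WorkingModel 𝓛 n p q r) (μ : Measure Ω) (N : ℕ)
    (β : Vec p) (α : Vec r) (ω : Ω) : ℝ :=
  -(1 / 2 : ℝ) * ∑ i ∈ Finset.range N, ∑ d ∈ T.dtrs, T.wTilde μ i d ω *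
    (Real.log (M.V i d (T.L i ω) α).det +
      residual T M i d β ω ⬝ᵥ ((M.V i d (T.L i ω) α)⁻¹ *ᵥ residual T M i d β ω))

/-- The estimating function `U_i(β, α)`. -/
def U (T : Trial Ω 𝓛 n) (M : WorkingModel 𝓛 n p q r) (μ : Measure Ω) (i : ℕ)
    (β : Vec p) (α : Vec r) (ω : Ω) : Vec p :=
  ∑ d ∈ T.dtrs, T.wTilde μ i d ω •
    (WithLp.toLp 2 ((M.X i d (T.L i ω))ᵀ *ᵥ
      ((M.V i d (T.L i ω) α)⁻¹ *ᵥ residual T M i d β ω)) : Vec p)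

/-- The matrix `∑_{a₁,a₂} W̃_i Xᵢᵀ Vᵢ(α)⁻¹ Xᵢ`. -/
def H (T : Trial Ω 𝓛 n) (M : WorkingModel 𝓛 n p q r) (μ : Measure Ω) (i : ℕ)
    (α : Vec r) (ω : Ω) : Matrix (Fin p) (Fin p) ℝ :=
  ∑ d ∈ T.dtrs, T.wTilde μ i d ω •
    ((M.X i d (T.L i ω))ᵀ * (M.V i d (T.L i ω) α)⁻¹ * M.X i d (T.L i ω))

/-- The closed form `β̂(α)` computed from the first `N` participants. -/
def betaHat (T : Trial Ω 𝓛 n) (M : WorkingModel 𝓛 n p q r) (μ : Measure Ω) (N : ℕ)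
    (α : Vec r) (ω : Ω) : Vec p :=
  WithLp.toLp 2 ((∑ i ∈ Finset.range N, H T M μ i α ω)⁻¹ *ᵥ
    (∑ i ∈ Finset.range N, ∑ d ∈ T.dtrs, T.wTilde μ i d ω •
      ((M.X i d (T.L i ω))ᵀ *ᵥ ((M.V i d (T.L i ω) α)⁻¹ *ᵥ (T.Y i ω).ofLp))))

/-- Frobenius norm of a matrix. -/
def frob {m k : ℕ} (A : Matrix (Fin m) (Fin k) ℝ) : ℝ :=
  Real.sqrt (∑ i, ∑ j, A i j ^ 2)

/-- The function `(1 + ‖X‖² + ‖X‖ ‖Y(a₁, a₂)‖) (1 + ‖Z‖²)` of the data of participant `i`. -/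
def envelope (T : Trial Ω 𝓛 n) (M : WorkingModel 𝓛 n p q r) (i : ℕ) (d : DTR) (ω : Ω) : ℝ :=
  (1 + frob (M.X i d (T.L i ω)) ^ 2 + frob (M.X i d (T.L i ω)) * ‖T.Ypot i d ω‖) *
    (1 + frob (M.Z i d (T.L i ω)) ^ 2)

end Objects

section Modes

variable {Ω : Type*} [MeasurableSpace Ω]

/-- The property `P N` holds with probability tending to one as `N → ∞`. -/
def WithHighProb (μ : Measure Ω) (P : ℕ → Ω → Prop) : Prop :=
  Tendsto (fun N => μ {ω | ¬ P N ω}) atTop (𝓝 0)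

/-- The sequence `ξ` is bounded above in probability. -/
def BoundedInProb (μ : Measure Ω) (ξ : ℕ → Ω → ℝ) : Prop :=
  ∀ ε : ℝ, 0 < ε → ∃ K : ℝ, ∀ᶠ N in atTop, μ {ω | K < ξ N ω} ≤ ENNReal.ofReal ε

end Modes

section Assumptions

variable {Ω 𝓛 : Type*} [MeasurableSpace Ω] [MeasurableSpace 𝓛] {n : ℕ → ℕ} {p q r : ℕ}

/-- Observed data of different participants are independent. -/
def IndependentParticipants (T : Trial Ω 𝓛 n) (μ : Measure Ω) : Prop :=
  iIndepFun (β := fun i => 𝓛 × ℤˣ × Bool × Stage2 × Vec (n i))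
    (fun i ω => (T.L i ω, T.A1 i ω, T.R i ω, T.A2 i ω, T.Y i ω)) μ

/-- The second-stage design: exactly the slow responders to a first-stage treatment in `rerand`
are randomized again, with probabilities that depend on the past only through `(A₁, R)`. -/
def SecondStageDesign [StandardBorelSpace Ω] (T : Trial Ω 𝓛 n) (μ : Measure Ω)
    [IsFiniteMeasure μ] : Prop :=
  ∀ i, (∀ᵐ ω ∂μ, T.A2 i ω = none ↔ (T.R i ω = true ∨ T.A1 i ω ∉ T.rerand)) ∧
    CondIndepFun (MeasurableSpace.comap (fun ω => (T.A1 i ω, T.R i ω)) inferInstance)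
      ((T.measurable_A1 i).prodMk (T.measurable_R i)).comap_le (T.A2 i) (T.L i) μ

/-- Correctly specified marginal mean model with parameter `β`. -/
def CorrectMean (T : Trial Ω 𝓛 n) (M : WorkingModel 𝓛 n p q r) (μ : Measure Ω)
    (β : Vec p) : Prop :=
  ∀ i, ∀ d ∈ T.dtrs, Integrable (T.Ypot i d) μ ∧
    μ[T.Ypot i d | T.sigmaL i] =ᵐ[μ]
      fun ω => (WithLp.toLp 2 (M.X i d (T.L i ω) *ᵥ β.ofLp) : Vec (n i))

/-- Sequential randomization. -/
def SequentialRandomization [StandardBorelSpace Ω] (T : Trial Ω 𝓛 n) (μ : Measure Ω)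
    [IsFiniteMeasure μ] : Prop :=
  ∀ i,
    (∀ d ∈ T.dtrs,
      CondIndepFun (T.sigmaL i) (T.measurable_L i).comap_le (T.Ypot i d) (T.A1 i) μ) ∧
    (∀ a, CondIndepFun (T.sigmaL i) (T.measurable_L i).comap_le (T.Rpot i a) (T.A1 i) μ) ∧
    (∀ d ∈ T.dtrs,
      CondIndepFun
        (MeasurableSpace.comap (fun ω => (T.A1 i ω, T.R i ω, T.L i ω)) inferInstance)
        ((T.measurable_A1 i).prodMk
          ((T.measurable_R i).prodMk (T.measurable_L i))).comap_le
        (T.Ypot i d) (T.A2 i) μ)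

/-- Consistency: `R = R(A₁)`, the outcome of a responder is the common value of `Y(A₁, a₂)` over
all `a₂`, and the outcome of a slow responder is `Y(A₁, A₂)`. -/
def Consistency (T : Trial Ω 𝓛 n) (μ : Measure Ω) : Prop :=
  ∀ i, ∀ᵐ ω ∂μ, T.R i ω = T.Rpot i (T.A1 i ω) ω ∧
    (T.R i ω = true → ∀ d ∈ T.dtrs, d.1 = T.A1 i ω → T.Y i ω = T.Ypot i d ω) ∧
    (T.R i ω = false → T.Y i ω = T.Ypot i (T.A1 i ω, T.A2 i ω) ω)

/-- Positivity, with a bound common to all participants. -/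
def Positivity (T : Trial Ω 𝓛 n) (μ : Measure Ω) : Prop :=
  ∃ c : ℝ, 0 < c ∧ ∀ i, (∀ a, c ≤ T.prob1 μ i a) ∧ (∀ d ∈ T.dtrs, c ≤ T.prob2 μ i d)

/-- Moment and smoothness conditions, with `α₀` the limit of the variance parameter. -/
def MomentsAndSmoothness (T : Trial Ω 𝓛 n) (M : WorkingModel 𝓛 n p q r) (μ : Measure Ω)
    (α₀ : Vec r) : Prop :=
  (∃ η : ℝ, 0 < η ∧ ∃ C : ℝ≥0, ∀ i, ∀ d ∈ T.dtrs,
    eLpNorm (envelope T M i d) (ENNReal.ofReal (2 + η)) μ ≤ C) ∧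
  (∀ j k, DifferentiableAt ℝ (fun α => M.G α j k) α₀) ∧ DifferentiableAt ℝ M.sigmaSq α₀

/-- `α̂(β)` is, for every `β ∈ B`, a maximizer of `α ↦ l(β, α)`, `α̂` is a maximizer of
`α ↦ l(β̂(α), α)`, `α̂ = α̂(β̂)` and `β̂ ∈ B`, where `β̂ = β̂(α̂)`, each with probability tending
to one. -/
def PseudoLikelihoodEstimators (T : Trial Ω 𝓛 n) (M : WorkingModel 𝓛 n p q r) (μ : Measure Ω)
    (B : Set (Vec p)) (αhatAt : ℕ → Vec p → Ω → Vec r) (αhat : ℕ → Ω → Vec r) : Prop :=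
  (∀ β ∈ B, WithHighProb μ fun N ω => αhatAt N β ω ∈ M.params ∧
    ∀ α ∈ M.params, pseudoLogLik T M μ N β α ω ≤ pseudoLogLik T M μ N β (αhatAt N β ω) ω) ∧
  (WithHighProb μ fun N ω => αhat N ω ∈ M.params ∧
    ∀ α ∈ M.params, pseudoLogLik T M μ N (betaHat T M μ N α ω) α ω ≤
      pseudoLogLik T M μ N (betaHat T M μ N (αhat N ω) ω) (αhat N ω) ω) ∧
  (WithHighProb μ fun N ω => betaHat T M μ N (αhat N ω) ω ∈ B ∧
    αhatAt N (betaHat T M μ N (αhat N ω) ω) ω = αhat N ω)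

/-- `α̂(β)` converges to `α*(β)` at rate `√N` for each `β ∈ B`, and, near `β₀`, the function
`β ↦ α̂(β) - α̂(β₀)` is bounded by `‖β - β₀‖` times a quantity that is bounded in probability. -/
def RootNConsistent (μ : Measure Ω) (B : Set (Vec p)) (β₀ : Vec p)
    (αhatAt : ℕ → Vec p → Ω → Vec r) (αstar : Vec p → Vec r) : Prop :=
  (∀ β ∈ B, BoundedInProb μ fun N ω => √(N : ℝ) * ‖αhatAt N β ω - αstar β‖) ∧
  ∃ δ : ℝ, 0 < δ ∧ ∀ ε : ℝ, 0 < ε → ∃ K : ℝ, ∀ᶠ N in atTop,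
    μ {ω | ∃ β ∈ B, ‖β - β₀‖ < δ ∧ K * ‖β - β₀‖ < ‖αhatAt N β ω - αhatAt N β₀ ω‖}
      ≤ ENNReal.ofReal ε

/-- The averaged conditional expectations of `U_i(β, α*(β))` converge in probability to `m β`, and
the averaged estimating functions at `α̂(β)` converge to `m β` in probability, uniformly
in `β ∈ B`. -/
def UniformConvergence (T : Trial Ω 𝓛 n) (M : WorkingModel 𝓛 n p q r) (μ : Measure Ω)
    (B : Set (Vec p)) (αhatAt : ℕ → Vec p → Ω → Vec r) (αstar : Vec p → Vec r)
    (m : Vec p → Vec p) : Prop :=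
  (∀ β ∈ B, TendstoInMeasure μ
    (fun (N : ℕ) ω => (N : ℝ)⁻¹ • (∑ i ∈ Finset.range N,
      (μ[U T M μ i β (αstar β) | T.sigmaL i]) ω)) atTop (fun _ => m β)) ∧
  ∀ ε : ℝ, 0 < ε → WithHighProb μ fun N ω => ∀ β ∈ B,
    ‖(N : ℝ)⁻¹ • (∑ i ∈ Finset.range N, U T M μ i β (αhatAt N β ω) ω) - m β‖ ≤ ε

/-- `lim N⁻¹ ∑ E[F_i | L_i] = A` in probability, entrywise, for random matrices `F_i`. -/
def LimitMeanCond (T : Trial Ω 𝓛 n) (μ : Measure Ω)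
    (F : ℕ → Ω → Matrix (Fin p) (Fin p) ℝ) (A : Matrix (Fin p) (Fin p) ℝ) : Prop :=
  ∀ j k, TendstoInMeasure μ
    (fun (N : ℕ) ω => (N : ℝ)⁻¹ * ∑ i ∈ Finset.range N,
      (μ[fun ω' => F i ω' j k | T.sigmaL i]) ω) atTop (fun _ => A j k)

/-- The limits `J(β)` of the averaged conditional means of `∑ W̃ Xᵀ V(α*(β))⁻¹ X` exist and are
nonsingular uniformly in `β ∈ B`. -/
def UniformlyNonsingular (T : Trial Ω 𝓛 n) (M : WorkingModel 𝓛 n p q r) (μ : Measure Ω)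
    (B : Set (Vec p)) (αstar : Vec p → Vec r)
    (J : Vec p → Matrix (Fin p) (Fin p) ℝ) : Prop :=
  (∀ β ∈ B, LimitMeanCond T μ (fun i => H T M μ i (αstar β)) (J β)) ∧
  ∃ c : ℝ, 0 < c ∧ ∀ β ∈ B, ∀ v : Vec p, c * ‖v‖ ^ 2 ≤ v.ofLp ⬝ᵥ (J β *ᵥ v.ofLp)

end Assumptions

end SMART

end

/-! The heart of the matter is that, at the true mean parameter, the weighted score `∑ W̃ Xᵀ K r` is
centered given the baseline covariates for every weighting matrix `K` that depends on the covariates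
only (`condExp_score_eq_zero`). Given the past, the second-stage probability is the known constant
in the weight and cancels it. Responders and slow responders then recombine into the event that the
first-stage treatment was `a₁`, which is independent of the potential outcome given `L`. Whether `K`
is the inverse of the true covariance is irrelevant.

This has three consequences. With `K = V(α)⁻¹`, and since `U` is affine in `β`, the limit satisfies
`m(β) = J(β)(β* - β)` (`limit_U_eq`). With `K = V(α*)⁻¹`, Lyapunov's theorem gives a central limit
theorem for the scores. With `K` a derivative of `V⁻¹` in the covariance parameters, the sums of
scores are of order `√N`, so estimating `α` has no first-order effect on `β̂`.

Solvability comes before any consistency: the null space of the quadratic form of `∑ H(α)` does not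
depend on `α` in the parameter set, so the law of large numbers at `α*` makes `∑ H(α̂)` invertible
with probability tending to one, and the closed form solves the equations. Consistency follows: the
average of `U(β̂, α̂(β̂))` is zero and uniformly close to `J(β̂)(β* - β̂)`, and `J` is uniformly
coercive.

For normality put `y = √N ‖β̂ - β*‖` and `δ = ‖α̂ - α*‖`, where `δ` tends to zero. A second-order
expansion of `V⁻¹` bounds the linearization error `z` by `o(1) y + O(δ) + O(δ) √N δ`, in
probability. Condition (a) gives `√N δ ≤ O(1) y + O(1)`, so `z ≤ o(1) y + o(1)`, whereas coercivity
gives `c y ≤ O(1) + z`. Absorbing the term in `y` (`SmallInProb.of_self_bound`) yields the rate of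
`β̂` and `z → 0` together, and Slutsky's theorem concludes. -/

namespace SMART

/-! ### Stochastic order calculus and convergence of means -/

section Modes

variable {Ω : Type*} [MeasurableSpace Ω] {μ : Measure Ω}

/-- Here `μ` acts as an outer measure: no event has to be measurable. This matters for events built
from `α̂(β)`, on which no measurability is imposed. -/
theorem WithHighProb.mono {P Q : ℕ → Ω → Prop} (h : WithHighProb μ P)
    (hPQ : ∀ᶠ N in atTop, ∀ᵐ ω ∂μ, P N ω → Q N ω) : WithHighProb μ Q := by
  refine tendsto_of_tendsto_of_tendsto_of_le_of_le' tendsto_const_nhds h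
    (Eventually.of_forall fun _ => zero_le) ?_
  filter_upwards [hPQ] with N hN
  refine measure_mono_ae ?_
  filter_upwards [hN] with ω hω hQ hP using hQ (hω hP)

theorem WithHighProb.of_imp {P Q : ℕ → Ω → Prop} (h : WithHighProb μ P)
    (hPQ : ∀ N ω, P N ω → Q N ω) : WithHighProb μ Q :=
  h.mono (Eventually.of_forall fun N => Eventually.of_forall (hPQ N))

theorem WithHighProb.and {P Q : ℕ → Ω → Prop} (hP : WithHighProb μ P) (hQ : WithHighProb μ Q) :
    WithHighProb μ fun N ω => P N ω ∧ Q N ω := by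
  have := Tendsto.add hP hQ
  rw [add_zero] at this
  refine tendsto_of_tendsto_of_tendsto_of_le_of_le tendsto_const_nhds this
    (fun _ => zero_le) fun N => ?_
  refine le_trans (measure_mono fun ω hω => ?_) (measure_union_le _ _)
  simp only [Set.mem_ofPred_eq, Set.mem_union] at hω ⊢
  tauto

theorem WithHighProb.of_ae {P : ℕ → Ω → Prop} (h : ∀ᶠ N in atTop, ∀ᵐ ω ∂μ, P N ω) :
    WithHighProb μ P := by
  have : WithHighProb μ fun (_ : ℕ) (_ : Ω) => True := by simp [WithHighProb]
  exact this.mono (h.mono fun N hN => hN.mono fun ω hω _ => hω)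

/-- The sequence `ξ` is bounded above by an arbitrarily small positive number, with probability
tending to one. -/
def SmallInProb (μ : Measure Ω) (ξ : ℕ → Ω → ℝ) : Prop :=
  ∀ ε : ℝ, 0 < ε → WithHighProb μ fun N ω => ξ N ω ≤ ε

theorem WithHighProb.exists_eventually_le {P : ℕ → Ω → Prop} (h : WithHighProb μ P) {ε : ℝ}
    (hε : 0 < ε) : ∀ᶠ N in atTop, μ {ω | ¬ P N ω} ≤ ENNReal.ofReal ε :=
  h.eventually (ge_mem_nhds (by simpa using hε))

theorem tendstoInMeasure_iff_smallInProb {E : Type*} [SeminormedAddCommGroup E]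
    {f : ℕ → Ω → E} {g : Ω → E} :
    TendstoInMeasure μ f atTop g ↔ SmallInProb μ fun N ω => ‖f N ω - g ω‖ := by
  rw [tendstoInMeasure_iff_norm]
  refine ⟨fun h ε hε => ?_, fun h ε hε => ?_⟩
  · refine tendsto_of_tendsto_of_tendsto_of_le_of_le tendsto_const_nhds (h ε hε)
      (fun _ => zero_le) fun N => measure_mono fun ω hω => ?_
    exact (not_le.1 hω).le
  · refine tendsto_of_tendsto_of_tendsto_of_le_of_le tendsto_const_nhds (h (ε / 2) (by positivity))
      (fun _ => zero_le) fun N => measure_mono fun ω hω => ?_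
    simp only [Set.mem_ofPred_eq, not_le] at hω ⊢
    linarith

theorem SmallInProb.mono {ξ ζ : ℕ → Ω → ℝ} (h : SmallInProb μ ξ)
    (hle : WithHighProb μ fun N ω => ζ N ω ≤ ξ N ω) : SmallInProb μ ζ := fun ε hε =>
  ((h ε hε).and hle).of_imp fun _ _ h => h.2.trans h.1

theorem BoundedInProb.mono {ξ ζ : ℕ → Ω → ℝ} (h : BoundedInProb μ ξ)
    (hle : WithHighProb μ fun N ω => ζ N ω ≤ ξ N ω) : BoundedInProb μ ζ := fun ε hε => by
  obtain ⟨K, hK⟩ := h (ε / 2) (by positivity)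
  refine ⟨K, ?_⟩
  filter_upwards [hK, hle.exists_eventually_le (half_pos hε)] with N h1 h2
  calc μ {ω | K < ζ N ω} ≤ μ ({ω | K < ξ N ω} ∪ {ω | ¬ ζ N ω ≤ ξ N ω}) := by
        refine measure_mono fun ω hω => ?_
        simp only [Set.mem_ofPred_eq, Set.mem_union, not_le] at hω ⊢
        by_contra! hc
        linarith [hc.1, hc.2]
    _ ≤ _ := measure_union_le _ _
    _ ≤ ENNReal.ofReal (ε / 2) + ENNReal.ofReal (ε / 2) := add_le_add h1 h2
    _ = ENNReal.ofReal ε := by rw [← ENNReal.ofReal_add (by positivity) (by positivity)]; simp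

theorem BoundedInProb.add {ξ ζ : ℕ → Ω → ℝ} (h : BoundedInProb μ ξ) (h' : BoundedInProb μ ζ) :
    BoundedInProb μ fun N ω => ξ N ω + ζ N ω := fun ε hε => by
  obtain ⟨K, hK⟩ := h (ε / 2) (by positivity)
  obtain ⟨K', hK'⟩ := h' (ε / 2) (by positivity)
  refine ⟨K + K', ?_⟩
  filter_upwards [hK, hK'] with N h1 h2
  calc μ {ω | K + K' < ξ N ω + ζ N ω} ≤ μ ({ω | K < ξ N ω} ∪ {ω | K' < ζ N ω}) := by
        refine measure_mono fun ω hω => ?_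
        simp only [Set.mem_ofPred_eq, Set.mem_union] at hω ⊢
        by_contra! hc
        linarith [hc.1, hc.2]
    _ ≤ _ := measure_union_le _ _
    _ ≤ ENNReal.ofReal (ε / 2) + ENNReal.ofReal (ε / 2) := add_le_add h1 h2
    _ = ENNReal.ofReal ε := by rw [← ENNReal.ofReal_add (by positivity) (by positivity)]; simp

theorem BoundedInProb.mul {ξ ζ : ℕ → Ω → ℝ} (h : BoundedInProb μ ξ) (h' : BoundedInProb μ ζ)
    (h0 : ∀ N ω, 0 ≤ ξ N ω) (h0' : ∀ N ω, 0 ≤ ζ N ω) :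
    BoundedInProb μ fun N ω => ξ N ω * ζ N ω := fun ε hε => by
  obtain ⟨K, hK⟩ := h (ε / 2) (by positivity)
  obtain ⟨K', hK'⟩ := h' (ε / 2) (by positivity)
  refine ⟨K * K', ?_⟩
  filter_upwards [hK, hK'] with N h1 h2
  calc μ {ω | K * K' < ξ N ω * ζ N ω} ≤ μ ({ω | K < ξ N ω} ∪ {ω | K' < ζ N ω}) := by
        refine measure_mono fun ω hω => ?_
        simp only [Set.mem_ofPred_eq, Set.mem_union] at hω ⊢
        by_contra! hc
        exact absurd (mul_le_mul hc.1 hc.2 (h0' N ω) ((h0 N ω).trans hc.1)) (not_le.2 hω)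
    _ ≤ _ := measure_union_le _ _
    _ ≤ ENNReal.ofReal (ε / 2) + ENNReal.ofReal (ε / 2) := add_le_add h1 h2
    _ = ENNReal.ofReal ε := by rw [← ENNReal.ofReal_add (by positivity) (by positivity)]; simp

theorem boundedInProb_const (C : ℝ) : BoundedInProb μ fun _ _ => C := fun _ _ =>
  ⟨C, by simp⟩

theorem BoundedInProb.sum {ι : Type*} (s : Finset ι) {ξ : ι → ℕ → Ω → ℝ}
    (h : ∀ i ∈ s, BoundedInProb μ (ξ i)) : BoundedInProb μ fun N ω => ∑ i ∈ s, ξ i N ω := by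
  classical
  induction s using Finset.induction_on with
  | empty => simpa using boundedInProb_const 0
  | insert a s ha ih =>
    simp_rw [Finset.sum_insert ha]
    exact (h a (Finset.mem_insert_self a s)).add
      (ih fun i hi => h i (Finset.mem_insert_of_mem hi))

theorem SmallInProb.boundedInProb {ξ : ℕ → Ω → ℝ} (h : SmallInProb μ ξ) : BoundedInProb μ ξ :=
  (boundedInProb_const 1).mono (h 1 one_pos)

theorem SmallInProb.add {ξ ζ : ℕ → Ω → ℝ} (h : SmallInProb μ ξ) (h' : SmallInProb μ ζ) :
    SmallInProb μ fun N ω => ξ N ω + ζ N ω := fun ε hε =>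
  ((h (ε / 2) (by positivity)).and (h' (ε / 2) (by positivity))).of_imp
    fun N ω hω => by linarith [hω.1, hω.2]

theorem smallInProb_zero : SmallInProb μ fun _ _ => 0 := fun _ hε =>
  .of_ae (Eventually.of_forall fun _ => Eventually.of_forall fun _ => hε.le)

theorem SmallInProb.sum {ι : Type*} (s : Finset ι) {ξ : ι → ℕ → Ω → ℝ}
    (h : ∀ i ∈ s, SmallInProb μ (ξ i)) : SmallInProb μ fun N ω => ∑ i ∈ s, ξ i N ω := by
  classical
  induction s using Finset.induction_on with
  | empty => simpa using smallInProb_zero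
  | insert a s ha ih =>
    simp_rw [Finset.sum_insert ha]
    exact (h a (Finset.mem_insert_self a s)).add
      (ih fun i hi => h i (Finset.mem_insert_of_mem hi))

/-- Only upper tails are controlled, so a sign is needed for `ξ`, through which the upper bound of
`ζ` is multiplied; `ζ` may have any sign. -/
theorem SmallInProb.mul_bounded {ξ ζ : ℕ → Ω → ℝ} (h : SmallInProb μ ξ) (h' : BoundedInProb μ ζ)
    (h0 : ∀ N ω, 0 ≤ ξ N ω) :
    SmallInProb μ fun N ω => ξ N ω * ζ N ω := fun ε hε => by
  refine ENNReal.tendsto_nhds_zero.2 fun η hη => ?_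
  obtain ⟨η', hη'0, hη'⟩ : ∃ η' : ℝ, 0 < η' ∧ ENNReal.ofReal η' ≤ η := by
    rcases eq_or_ne η ⊤ with rfl | hη_top
    · exact ⟨1, one_pos, le_top⟩
    · exact ⟨η.toReal, ENNReal.toReal_pos hη.ne' hη_top, ENNReal.ofReal_toReal_le⟩
  obtain ⟨K, hK⟩ := h' (η' / 2) (by positivity)
  have hK1 : 0 < max K 1 := lt_max_of_lt_right one_pos
  filter_upwards [hK, (h (ε / max K 1) (by positivity)).exists_eventually_le (half_pos hη'0)]
    with N h1 h2
  calc μ {ω | ¬ ξ N ω * ζ N ω ≤ ε} ≤ μ ({ω | K < ζ N ω} ∪ {ω | ¬ ξ N ω ≤ ε / max K 1}) := by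
        refine measure_mono fun ω hω => ?_
        simp only [Set.mem_ofPred_eq, Set.mem_union] at hω ⊢
        by_contra! hc
        refine hω ?_
        calc ξ N ω * ζ N ω ≤ ξ N ω * max K 1 :=
              mul_le_mul_of_nonneg_left (hc.1.trans (le_max_left _ _)) (h0 N ω)
          _ ≤ ε := (le_div_iff₀ hK1).1 hc.2
    _ ≤ _ := measure_union_le _ _
    _ ≤ ENNReal.ofReal (η' / 2) + ENNReal.ofReal (η' / 2) := add_le_add h1 h2
    _ = ENNReal.ofReal η' := by rw [← ENNReal.ofReal_add (by positivity) (by positivity)]; simp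
    _ ≤ η := hη'

/-- Markov's inequality at level `max C 1 / ε`; the maximum keeps the level positive when `C ≤ 0`.
-/
theorem BoundedInProb.of_integral_le {ξ : ℕ → Ω → ℝ} {C : ℝ} (hint : ∀ N, Integrable (ξ N) μ)
    (h0 : ∀ N, 0 ≤ᵐ[μ] ξ N) (hC : ∀ N, ∫ ω, ξ N ω ∂μ ≤ C) : BoundedInProb μ ξ := fun ε hε => by
  have hC1 : 0 < max C 1 := lt_max_of_lt_right one_pos
  refine ⟨max C 1 / ε, Eventually.of_forall fun N => ?_⟩
  have h := mul_meas_ge_le_lintegral₀ (hint N).aemeasurable.ennreal_ofReal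
    (ENNReal.ofReal (max C 1 / ε))
  rw [← ofReal_integral_eq_lintegral_ofReal (hint N) (h0 N)] at h
  have h2 : ENNReal.ofReal (max C 1 / ε) * μ {ω | max C 1 / ε < ξ N ω} ≤
      ENNReal.ofReal (max C 1 / ε) * ENNReal.ofReal ε := by
    rw [← ENNReal.ofReal_mul (by positivity), div_mul_cancel₀ _ hε.ne']
    refine le_trans ?_ (h.trans (ENNReal.ofReal_le_ofReal ((hC N).trans (le_max_left _ _))))
    gcongr
    exact fun h => ENNReal.ofReal_le_ofReal h.le
  have h3 : 0 < max C 1 / ε := by positivity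
  exact (ENNReal.mul_le_mul_iff_right (by simpa using h3) ENNReal.ofReal_ne_top).1 h2

/-- Sequences bounded in `L^p` with `p > 1` are uniformly integrable. -/
theorem unifIntegrable_of_eLpNorm_le {ι : Type*} {ξ : ι → Ω → ℝ} {p : ℝ≥0∞} (hp : 1 < p)
    (hp' : p ≠ ∞) {C : ℝ≥0} (hm : ∀ i, AEStronglyMeasurable (ξ i) μ)
    (hC : ∀ i, eLpNorm (ξ i) p μ ≤ C) : UnifIntegrable ξ 1 μ := by
  intro ε hε
  have hp1 : 1 < p.toReal := by
    simpa using (ENNReal.toReal_lt_toReal ENNReal.one_ne_top hp').2 hp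
  obtain ⟨a, ha⟩ : ∃ a : ℝ, a = 1 - 1 / p.toReal := ⟨_, rfl⟩
  have ha0 : 0 < a := by
    rw [ha]
    have : 1 / p.toReal < 1 := (div_lt_one (by linarith)).2 hp1
    linarith
  -- Hölder bounds the `L¹` norm over `s` by `C μ(s)^a` with `a = 1 - 1/p`; this choice of the
  -- measure bound makes it at most `C ε / (C + 1)`.
  refine ⟨(ε / (C + 1)) ^ a⁻¹, by positivity, fun i s hs hμs => ?_⟩
  rw [eLpNorm_indicator_eq_eLpNorm_restrict hs]
  refine (eLpNorm_le_eLpNorm_mul_rpow_measure_univ hp.le (hm i).restrict).trans ?_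
  simp only [ENNReal.toReal_one, MeasurableSet.univ, Measure.restrict_apply, Set.univ_inter]
  rw [div_one, ← ha]
  calc eLpNorm (ξ i) p (μ.restrict s) * μ s ^ a
      ≤ C * (ENNReal.ofReal ((ε / (C + 1)) ^ a⁻¹)) ^ a := by
        gcongr
        exact (eLpNorm_mono_measure _ Measure.restrict_le_self).trans (hC i)
    _ = ENNReal.ofReal (C * (ε / (C + 1))) := by
        rw [ENNReal.ofReal_rpow_of_nonneg (by positivity) ha0.le, ← Real.rpow_mul (by positivity),
          inv_mul_cancel₀ ha0.ne', Real.rpow_one, ENNReal.ofReal_mul (by positivity),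
          ENNReal.ofReal_coe_nnreal]
    _ ≤ ENNReal.ofReal ε := by
        refine ENNReal.ofReal_le_ofReal ?_
        rw [mul_div_assoc', div_le_iff₀ (by positivity)]
        nlinarith

/-- Convergence in probability to a constant and boundedness in `L^p`, `p > 1`, give convergence
of the expectations. -/
theorem tendsto_integral_of_tendstoInMeasure [IsProbabilityMeasure μ] {ξ : ℕ → Ω → ℝ} {p : ℝ≥0∞}
    (hp : 1 < p) (hp' : p ≠ ∞) {C : ℝ≥0} (hm : ∀ N, AEStronglyMeasurable (ξ N) μ)
    (hC : ∀ N, eLpNorm (ξ N) p μ ≤ C) {a : ℝ} (h : TendstoInMeasure μ ξ atTop fun _ => a) :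
    Tendsto (fun N => ∫ ω, ξ N ω ∂μ) atTop (𝓝 a) := by
  have h1 : Tendsto (fun N => eLpNorm (ξ N - fun _ => a) 1 μ) atTop (𝓝 0) :=
    tendsto_Lp_finite_of_tendstoInMeasure le_rfl ENNReal.one_ne_top hm (memLp_const a)
      (unifIntegrable_of_eLpNorm_le hp hp' hm hC) h
  have hi : ∀ N, Integrable (ξ N) μ := fun N =>
    memLp_one_iff_integrable.1 (MemLp.mono_exponent
      (⟨hm N, (hC N).trans_lt ENNReal.coe_lt_top⟩ : MemLp (ξ N) p μ) hp.le)
  have := tendsto_integral_of_L1' (fun _ => a) aestronglyMeasurable_const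
    (Eventually.of_forall hi) h1
  simpa using this

end Modes

/-! ### Lyapunov's central limit theorem -/

section CentralLimit

/-- Exchange one factor at a time; the other factors lie in the closed unit disc. It compares a
product of characteristic functions with its Gaussian counterpart. -/
theorem norm_prod_sub_prod_le {ι : Type*} (s : Finset ι) {z w : ι → ℂ}
    (hz : ∀ i ∈ s, ‖z i‖ ≤ 1) (hw : ∀ i ∈ s, ‖w i‖ ≤ 1) :
    ‖∏ i ∈ s, z i - ∏ i ∈ s, w i‖ ≤ ∑ i ∈ s, ‖z i - w i‖ := by
  classical
  induction s using Finset.induction_on with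
  | empty => simp
  | insert a s ha ih =>
    rw [Finset.prod_insert ha, Finset.prod_insert ha, Finset.sum_insert ha]
    have h1 : ‖∏ i ∈ s, z i‖ ≤ 1 := by
      rw [norm_prod]
      exact Finset.prod_le_one (fun _ _ => norm_nonneg _)
        fun i hi => hz i (Finset.mem_insert_of_mem hi)
    have h2 := hw a (Finset.mem_insert_self a s)
    have h3 := ih (fun i hi => hz i (Finset.mem_insert_of_mem hi))
      (fun i hi => hw i (Finset.mem_insert_of_mem hi))
    calc ‖z a * ∏ i ∈ s, z i - w a * ∏ i ∈ s, w i‖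
        = ‖(z a - w a) * ∏ i ∈ s, z i + w a * (∏ i ∈ s, z i - ∏ i ∈ s, w i)‖ := by ring_nf
      _ ≤ ‖z a - w a‖ * ‖∏ i ∈ s, z i‖ + ‖w a‖ * ‖∏ i ∈ s, z i - ∏ i ∈ s, w i‖ := by
        rw [← norm_mul, ← norm_mul]; exact norm_add_le _ _
      _ ≤ ‖z a - w a‖ * 1 + 1 * ∑ i ∈ s, ‖z i - w i‖ := by gcongr
      _ = _ := by ring

/-- For `|x| ≤ 1` the Taylor remainder is cubic, and `η ≤ 1` gives `|x|³ ≤ |x|^(2+η)`. For `|x| ≥ 1`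
the exponential and its Taylor polynomial are each of order `|x|²` at most. The constant 4 serves
both ranges. -/
theorem norm_exp_mul_I_sub_taylor_le {η : ℝ} (hη0 : 0 ≤ η) (hη1 : η ≤ 1) (x : ℝ) :
    ‖Complex.exp (x * Complex.I) - (1 + x * Complex.I - x ^ 2 / 2)‖ ≤ 4 * |x| ^ (2 + η) := by
  rcases le_total |x| 1 with hx | hx
  · have hx' : ‖(x : ℂ) * Complex.I‖ ≤ 1 := by simpa using hx
    have h := Complex.exp_bound hx' (n := 3) (by norm_num)
    have e : ∑ m ∈ Finset.range 3, ((x : ℂ) * Complex.I) ^ m / (m.factorial : ℂ) =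
        1 + x * Complex.I - x ^ 2 / 2 := by
      simp [Finset.sum_range_succ, mul_pow, Nat.factorial]
      ring
    rw [e] at h
    refine h.trans ?_
    have h3 : |x| ^ 3 ≤ |x| ^ (2 + η) := by
      rcases (abs_nonneg x).eq_or_lt with h0 | h0
      · rw [← h0, Real.zero_rpow (by linarith)]; simp
      · rw [← Real.rpow_natCast]
        exact Real.rpow_le_rpow_of_exponent_ge h0 hx (by push_cast; linarith)
    simp only [norm_mul, Complex.norm_real, Real.norm_eq_abs, Complex.norm_I, mul_one]
    have h4 : ((Nat.succ 3 : ℝ) * ((Nat.factorial 3 : ℝ) * (3 : ℕ))⁻¹) ≤ 4 := by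
      norm_num [Nat.factorial]
    have h5 : 0 ≤ |x| ^ 3 := by positivity
    calc _ ≤ |x| ^ 3 * 4 := mul_le_mul_of_nonneg_left h4 h5
      _ ≤ _ := by linarith
  · have h2 : |x| ^ 2 ≤ |x| ^ (2 + η) := by
      rw [← Real.rpow_natCast]
      exact Real.rpow_le_rpow_of_exponent_le hx (by push_cast; linarith)
    have h1 : ‖Complex.exp (x * Complex.I)‖ = 1 := Complex.norm_exp_ofReal_mul_I x
    have h3 : ‖(1 + x * Complex.I - x ^ 2 / 2 : ℂ)‖ ≤ 1 + |x| + |x| ^ 2 / 2 := by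
      refine (norm_sub_le _ _).trans (add_le_add ((norm_add_le _ _).trans ?_) ?_) <;> simp
    calc _ ≤ ‖Complex.exp (x * Complex.I)‖ + ‖(1 + x * Complex.I - x ^ 2 / 2 : ℂ)‖ :=
          norm_sub_le _ _
      _ ≤ 1 + (1 + |x| + |x| ^ 2 / 2) := by rw [h1]; linarith
      _ ≤ 4 * |x| ^ 2 := by nlinarith
      _ ≤ _ := by linarith

theorem sq_le_one_add_rpow {η : ℝ} (hη0 : 0 ≤ η) (x : ℝ) : x ^ 2 ≤ 1 + |x| ^ (2 + η) := by
  have h0 : 0 ≤ |x| ^ (2 + η) := by positivity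
  rcases le_total |x| 1 with hx | hx
  · have : x ^ 2 ≤ 1 := by rw [← sq_abs]; exact pow_le_one₀ (abs_nonneg _) hx
    linarith
  · have h2 : |x| ^ 2 ≤ |x| ^ (2 + η) := by
      rw [← Real.rpow_natCast]
      exact Real.rpow_le_rpow_of_exponent_le hx (by push_cast; linarith)
    rw [sq_abs] at h2
    linarith

variable {Ω : Type*} [MeasurableSpace Ω] {μ : Measure Ω} [IsProbabilityMeasure μ]

/-- The Taylor bound is integrated; centering removes the linear term. -/
theorem norm_charFun_sub_le {X : Ω → ℝ} {η C : ℝ} (hη0 : 0 ≤ η) (hη1 : η ≤ 1)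
    (hX : AEMeasurable X μ) (hint : Integrable (fun ω => |X ω| ^ (2 + η)) μ)
    (hC : ∫ ω, |X ω| ^ (2 + η) ∂μ ≤ C) (h0 : ∫ ω, X ω ∂μ = 0) {s : ℝ} (hs : 0 ≤ s) :
    ‖charFun (μ.map X) s - (1 - s ^ 2 * (∫ ω, X ω ^ 2 ∂μ) / 2 : ℝ)‖ ≤ 4 * C * s ^ (2 + η) := by
  have hsq : Integrable (fun ω => X ω ^ 2) μ := by
    refine ((integrable_const (1 : ℝ)).add hint).mono (hX.pow_const 2).aestronglyMeasurable ?_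
    refine Eventually.of_forall fun ω => ?_
    have h0 : 0 ≤ |X ω| ^ (2 + η) := by positivity
    simp only [Pi.add_apply, Real.norm_eq_abs]
    rw [abs_of_nonneg (sq_nonneg _), abs_of_nonneg (by linarith)]
    exact sq_le_one_add_rpow hη0 _
  have hone : Integrable X μ := by
    refine ((integrable_const (1 : ℝ)).add hsq).mono hX.aestronglyMeasurable ?_
    refine Eventually.of_forall fun ω => ?_
    simp only [Pi.add_apply, Real.norm_eq_abs]
    rw [abs_of_nonneg (by positivity : 0 ≤ 1 + X ω ^ 2)]
    nlinarith [sq_abs (X ω), sq_nonneg (|X ω| - 1)]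
  have hexp : Integrable (fun ω => Complex.exp ((s * X ω : ℝ) * Complex.I)) μ := by
    refine Integrable.of_bound (C := 1) ?_ (Eventually.of_forall fun ω => ?_)
    · exact (Complex.measurable_exp.comp_aemeasurable
        ((Complex.measurable_ofReal.comp_aemeasurable (hX.const_mul s)).mul_const
          _)).aestronglyMeasurable
    · exact (Complex.norm_exp_ofReal_mul_I _).le
  have hT : Integrable (fun ω => (1 + (s * X ω : ℝ) * Complex.I - (s * X ω : ℝ) ^ 2 / 2 : ℂ)) μ := by
    refine ((integrable_const _).add ((hone.const_mul s).ofReal.mul_const _)).sub ?_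
    have := ((hsq.const_mul (s ^ 2 / 2)).ofReal (𝕜 := ℂ))
    refine this.congr (Eventually.of_forall fun ω => ?_)
    change ((s ^ 2 / 2 * X ω ^ 2 : ℝ) : ℂ) = _
    push_cast
    ring
  have e1 : charFun (μ.map X) s = ∫ ω, Complex.exp ((s * X ω : ℝ) * Complex.I) ∂μ := by
    rw [charFun_apply_real, integral_map hX (by fun_prop)]
    simp
  have e2 : ((1 - s ^ 2 * (∫ ω, X ω ^ 2 ∂μ) / 2 : ℝ) : ℂ) =
      ∫ ω, (1 + (s * X ω : ℝ) * Complex.I - (s * X ω : ℝ) ^ 2 / 2 : ℂ) ∂μ := by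
    have e3 : ∫ ω, (1 + (s * X ω : ℝ) * Complex.I - (s * X ω : ℝ) ^ 2 / 2 : ℂ) ∂μ =
        ∫ ω, ((1 - s ^ 2 * X ω ^ 2 / 2 : ℝ) : ℂ) + ((s * X ω : ℝ) : ℂ) * Complex.I ∂μ := by
      congr 1; ext ω; push_cast; ring
    rw [e3, integral_add, integral_mul_const, integral_complex_ofReal, integral_complex_ofReal,
      integral_const_mul, h0, integral_sub, integral_div, integral_const_mul]
    · simp
    · exact integrable_const _
    · exact (hsq.const_mul _).div_const _
    · exact (((integrable_const _).sub ((hsq.const_mul _).div_const _))).ofReal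
    · exact (hone.const_mul s).ofReal.mul_const _
  rw [e1, e2, ← integral_sub hexp hT]
  refine (norm_integral_le_integral_norm _).trans ?_
  calc ∫ ω, ‖Complex.exp ((s * X ω : ℝ) * Complex.I) -
        (1 + (s * X ω : ℝ) * Complex.I - (s * X ω : ℝ) ^ 2 / 2 : ℂ)‖ ∂μ
      ≤ ∫ ω, 4 * s ^ (2 + η) * |X ω| ^ (2 + η) ∂μ := by
        refine integral_mono (hexp.sub hT).norm (hint.const_mul _) fun ω => ?_
        refine (norm_exp_mul_I_sub_taylor_le hη0 hη1 (s * X ω)).trans (le_of_eq ?_)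
        rw [abs_mul, abs_of_nonneg hs, Real.mul_rpow hs (abs_nonneg _)]
        ring
    _ = 4 * s ^ (2 + η) * ∫ ω, |X ω| ^ (2 + η) ∂μ := integral_const_mul _ _
    _ ≤ 4 * s ^ (2 + η) * C := by gcongr
    _ = _ := by ring

/-- **Lyapunov's central limit theorem**, at the level of the characteristic functions of
normalized sums of independent centered random variables that are bounded in `L^(2 + η)`. -/
theorem tendsto_charFun_inv_sqrt_mul_sum {X : ℕ → Ω → ℝ} {η C v : ℝ} (hη0 : 0 < η) (hη1 : η ≤ 1)
    (hX : ∀ i, AEMeasurable (X i) μ) (hindep : iIndepFun X μ)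
    (hint : ∀ i, Integrable (fun ω => |X i ω| ^ (2 + η)) μ)
    (hC : ∀ i, ∫ ω, |X i ω| ^ (2 + η) ∂μ ≤ C) (h0 : ∀ i, ∫ ω, X i ω ∂μ = 0)
    (hv : Tendsto (fun N : ℕ => (N : ℝ)⁻¹ * ∑ i ∈ Finset.range N, ∫ ω, X i ω ^ 2 ∂μ) atTop (𝓝 v)) :
    Tendsto (fun N : ℕ => charFun (μ.map fun ω => (√N)⁻¹ * ∑ i ∈ Finset.range N, X i ω) 1) atTop
      (𝓝 (Complex.exp (-(v / 2)))) := by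
  have hC0 : 0 ≤ C := (integral_nonneg fun ω => by positivity).trans (hC 0)
  have hsq0 : ∀ i, 0 ≤ ∫ ω, X i ω ^ 2 ∂μ := fun i => integral_nonneg fun ω => sq_nonneg _
  have hsq : ∀ i, ∫ ω, X i ω ^ 2 ∂μ ≤ 1 + C := fun i => by
    calc ∫ ω, X i ω ^ 2 ∂μ ≤ ∫ ω, 1 + |X i ω| ^ (2 + η) ∂μ :=
          integral_mono_of_nonneg (Eventually.of_forall fun ω => sq_nonneg _)
            ((integrable_const _).add (hint i))
            (Eventually.of_forall fun ω => sq_le_one_add_rpow hη0.le _)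
      _ = 1 + ∫ ω, |X i ω| ^ (2 + η) ∂μ := by
          rw [integral_add (integrable_const _) (hint i)]; simp
      _ ≤ _ := by linarith [hC i]
  have hw : Tendsto (fun N : ℕ => ∏ i ∈ Finset.range N,
      Complex.exp (-(((N : ℝ)⁻¹ * ∫ ω, X i ω ^ 2 ∂μ) / 2 : ℝ))) atTop
      (𝓝 (Complex.exp (-(v / 2)))) := by
    have h1 : Tendsto (fun N : ℕ =>
        -(((N : ℝ)⁻¹ * ∑ i ∈ Finset.range N, ∫ ω, X i ω ^ 2 ∂μ) / 2)) atTop (𝓝 (-(v / 2))) :=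
      (hv.div_const 2).neg
    have h2 := (Complex.continuous_exp.tendsto _).comp
      ((Complex.continuous_ofReal.tendsto _).comp h1)
    convert h2 using 1
    · ext N
      simp only [Function.comp_apply]
      rw [← Complex.exp_sum]
      congr 1
      push_cast
      rw [Finset.mul_sum, Finset.sum_div, Finset.sum_neg_distrib]
    · push_cast; rfl
  have hdiff : Tendsto (fun N : ℕ =>
      charFun (μ.map fun ω => (√N)⁻¹ * ∑ i ∈ Finset.range N, X i ω) 1 -
        ∏ i ∈ Finset.range N, Complex.exp (-(((N : ℝ)⁻¹ * ∫ ω, X i ω ^ 2 ∂μ) / 2 : ℝ)))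
      atTop (𝓝 0) := by
    -- The two errors, each summed over `N` factors: Taylor expansion of the characteristic
    -- functions at `N^(-1/2)`, and replacement of `1 - x` by `exp (-x)`, which costs at most `x²`
    -- with `x ≤ (1 + C) / N`.
    have hb : Tendsto (fun N : ℕ => 4 * C * (N : ℝ) ^ (-(η / 2)) +
        (1 + C) ^ 2 * (N : ℝ)⁻¹) atTop (𝓝 0) := by
      have h1 : Tendsto (fun N : ℕ => (N : ℝ) ^ (-(η / 2))) atTop (𝓝 0) :=
        (tendsto_rpow_neg_atTop (half_pos hη0)).comp tendsto_natCast_atTop_atTop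
      have h2 : Tendsto (fun N : ℕ => (N : ℝ)⁻¹) atTop (𝓝 0) :=
        tendsto_inv_atTop_zero.comp tendsto_natCast_atTop_atTop
      simpa using (h1.const_mul (4 * C)).add (h2.const_mul ((1 + C) ^ 2))
    refine squeeze_zero_norm' ?_ hb
    -- This ensures `x ≤ 1`, the range in which `exp (-x)` differs from `1 - x` by at most `x²`.
    have hlarge : ∀ᶠ N : ℕ in atTop, 1 + C ≤ (N : ℝ) :=
      tendsto_natCast_atTop_atTop.eventually_ge_atTop _
    filter_upwards [hlarge, eventually_ge_atTop 1] with N hN hN1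
    have hNpos : (0 : ℝ) < N := by exact_mod_cast hN1
    have hprod : charFun (μ.map fun ω => (√N)⁻¹ * ∑ i ∈ Finset.range N, X i ω) 1 =
        ∏ i ∈ Finset.range N, charFun (μ.map (X i)) (√N)⁻¹ := by
      rw [charFun_map_mul_comp, (hindep.restrict _).charFun_map_fun_finsetSum_eq_prod
        (fun i _ => hX i)]
      · simp
      · exact Finset.aemeasurable_fun_sum _ fun i _ => hX i
    have hs2 : ((√(N : ℝ))⁻¹) ^ 2 = (N : ℝ)⁻¹ := by
      rw [inv_pow, Real.sq_sqrt hNpos.le]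
    have hsη : ((√(N : ℝ))⁻¹) ^ (2 + η) = (N : ℝ)⁻¹ * (N : ℝ) ^ (-(η / 2)) := by
      rw [Real.rpow_add (by positivity), Real.rpow_two, hs2, Real.sqrt_eq_rpow,
        ← Real.rpow_neg hNpos.le, ← Real.rpow_mul hNpos.le]
      congr 2
      ring
    rw [hprod]
    refine (norm_prod_sub_prod_le _ (fun i _ => ?_) fun i _ => ?_).trans ?_
    · have := Measure.isProbabilityMeasure_map (μ := μ) (hX i)
      exact norm_charFun_le_one _
    · rw [← Complex.ofReal_neg, ← Complex.ofReal_exp, Complex.norm_real, Real.norm_eq_abs, Real.abs_exp]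
      refine Real.exp_le_one_iff.2 ?_
      have := hsq0 i
      have : 0 ≤ (N : ℝ)⁻¹ * ∫ ω, X i ω ^ 2 ∂μ := by positivity
      linarith
    · have hterm : ∀ i ∈ Finset.range N, ‖charFun (μ.map (X i)) (√N)⁻¹ -
          Complex.exp (-(((N : ℝ)⁻¹ * ∫ ω, X i ω ^ 2 ∂μ) / 2 : ℝ))‖ ≤
          (N : ℝ)⁻¹ * (4 * C * (N : ℝ) ^ (-(η / 2)) + (1 + C) ^ 2 * (N : ℝ)⁻¹) := fun i _ => by
        set x : ℝ := ((N : ℝ)⁻¹ * ∫ ω, X i ω ^ 2 ∂μ) / 2 with hx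
        have hxle : x ≤ (N : ℝ)⁻¹ * (1 + C) := by
          have h1 := mul_le_mul_of_nonneg_left (hsq i) (inv_nonneg.2 hNpos.le)
          have h2 : 0 ≤ (N : ℝ)⁻¹ * (1 + C) := by positivity
          rw [hx]; linarith
        have hx0 : 0 ≤ x := by
          have := hsq0 i
          positivity
        have hx1 : x ≤ 1 := hxle.trans (by
          rw [inv_mul_le_iff₀ hNpos]; linarith)
        have h1 := norm_charFun_sub_le (s := (√(N : ℝ))⁻¹) hη0.le hη1 (hX i) (hint i) (hC i) (h0 i)
          (by positivity)
        rw [hs2, hsη] at h1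
        have h2 : ‖((1 - x : ℝ) : ℂ) - Complex.exp (-(x : ℝ))‖ ≤ x ^ 2 := by
          rw [← Complex.ofReal_neg, ← Complex.ofReal_exp, ← Complex.ofReal_sub,
            Complex.norm_real, Real.norm_eq_abs, abs_sub_comm]
          have := Real.abs_exp_sub_one_sub_id_le (x := -x) (by rwa [abs_neg, abs_of_nonneg hx0])
          rw [neg_sq] at this
          convert this using 2
          ring
        have h3 : x ^ 2 ≤ ((N : ℝ)⁻¹ * (1 + C)) ^ 2 := by gcongr
        calc _ ≤ ‖charFun (μ.map (X i)) (√N)⁻¹ - ((1 - x : ℝ) : ℂ)‖ +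
              ‖((1 - x : ℝ) : ℂ) - Complex.exp (-(x : ℝ))‖ := norm_sub_le_norm_sub_add_norm_sub ..
          _ ≤ 4 * C * ((N : ℝ)⁻¹ * (N : ℝ) ^ (-(η / 2))) + ((N : ℝ)⁻¹ * (1 + C)) ^ 2 := by
              gcongr
              exact h2.trans h3
          _ = _ := by ring
      refine (Finset.sum_le_sum hterm).trans (le_of_eq ?_)
      rw [Finset.sum_const, Finset.card_range, nsmul_eq_mul, ← mul_assoc,
        mul_inv_cancel₀ hNpos.ne', one_mul]
  simpa using hdiff.add hw

end CentralLimit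

/-! ### Integration under conditional independence -/

section CondIndep

variable {Ω : Type*} {m mΩ : MeasurableSpace Ω} {μ : Measure Ω}
  [IsProbabilityMeasure μ]

theorem setIntegral_indicator_mul_of_stronglyMeasurable (hm : m ≤ mΩ)
    {A B : Set Ω} (hA : MeasurableSet A) (hB : MeasurableSet[m] B) {ψ : Ω → ℝ}
    (hψ : StronglyMeasurable[m] ψ) (hint : Integrable ψ μ) :
    ∫ ω in B, A.indicator 1 ω * ψ ω ∂μ = ∫ ω in B, (μ⟦A | m⟧) ω * ψ ω ∂μ := by
  have hA1 : Integrable (A.indicator fun _ => (1 : ℝ)) μ := (integrable_const 1).indicator hA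
  have hi : Integrable ((A.indicator fun _ => (1 : ℝ)) * ψ) μ := by
    refine (hint.indicator hA).congr (Eventually.of_forall fun ω => ?_)
    by_cases h : ω ∈ A <;> simp [h]
  have h1 := condExp_mul_of_stronglyMeasurable_right hψ hi hA1
  calc ∫ ω in B, A.indicator 1 ω * ψ ω ∂μ
      = ∫ ω in B, (μ[(A.indicator fun _ => (1 : ℝ)) * ψ | m]) ω ∂μ :=
        (setIntegral_condExp hm hi hB).symm
    _ = _ := setIntegral_congr_ae (hm _ hB) (h1.mono fun ω hω _ => hω)

theorem condExp_indicator_one_nonneg_le_one {A : Set Ω}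
    (hA : MeasurableSet A) : ∀ᵐ ω ∂μ, 0 ≤ (μ⟦A | m⟧) ω ∧ (μ⟦A | m⟧) ω ≤ 1 := by
  have h0 : 0 ≤ᵐ[μ] μ⟦A | m⟧ := condExp_nonneg (Eventually.of_forall fun ω =>
    Set.indicator_nonneg (fun _ _ => zero_le_one) ω)
  by_cases hm : m ≤ mΩ
  · have h1 : μ⟦A | m⟧ ≤ᵐ[μ] μ[fun _ => (1 : ℝ) | m] := condExp_mono
      ((integrable_const 1).indicator hA) (integrable_const 1) (Eventually.of_forall fun ω =>
        Set.indicator_le_self' (fun _ _ => zero_le_one) ω)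
    rw [condExp_const hm] at h1
    filter_upwards [h0, h1] with ω a b using ⟨a, b⟩
  · rw [condExp_of_not_le hm]; simp

theorem integrable_condExp_indicator_mul {A : Set Ω}
    (hA : MeasurableSet A) {e : Ω → ℝ} (he : Integrable e μ) :
    Integrable (fun ω => (μ⟦A | m⟧) ω * e ω) μ := by
  refine he.bdd_mul (c := 1) integrable_condExp.aestronglyMeasurable ?_
  filter_upwards [condExp_indicator_one_nonneg_le_one (m := m) hA] with ω hω
  rw [Real.norm_eq_abs, abs_of_nonneg hω.1]
  exact hω.2

variable [StandardBorelSpace Ω]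

/-- Integration of `φ(f)` over an event determined by `g`, when `f` and `g` are conditionally
independent. -/
theorem setIntegral_indicator_mul_of_condIndepFun {hm : m ≤ mΩ}
    {E F : Type*} [MeasurableSpace E] [MeasurableSpace F] {f : Ω → E} {g : Ω → F}
    (h : CondIndepFun m hm f g μ) (hf : Measurable f) (hg : Measurable g) {t : Set F}
    (ht : MeasurableSet t) {B : Set Ω} (hB : MeasurableSet[m] B) {φ : E → ℝ} (hφ : Measurable φ) :
    ∫ ω in B, (g ⁻¹' t).indicator 1 ω * φ (f ω) ∂μ =
      ∫ ω in B, (μ⟦g ⁻¹' t | m⟧) ω * φ (f ω) ∂μ := by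
  have hB' := hm _ hB
  have hgt := hg ht
  set P := μ⟦g ⁻¹' t | m⟧ with hP
  have hPint : Integrable P μ := integrable_condExp
  have hP01 := condExp_indicator_one_nonneg_le_one (μ := μ) (m := m) hgt
  have hPm : Measurable[mΩ] P := (stronglyMeasurable_condExp.mono hm).measurable
  -- Both sides integrate `φ` against a law of `f`: on `B ∩ g⁻¹ t`, and on `B` with density `P`. It
  -- suffices that the two laws agree on measurable sets, where conditional independence applies
  -- directly; hence `φ` need not be bounded or integrable.
  have hkey : ((μ.restrict B).restrict (g ⁻¹' t)).map f =
      ((μ.restrict B).withDensity fun ω => ENNReal.ofReal (P ω)).map f := by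
    ext s hs
    have hfs := hf hs
    rw [Measure.map_apply hf hs, Measure.map_apply hf hs, Measure.restrict_apply hfs,
      Measure.restrict_apply (hfs.inter hgt), withDensity_apply _ hfs, Measure.restrict_restrict hfs,
      ← ofReal_integral_eq_lintegral_ofReal hPint.integrableOn
        (ae_restrict_of_ae (hP01.mono fun ω hω => hω.1)),
      ← ENNReal.ofReal_toReal (measure_ne_top μ (f ⁻¹' s ∩ g ⁻¹' t ∩ B))]
    congr 1
    have h1 := (condIndepFun_iff_condExp_inter_preimage_eq_mul hf hg).1 h s t hs ht
    calc μ.real (f ⁻¹' s ∩ g ⁻¹' t ∩ B)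
        = ∫ ω in B, (f ⁻¹' s ∩ g ⁻¹' t).indicator (fun _ => (1 : ℝ)) ω ∂μ := by
          rw [integral_indicator (hfs.inter hgt)]
          simp [Measure.real, Measure.restrict_apply, hfs.inter hgt]
      _ = ∫ ω in B, (μ⟦f ⁻¹' s ∩ g ⁻¹' t | m⟧) ω ∂μ :=
          (setIntegral_condExp hm ((integrable_const 1).indicator (hfs.inter hgt)) hB).symm
      _ = ∫ ω in B, (μ⟦f ⁻¹' s | m⟧) ω * P ω ∂μ :=
          setIntegral_congr_ae hB' (h1.mono fun ω hω _ => hω)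
      _ = ∫ ω in B, (f ⁻¹' s).indicator 1 ω * P ω ∂μ :=
          (setIntegral_indicator_mul_of_stronglyMeasurable hm hfs hB stronglyMeasurable_condExp
            hPint).symm
      _ = ∫ ω in f ⁻¹' s ∩ B, P ω ∂μ := by
          rw [← Measure.restrict_restrict hfs, ← integral_indicator hfs]
          congr 1; ext ω; by_cases h : ω ∈ f ⁻¹' s <;> simp [h]
  calc ∫ ω in B, (g ⁻¹' t).indicator 1 ω * φ (f ω) ∂μ
      = ∫ ω, φ (f ω) ∂((μ.restrict B).restrict (g ⁻¹' t)) := by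
        rw [← integral_indicator hgt]
        congr 1; ext ω; by_cases h : ω ∈ g ⁻¹' t <;> simp [h]
    _ = ∫ y, φ y ∂(((μ.restrict B).restrict (g ⁻¹' t)).map f) :=
        (integral_map hf.aemeasurable hφ.aestronglyMeasurable).symm
    _ = ∫ y, φ y ∂(((μ.restrict B).withDensity fun ω => ENNReal.ofReal (P ω)).map f) := by
        rw [hkey]
    _ = ∫ ω, φ (f ω) ∂((μ.restrict B).withDensity fun ω => ENNReal.ofReal (P ω)) :=
        integral_map hf.aemeasurable hφ.aestronglyMeasurable
    _ = ∫ ω in B, (P ω).toNNReal • φ (f ω) ∂μ :=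
        integral_withDensity_eq_integral_smul hPm.real_toNNReal _
    _ = ∫ ω in B, P ω * φ (f ω) ∂μ := by
        refine setIntegral_congr_ae hB' (hP01.mono fun ω hω _ => ?_)
        rw [NNReal.smul_def, Real.coe_toNNReal _ hω.1, smul_eq_mul]

/-- The form suits residuals, which are an outcome plus a function of the covariates: the first
summand uses conditional independence, the second only measurability with respect to `m`. -/
theorem setIntegral_indicator_mul_add_of_condIndepFun {hm : m ≤ mΩ}
    {E F : Type*} [MeasurableSpace E] [MeasurableSpace F] {f : Ω → E} {g : Ω → F}
    (h : CondIndepFun m hm f g μ) (hf : Measurable f) (hg : Measurable g) {t : Set F}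
    (ht : MeasurableSet t) {B : Set Ω} (hB : MeasurableSet[m] B) {φ : E → ℝ} (hφ : Measurable φ)
    (hφi : Integrable (fun ω => φ (f ω)) μ) {ψ : Ω → ℝ} (hψ : StronglyMeasurable[m] ψ)
    (hψi : Integrable ψ μ) :
    ∫ ω in B, (g ⁻¹' t).indicator 1 ω * (φ (f ω) + ψ ω) ∂μ =
      ∫ ω in B, (μ⟦g ⁻¹' t | m⟧) ω * (φ (f ω) + ψ ω) ∂μ := by
  have hi : ∀ {e : Ω → ℝ}, Integrable e μ →
      Integrable (fun ω => (g ⁻¹' t).indicator 1 ω * e ω) μ := fun {e} he =>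
    (he.indicator (hg ht)).congr (Eventually.of_forall fun ω => by
      by_cases h : ω ∈ g ⁻¹' t <;> simp [h])
  simp_rw [mul_add]
  rw [integral_add (hi hφi).integrableOn (hi hψi).integrableOn,
    integral_add (integrable_condExp_indicator_mul (hg ht) hφi).integrableOn
      (integrable_condExp_indicator_mul (hg ht) hψi).integrableOn,
    setIntegral_indicator_mul_of_condIndepFun h hf hg ht hB hφ,
    setIntegral_indicator_mul_of_stronglyMeasurable hm (hg ht) hB hψ hψi]

/-- On an atom of the conditioning σ-algebra, conditional independence is independence. -/
theorem measure_inter_mul_of_condIndepFun {hm : m ≤ mΩ} {E F : Type*} [MeasurableSpace E]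
    [MeasurableSpace F] {f : Ω → E} {g : Ω → F} (h : CondIndepFun m hm f g μ)
    (hf : Measurable f) (hg : Measurable g) {A : Set Ω} (hA : MeasurableSet[m] A)
    (hatom : ∀ u : Ω → ℝ, Measurable[m] u → ∀ ω ∈ A, ∀ ω' ∈ A, u ω = u ω')
    {s : Set E} (hs : MeasurableSet s) {t : Set F} (ht : MeasurableSet t) :
    μ.real (A ∩ (f ⁻¹' s ∩ g ⁻¹' t)) * μ.real A = μ.real (A ∩ f ⁻¹' s) * μ.real (A ∩ g ⁻¹' t) := by
  have hA' := hm _ hA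
  -- A conditional probability is measurable for the conditioning σ-algebra, hence constant on an
  -- atom.
  obtain ⟨c, hc⟩ : ∃ c, ∀ ω ∈ A, (μ⟦g ⁻¹' t | m⟧) ω = c := by
    rcases A.eq_empty_or_nonempty with rfl | ⟨ω₀, hω₀⟩
    · exact ⟨0, by simp⟩
    · exact ⟨(μ⟦g ⁻¹' t | m⟧) ω₀, fun ω hω =>
        hatom _ stronglyMeasurable_condExp.measurable _ hω _ hω₀⟩
  have hAg : μ.real (A ∩ g ⁻¹' t) = c * μ.real A := by
    calc μ.real (A ∩ g ⁻¹' t) = ∫ ω in A, (g ⁻¹' t).indicator (fun _ => (1 : ℝ)) ω ∂μ := by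
          rw [integral_indicator (hg ht), Measure.restrict_restrict (hg ht)]
          simp [Set.inter_comm]
      _ = ∫ ω in A, (μ⟦g ⁻¹' t | m⟧) ω ∂μ :=
          (setIntegral_condExp hm ((integrable_const 1).indicator (hg ht)) hA).symm
      _ = ∫ _ in A, c ∂μ := setIntegral_congr_fun hA' fun ω hω => hc ω hω
      _ = c * μ.real A := by simp [mul_comm]
  have hAfg : μ.real (A ∩ (f ⁻¹' s ∩ g ⁻¹' t)) = c * μ.real (A ∩ f ⁻¹' s) := by
    calc μ.real (A ∩ (f ⁻¹' s ∩ g ⁻¹' t))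
        = ∫ ω in A, (f ⁻¹' s ∩ g ⁻¹' t).indicator (fun _ => (1 : ℝ)) ω ∂μ := by
          rw [integral_indicator ((hf hs).inter (hg ht)),
            Measure.restrict_restrict ((hf hs).inter (hg ht))]
          simp [Set.inter_comm]
      _ = ∫ ω in A, (g ⁻¹' t).indicator 1 ω * (s.indicator 1 (f ω) : ℝ) ∂μ := by
          congr 1; ext ω
          by_cases h1 : g ω ∈ t <;> by_cases h2 : f ω ∈ s <;> simp [Set.indicator, h1, h2]
      _ = ∫ ω in A, (μ⟦g ⁻¹' t | m⟧) ω * (s.indicator 1 (f ω) : ℝ) ∂μ :=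
          setIntegral_indicator_mul_of_condIndepFun h hf hg ht hA (measurable_one.indicator hs)
      _ = ∫ ω in A, c * (f ⁻¹' s).indicator (fun _ => (1 : ℝ)) ω ∂μ :=
          setIntegral_congr_fun hA' fun ω hω => by
            simp only [hc ω hω]; rfl
      _ = c * μ.real (A ∩ f ⁻¹' s) := by
          rw [integral_const_mul, integral_indicator (hf hs), Measure.restrict_restrict (hf hs)]
          simp [Set.inter_comm]
  rw [hAg, hAfg]
  ring

end CondIndep

/-! ### Inverse probability weighting preserves centering -/

section MeanZero

variable {Ω 𝓛 : Type*} [MeasurableSpace Ω] [MeasurableSpace 𝓛] {n : ℕ → ℕ}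
  {μ : Measure Ω}

instance : DiscreteMeasurableSpace Stage2 := ⟨fun _ => trivial⟩

instance : MeasurableSingletonClass ℤˣ :=
  ⟨fun a => ⟨{(a : ℤ)}, measurableSet_singleton _, by ext b; simp [Units.ext_iff]⟩⟩

/-- This separates responders, who carry the first-stage weight alone, from slow responders, for
whom the second-stage weight must be cancelled. -/
theorem wTilde_eq_indicator (T : Trial Ω 𝓛 n) (i : ℕ) (d : DTR) (ω : Ω) :
    T.wTilde μ i d ω = (T.prob1 μ i d.1)⁻¹ *
      ((T.A1 i ⁻¹' {d.1} ∩ T.R i ⁻¹' {true}).indicator 1 ω +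
        (T.prob2 μ i d)⁻¹ * ((T.A1 i ⁻¹' {d.1} ∩ T.R i ⁻¹' {false}).indicator 1 ω *
          (T.A2 i ⁻¹' {d.2}).indicator 1 ω)) := by
  unfold Trial.wTilde observable Trial.weight
  by_cases h1 : T.A1 i ω = d.1 <;> by_cases h2 : T.A2 i ω = d.2 <;> cases hR : T.R i ω <;>
    simp [Set.indicator, h1, h2, hR]

theorem measurable_wTilde (T : Trial Ω 𝓛 n) (i : ℕ) (d : DTR) :
    Measurable (T.wTilde μ i d) := by
  have e : T.wTilde μ i d = _ := funext (wTilde_eq_indicator T i d)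
  rw [e]
  have h1 := T.measurable_A1 i (measurableSet_singleton d.1)
  have h2 := T.measurable_A2 i (measurableSet_singleton d.2)
  have hR := fun b => T.measurable_R i (measurableSet_singleton b)
  exact ((measurable_one.indicator (h1.inter (hR true))).add
    (((measurable_one.indicator (h1.inter (hR false))).mul
      (measurable_one.indicator h2)).const_mul _)).const_mul _

variable [IsProbabilityMeasure μ] [StandardBorelSpace Ω]

/-- Given the past, the probability of the second-stage assignment is the known one. -/
theorem condExp_secondStage (T : Trial Ω 𝓛 n) (hdesign : SecondStageDesign T μ) (i : ℕ) (d : DTR) :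
    ∀ᵐ ω ∂μ, ω ∈ T.A1 i ⁻¹' {d.1} ∩ T.R i ⁻¹' {false} →
      (μ⟦T.A2 i ⁻¹' {d.2} |
        MeasurableSpace.comap (fun ω => (T.A1 i ω, T.R i ω, T.L i ω)) inferInstance⟧) ω =
        T.prob2 μ i d := by
  obtain ⟨A, hAdef⟩ : ∃ A, A = T.A1 i ⁻¹' {d.1} ∩ T.R i ⁻¹' {false} := ⟨_, rfl⟩
  have hm := ((T.measurable_A1 i).prodMk ((T.measurable_R i).prodMk (T.measurable_L i))).comap_le
  have hA1 : MeasurableSet[MeasurableSpace.comap (fun ω => (T.A1 i ω, T.R i ω, T.L i ω))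
      inferInstance] A :=
    ⟨{d.1} ×ˢ {false} ×ˢ Set.univ, (measurableSet_singleton _).prod
      ((measurableSet_singleton _).prod MeasurableSet.univ), by ext ω; simp [hAdef]⟩
  have hA0 : MeasurableSet[MeasurableSpace.comap (fun ω => (T.A1 i ω, T.R i ω)) inferInstance] A :=
    ⟨{d.1} ×ˢ {false}, (measurableSet_singleton _).prod (measurableSet_singleton _),
      by ext ω; simp [hAdef]⟩
  have hA := hm _ hA1
  have h2 := T.measurable_A2 i (measurableSet_singleton d.2)
  rw [← hAdef]
  have hprob : T.prob2 μ i d = (μ.real A)⁻¹ * μ.real (A ∩ T.A2 i ⁻¹' {d.2}) := by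
    have : {ω | T.A1 i ω = d.1 ∧ T.R i ω = false} = A := by ext ω; simp [hAdef]
    rw [Trial.prob2, this, cond_apply hA, ENNReal.toReal_mul, ENNReal.toReal_inv]
    rfl
  have hcond : (fun ω => A.indicator (fun _ => T.prob2 μ i d) ω) =ᵐ[μ]
      μ[A.indicator ((T.A2 i ⁻¹' {d.2}).indicator fun _ => (1 : ℝ)) |
        MeasurableSpace.comap (fun ω => (T.A1 i ω, T.R i ω, T.L i ω)) inferInstance] := by
    refine ae_eq_condExp_of_forall_setIntegral_eq hm (((integrable_const 1).indicator h2).indicator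
      hA) (fun s _ _ => ((integrable_const _).indicator hA).integrableOn) ?_
      ((stronglyMeasurable_const.indicator hA1).aestronglyMeasurable)
    rintro B ⟨B', hB', rfl⟩ -
    set B := (fun ω => (T.A1 i ω, T.R i ω, T.L i ω)) ⁻¹' B'
    -- On `A` the values of `(A₁, R)` are fixed, so an event of the past meets `A` in an event of
    -- the covariates. The design then gives independence of `A₂` and `L` within the atom `A`.
    obtain ⟨D, hDdef⟩ : ∃ D : Set 𝓛, D = (fun l => (d.1, false, l)) ⁻¹' B' := ⟨_, rfl⟩
    have hD : MeasurableSet D := by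
      rw [hDdef]
      exact (measurable_const.prodMk (measurable_const.prodMk measurable_id)) hB'
    have hAB : A ∩ B = A ∩ T.L i ⁻¹' D := by
      ext ω
      simp only [hAdef, hDdef, B, Set.mem_inter_iff, Set.mem_preimage, Set.mem_singleton_iff]
      constructor
      · rintro ⟨⟨h1, h2⟩, h3⟩; rw [h1, h2] at h3; exact ⟨⟨h1, h2⟩, h3⟩
      · rintro ⟨⟨h1, h2⟩, h3⟩; rw [h1, h2]; exact ⟨⟨rfl, rfl⟩, h3⟩
    have hind := measure_inter_mul_of_condIndepFun (hdesign i).2 (T.measurable_A2 i)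
      (T.measurable_L i) hA0 (fun u hu ω hω ω' hω' => by
        refine hu.factorsThrough ?_
        simp only [hAdef, Set.mem_inter_iff, Set.mem_preimage, Set.mem_singleton_iff] at hω hω'
        simp only [hω.1, hω.2, hω'.1, hω'.2])
      (measurableSet_singleton d.2) hD
    rw [integral_indicator hA, integral_indicator hA, integral_indicator h2,
      Measure.restrict_restrict hA, hAB, Measure.restrict_restrict h2]
    simp only [integral_const, smul_eq_mul, mul_one, measureReal_restrict_apply, MeasurableSet.univ,
      Set.univ_inter]
    have e : T.A2 i ⁻¹' {d.2} ∩ (A ∩ T.L i ⁻¹' D) = A ∩ (T.A2 i ⁻¹' {d.2} ∩ T.L i ⁻¹' D) := by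
      ext; simp; tauto
    rw [e, hprob]
    -- If `A` is null, both integrals vanish, whatever value the elementary conditional probability
    -- takes.
    rcases eq_or_ne (μ.real A) 0 with h0 | h0
    · have hz : ∀ s : Set Ω, μ.real (A ∩ s) = 0 := fun s =>
        measureReal_mono_null Set.inter_subset_left h0
      rw [hz, hz (T.A2 i ⁻¹' {d.2} ∩ T.L i ⁻¹' D), zero_mul]
    · field_simp
      linarith
  have := condExp_indicator (μ := μ) (f := (T.A2 i ⁻¹' {d.2}).indicator fun _ => (1 : ℝ))
    ((integrable_const 1).indicator h2) hA1
  filter_upwards [hcond, this] with ω h1 h2 hω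
  rw [h2] at h1
  simpa [hω] using h1.symm

/-- Weighting by the inverse of the randomization probabilities preserves centering, given the
baseline covariates, of functions of the potential outcomes. -/
theorem condExp_wTilde_mul_eq_zero (T : Trial Ω 𝓛 n) (hdesign : SecondStageDesign T μ)
    (hrand : SequentialRandomization T μ) {i : ℕ} {d : DTR} (hd : d ∈ T.dtrs)
    (hp : T.prob2 μ i d ≠ 0) {φ : Vec (n i) → ℝ} (hφ : Measurable φ)
    (hφi : Integrable (fun ω => φ (T.Ypot i d ω)) μ) {ψ : Ω → ℝ}
    (hψ : StronglyMeasurable[T.sigmaL i] ψ) (hψi : Integrable ψ μ)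
    (h0 : μ[fun ω => φ (T.Ypot i d ω) + ψ ω | T.sigmaL i] =ᵐ[μ] 0) :
    Integrable (fun ω => T.wTilde μ i d ω * (φ (T.Ypot i d ω) + ψ ω)) μ ∧
    μ[fun ω => T.wTilde μ i d ω * (φ (T.Ypot i d ω) + ψ ω) | T.sigmaL i] =ᵐ[μ] 0 := by
  have hm := (T.measurable_L i).comap_le
  have hm1 := ((T.measurable_A1 i).prodMk ((T.measurable_R i).prodMk (T.measurable_L i))).comap_le
  have h1 := T.measurable_A1 i (measurableSet_singleton d.1)
  have h2 := T.measurable_A2 i (measurableSet_singleton d.2)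
  have hR := fun b => T.measurable_R i (measurableSet_singleton b)
  have hle : T.sigmaL i ≤
      MeasurableSpace.comap (fun ω => (T.A1 i ω, T.R i ω, T.L i ω)) inferInstance := by
    rintro _ ⟨s, hs, rfl⟩
    exact ⟨Set.univ ×ˢ Set.univ ×ˢ s, MeasurableSet.univ.prod (MeasurableSet.univ.prod hs),
      by ext; simp⟩
  set e : Ω → ℝ := fun ω => φ (T.Ypot i d ω) + ψ ω with he
  have hei : Integrable e μ := hφi.add hψi
  have hwe : (fun ω => T.wTilde μ i d ω * e ω) = fun ω => (T.prob1 μ i d.1)⁻¹ *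
      ((T.A1 i ⁻¹' {d.1} ∩ T.R i ⁻¹' {true}).indicator e ω + (T.prob2 μ i d)⁻¹ *
        ((T.A1 i ⁻¹' {d.1} ∩ T.R i ⁻¹' {false}).indicator
          (fun ω => (T.A2 i ⁻¹' {d.2}).indicator 1 ω * e ω) ω)) := by
    ext ω
    rw [wTilde_eq_indicator]
    by_cases ha : T.A1 i ω = d.1 <;> cases hr : T.R i ω <;>
      simp [Set.indicator, ha, hr, mul_assoc]
  have hi2 : Integrable (fun ω => (T.A2 i ⁻¹' {d.2}).indicator 1 ω * e ω) μ :=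
    (hei.indicator h2).congr (Eventually.of_forall fun ω => by
      by_cases h : ω ∈ T.A2 i ⁻¹' {d.2} <;> simp [h])
  have hI1 := hei.indicator (h1.inter (hR true))
  have hI2 := hi2.indicator (h1.inter (hR false))
  have hint : Integrable (fun ω => T.wTilde μ i d ω * e ω) μ := by
    rw [hwe]
    exact (hI1.add (hI2.const_mul _)).const_mul _
  refine ⟨hint, ?_⟩
  symm
  refine ae_eq_condExp_of_forall_setIntegral_eq hm hint (fun s _ _ => integrableOn_zero) ?_
    stronglyMeasurable_zero.aestronglyMeasurable
  intro D hD _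
  have hD' := hm _ hD
  -- Given the past, outcome and second-stage assignment are independent and the assignment
  -- probability is the constant `prob2`, which the weight inverts.
  have step2 : ∫ ω in (T.A1 i ⁻¹' {d.1} ∩ T.R i ⁻¹' {false}) ∩ D,
      (T.A2 i ⁻¹' {d.2}).indicator 1 ω * e ω ∂μ =
      T.prob2 μ i d * ∫ ω in (T.A1 i ⁻¹' {d.1} ∩ T.R i ⁻¹' {false}) ∩ D, e ω ∂μ := by
    have hB : MeasurableSet[MeasurableSpace.comap (fun ω => (T.A1 i ω, T.R i ω, T.L i ω))
        inferInstance] ((T.A1 i ⁻¹' {d.1} ∩ T.R i ⁻¹' {false}) ∩ D) := by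
      refine MeasurableSet.inter ?_ (hle _ hD)
      exact ⟨{d.1} ×ˢ {false} ×ˢ Set.univ, (measurableSet_singleton _).prod
        ((measurableSet_singleton _).prod MeasurableSet.univ), by ext ω; simp⟩
    rw [setIntegral_indicator_mul_add_of_condIndepFun ((hrand i).2.2 d hd) (T.measurable_Ypot i d)
      (T.measurable_A2 i) (measurableSet_singleton d.2) hB hφ hφi (hψ.mono hle) hψi,
      ← integral_const_mul]
    refine setIntegral_congr_ae (hm1 _ hB) ?_
    filter_upwards [condExp_secondStage T hdesign i d] with ω hω hmem
    rw [hω hmem.1]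
  -- Given `L`, the factor `P(A₁ = a₁ | L)` splits off and multiplies the conditional mean of `e`,
  -- which is zero. This probability may depend on `L`; the first-stage weight is only a constant
  -- factor.
  have step1 : ∫ ω in T.A1 i ⁻¹' {d.1} ∩ D, e ω ∂μ = 0 := by
    calc ∫ ω in T.A1 i ⁻¹' {d.1} ∩ D, e ω ∂μ
        = ∫ ω in D, (T.A1 i ⁻¹' {d.1}).indicator 1 ω * e ω ∂μ := by
          rw [← Measure.restrict_restrict h1, ← integral_indicator h1]
          congr 1; ext ω; by_cases h : ω ∈ T.A1 i ⁻¹' {d.1} <;> simp [h]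
      _ = ∫ ω in D, (μ⟦T.A1 i ⁻¹' {d.1} | T.sigmaL i⟧) ω * e ω ∂μ :=
          setIntegral_indicator_mul_add_of_condIndepFun ((hrand i).1 d hd) (T.measurable_Ypot i d)
            (T.measurable_A1 i) (measurableSet_singleton d.1) hD hφ hφi hψ hψi
      _ = ∫ ω in D, (μ[(μ⟦T.A1 i ⁻¹' {d.1} | T.sigmaL i⟧) * e | T.sigmaL i]) ω ∂μ :=
          (setIntegral_condExp hm (integrable_condExp_indicator_mul h1 hei) hD).symm
      _ = ∫ ω in D, 0 ∂μ := by
          refine setIntegral_congr_ae hD' ?_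
          filter_upwards [condExp_mul_of_stronglyMeasurable_left stronglyMeasurable_condExp
            (integrable_condExp_indicator_mul h1 hei) hei, h0] with ω ha hb _
          rw [ha, Pi.mul_apply, hb]
          simp
      _ = 0 := by simp
  rw [hwe, integral_const_mul, integral_add hI1.integrableOn (hI2.const_mul _).integrableOn,
    integral_const_mul, integral_indicator (h1.inter (hR true)),
    integral_indicator (h1.inter (hR false)), Measure.restrict_restrict (h1.inter (hR true)),
    Measure.restrict_restrict (h1.inter (hR false)), step2, ← mul_assoc, inv_mul_cancel₀ hp, one_mul,
    ← setIntegral_union (by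
      refine Set.disjoint_left.2 fun ω ha hb => ?_
      have := ha.1.2; have := hb.1.2; simp_all) (((h1.inter (hR false))).inter hD')
      hei.integrableOn hei.integrableOn]
  have : T.A1 i ⁻¹' {d.1} ∩ T.R i ⁻¹' {true} ∩ D ∪ T.A1 i ⁻¹' {d.1} ∩ T.R i ⁻¹' {false} ∩ D =
      T.A1 i ⁻¹' {d.1} ∩ D := by
    ext ω
    cases h : T.R i ω <;> simp [h]
  rw [this, step1]
  simp

end MeanZero

/-! ### Measurability of matrix operations -/

section MatrixMeasurability

variable {α : Type*} [MeasurableSpace α]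

theorem measurable_det {m : ℕ} {A : α → Matrix (Fin m) (Fin m) ℝ}
    (hA : ∀ j k, Measurable fun x => A x j k) : Measurable fun x => (A x).det := by
  simp_rw [Matrix.det_apply]
  refine Finset.measurable_fun_sum _ fun s _ => ?_
  simp_rw [Units.smul_def, zsmul_eq_mul]
  exact (Finset.measurable_fun_prod _ fun j _ => hA _ _).const_mul _

/-- Adjugate times the inverse of the determinant: with `0⁻¹ = 0` the formula also covers singular
matrices. -/
theorem measurable_inv_entry {m : ℕ} {A : α → Matrix (Fin m) (Fin m) ℝ}
    (hA : ∀ j k, Measurable fun x => A x j k) (j k : Fin m) :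
    Measurable fun x => (A x)⁻¹ j k := by
  simp_rw [Matrix.inv_def, Ring.inverse_eq_inv', Matrix.smul_apply, Matrix.adjugate_apply,
    smul_eq_mul]
  refine (measurable_det hA).inv.mul (measurable_det fun a b => ?_)
  by_cases h : a = k
  · subst h; simp
  · simpa [Matrix.updateRow_apply, h] using hA a b

theorem measurable_mul_entry {a b c : Type*} [Fintype b] {A : α → Matrix a b ℝ}
    {B : α → Matrix b c ℝ} (hA : ∀ j k, Measurable fun x => A x j k)
    (hB : ∀ j k, Measurable fun x => B x j k) (j : a) (k : c) :
    Measurable fun x => (A x * B x) j k := by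
  simp_rw [Matrix.mul_apply]
  exact Finset.measurable_fun_sum _ fun l _ => (hA _ _).mul (hB _ _)

theorem measurable_mulVec_entry {a b : Type*} [Fintype b] {A : α → Matrix a b ℝ}
    {v : α → b → ℝ} (hA : ∀ j k, Measurable fun x => A x j k)
    (hv : ∀ k, Measurable fun x => v x k) (j : a) :
    Measurable fun x => (A x *ᵥ v x) j := by
  simp_rw [Matrix.mulVec, dotProduct]
  exact Finset.measurable_fun_sum _ fun l _ => (hA _ _).mul (hv _)

theorem measurable_frob {a b : ℕ} {A : α → Matrix (Fin a) (Fin b) ℝ}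
    (hA : ∀ j k, Measurable fun x => A x j k) : Measurable fun x => frob (A x) := by
  unfold frob
  exact (Finset.measurable_fun_sum _ fun j _ => Finset.measurable_fun_sum _ fun k _ =>
    (hA j k).pow_const 2).sqrt

end MatrixMeasurability

/-! ### Operator norm bounds for the working covariance -/

section MatrixNorm

open scoped Matrix.Norms.L2Operator

theorem frob_nonneg {a b : ℕ} (A : Matrix (Fin a) (Fin b) ℝ) : 0 ≤ frob A := Real.sqrt_nonneg _

theorem l2_opNorm_le_of_forall {a b : ℕ} {A : Matrix (Fin a) (Fin b) ℝ} {c : ℝ} (hc : 0 ≤ c)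
    (h : ∀ v : Vec b, ‖(WithLp.toLp 2 (A *ᵥ v.ofLp) : Vec a)‖ ≤ c * ‖v‖) : ‖A‖ ≤ c := by
  rw [Matrix.l2_opNorm_def]
  exact ContinuousLinearMap.opNorm_le_bound _ hc h

theorem l2_opNorm_le_frob {a b : ℕ} (A : Matrix (Fin a) (Fin b) ℝ) : ‖A‖ ≤ frob A := by
  refine l2_opNorm_le_of_forall (frob_nonneg A) fun v => ?_
  rw [EuclideanSpace.norm_eq, EuclideanSpace.norm_eq, frob]
  refine (Real.sqrt_le_sqrt ?_).trans (le_of_eq (Real.sqrt_mul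
    (Finset.sum_nonneg fun i _ => Finset.sum_nonneg fun j _ => sq_nonneg _) _))
  rw [Finset.sum_mul]
  refine Finset.sum_le_sum fun i _ => ?_
  simp only [Real.norm_eq_abs, sq_abs, Matrix.mulVec, dotProduct]
  exact Finset.sum_mul_sq_le_sq_mul_sq _ _ _

theorem l2_opNorm_transpose {a b : ℕ} (A : Matrix (Fin a) (Fin b) ℝ) : ‖Aᵀ‖ = ‖A‖ := by
  rw [← Matrix.conjTranspose_eq_transpose_of_trivial, Matrix.l2_opNorm_conjTranspose]

theorem frob_le_sum_abs {a b : ℕ} (A : Matrix (Fin a) (Fin b) ℝ) :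
    frob A ≤ ∑ i, ∑ j, |A i j| := by
  have h0 : 0 ≤ ∑ i, ∑ j, |A i j| :=
    Finset.sum_nonneg fun i _ => Finset.sum_nonneg fun j _ => abs_nonneg _
  refine Real.sqrt_le_iff.2 ⟨h0, ?_⟩
  rw [← Finset.sum_product', ← Finset.sum_product', ]
  simp_rw [← sq_abs (A _ _)]
  exact Finset.sum_sq_le_sq_sum_of_nonneg fun _ _ => abs_nonneg _

theorem abs_entry_le_l2_opNorm {a b : ℕ} (A : Matrix (Fin a) (Fin b) ℝ) (j : Fin a) (k : Fin b) :
    |A j k| ≤ ‖A‖ := by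
  have h := Matrix.l2_opNorm_mulVec A (EuclideanSpace.single k (1 : ℝ))
  have h2 := PiLp.norm_apply_le (WithLp.toLp 2 (A *ᵥ (EuclideanSpace.single k (1 : ℝ)).ofLp) : Vec a) j
  rw [PiLp.norm_single, norm_one, mul_one] at h
  refine le_trans (le_of_eq ?_) (h2.trans h)
  simp

theorem inv_sub_inv_eq {m : ℕ} {V W : Matrix (Fin m) (Fin m) ℝ} (hV : IsUnit V.det)
    (hW : IsUnit W.det) : V⁻¹ - W⁻¹ = -(V⁻¹ * (V - W) * W⁻¹) := by
  rw [Matrix.mul_sub, Matrix.nonsing_inv_mul _ hV, Matrix.sub_mul, Matrix.one_mul,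
    Matrix.mul_assoc, Matrix.mul_nonsing_inv _ hW, Matrix.mul_one, neg_sub]

/-- The resolvent identity is substituted into itself. The linear term then contains only `W⁻¹`,
taken at the limit parameter, so that the estimate enters it through `V - W` alone. -/
theorem inv_sub_inv_eq_second_order {m : ℕ} {V W : Matrix (Fin m) (Fin m) ℝ} (hV : IsUnit V.det)
    (hW : IsUnit W.det) :
    V⁻¹ - W⁻¹ = V⁻¹ * (V - W) * W⁻¹ * (V - W) * W⁻¹ - W⁻¹ * (V - W) * W⁻¹ := by
  have h := inv_sub_inv_eq hV hW
  have h2 : V⁻¹ = W⁻¹ - V⁻¹ * (V - W) * W⁻¹ := by rw [sub_eq_add_neg, ← h]; abel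
  calc V⁻¹ - W⁻¹ = -(V⁻¹ * (V - W) * W⁻¹) := h
    _ = -((W⁻¹ - V⁻¹ * (V - W) * W⁻¹) * (V - W) * W⁻¹) := by rw [← h2]
    _ = _ := by simp only [Matrix.sub_mul]; abel

variable {𝓛 : Type*} [MeasurableSpace 𝓛] {n : ℕ → ℕ} {p q r : ℕ} (M : WorkingModel 𝓛 n p q r)

theorem sigmaSq_mul_le_dotProduct_V {α : Vec r} (hα : α ∈ M.params) (i : ℕ) (d : DTR) (l : 𝓛)
    (v : Fin (n i) → ℝ) : M.sigmaSq α * (v ⬝ᵥ v) ≤ v ⬝ᵥ (M.V i d l α *ᵥ v) := by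
  have h := ((M.G_posSemidef α hα).mul_mul_conjTranspose_same (M.Z i d l)).dotProduct_mulVec_nonneg v
  rw [Matrix.conjTranspose_eq_transpose_of_trivial] at h
  simp only [star_trivial] at h
  rw [WorkingModel.V, Matrix.add_mulVec, dotProduct_add, Matrix.smul_mulVec, Matrix.one_mulVec,
    dotProduct_smul, smul_eq_mul]
  linarith

theorem V_posDef {α : Vec r} (hα : α ∈ M.params) (i : ℕ) (d : DTR) (l : 𝓛) :
    (M.V i d l α).PosDef := by
  have h := ((M.G_posSemidef α hα).mul_mul_conjTranspose_same (M.Z i d l))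
  rw [Matrix.conjTranspose_eq_transpose_of_trivial] at h
  exact Matrix.PosDef.posSemidef_add h (Matrix.PosDef.one.smul (M.sigmaSq_pos α hα))

theorem isUnit_det_V {α : Vec r} (hα : α ∈ M.params) (i : ℕ) (d : DTR) (l : 𝓛) :
    IsUnit (M.V i d l α).det := (V_posDef M hα i d l).det_pos.ne'.isUnit

/-- Since `Z G Zᵀ` is positive semidefinite, `V` is at least `σ²` times the identity. The bound is
uniform in participants, covariates and the number of occasions. -/
theorem norm_V_inv_le {α : Vec r} (hα : α ∈ M.params) (i : ℕ) (d : DTR) (l : 𝓛) :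
    ‖(M.V i d l α)⁻¹‖ ≤ (M.sigmaSq α)⁻¹ := by
  have hs := M.sigmaSq_pos α hα
  refine l2_opNorm_le_of_forall (inv_nonneg.2 hs.le) fun x => ?_
  set y : Fin (n i) → ℝ := (M.V i d l α)⁻¹ *ᵥ x.ofLp with hy
  have hVy : M.V i d l α *ᵥ y = x.ofLp := by
    rw [hy, Matrix.mulVec_mulVec, Matrix.mul_nonsing_inv _ (isUnit_det_V M hα i d l),
      Matrix.one_mulVec]
  have h1 := sigmaSq_mul_le_dotProduct_V M hα i d l y
  rw [hVy] at h1
  have h2 : y ⬝ᵥ y = ‖(WithLp.toLp 2 y : Vec (n i))‖ ^ 2 := by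
    rw [EuclideanSpace.real_norm_sq_eq]; simp [dotProduct, sq]
  have h3 : y ⬝ᵥ x.ofLp ≤ ‖(WithLp.toLp 2 y : Vec (n i))‖ * ‖x‖ := by
    have := real_inner_le_norm x (WithLp.toLp 2 y : Vec (n i))
    rw [EuclideanSpace.inner_eq_star_dotProduct, mul_comm] at this
    simpa using this
  rw [h2] at h1
  rw [inv_mul_eq_div, le_div_iff₀ hs]
  rcases (norm_nonneg (WithLp.toLp 2 y : Vec (n i))).eq_or_lt with h0 | h0
  · rw [← h0]; simp
  · nlinarith

/-- The distance between the covariance parameters at `α` and `α₀`. -/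
def covDist (α α₀ : Vec r) : ℝ :=
  (∑ j, ∑ k, |M.G α j k - M.G α₀ j k|) + |M.sigmaSq α - M.sigmaSq α₀|

theorem covDist_nonneg (α α₀ : Vec r) : 0 ≤ covDist M α α₀ :=
  add_nonneg (Finset.sum_nonneg fun _ _ => Finset.sum_nonneg fun _ _ => abs_nonneg _) (abs_nonneg _)

/-- This is the origin of the factor `1 + ‖Z‖²` in the envelope. -/
theorem norm_V_sub_le (i : ℕ) (d : DTR) (l : 𝓛) (α α₀ : Vec r) :
    ‖M.V i d l α - M.V i d l α₀‖ ≤ (1 + frob (M.Z i d l) ^ 2) * covDist M α α₀ := by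
  have e : M.V i d l α - M.V i d l α₀ = M.Z i d l * (M.G α - M.G α₀) * (M.Z i d l)ᵀ +
      (M.sigmaSq α - M.sigmaSq α₀) • (1 : Matrix (Fin (n i)) (Fin (n i)) ℝ) := by
    simp only [WorkingModel.V, Matrix.mul_sub, Matrix.sub_mul, sub_smul]
    abel
  have hG : ‖M.G α - M.G α₀‖ ≤ ∑ j, ∑ k, |M.G α j k - M.G α₀ j k| := by
    refine (l2_opNorm_le_frob _).trans ((frob_le_sum_abs _).trans (le_of_eq ?_))
    simp
  have hZ := l2_opNorm_le_frob (M.Z i d l)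
  have hone : ‖(1 : Matrix (Fin (n i)) (Fin (n i)) ℝ)‖ ≤ 1 :=
    l2_opNorm_le_of_forall zero_le_one fun v => by simp
  have h1 : ‖M.Z i d l * (M.G α - M.G α₀) * (M.Z i d l)ᵀ‖ ≤
      frob (M.Z i d l) * (∑ j, ∑ k, |M.G α j k - M.G α₀ j k|) * frob (M.Z i d l) := by
    refine (Matrix.l2_opNorm_mul _ _).trans ?_
    rw [l2_opNorm_transpose]
    have := (Matrix.l2_opNorm_mul (M.Z i d l) (M.G α - M.G α₀))
    gcongr
    · exact mul_nonneg (frob_nonneg _) (Finset.sum_nonneg fun _ _ =>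
        Finset.sum_nonneg fun _ _ => abs_nonneg _)
    · exact this.trans (by gcongr; exact frob_nonneg _)
  have h2 : ‖(M.sigmaSq α - M.sigmaSq α₀) • (1 : Matrix (Fin (n i)) (Fin (n i)) ℝ)‖ ≤
      |M.sigmaSq α - M.sigmaSq α₀| := by
    rw [norm_smul, Real.norm_eq_abs]
    exact mul_le_of_le_one_right (abs_nonneg _) hone
  rw [e]
  refine (norm_add_le _ _).trans ((add_le_add h1 h2).trans ?_)
  have h3 : 0 ≤ ∑ j, ∑ k, |M.G α j k - M.G α₀ j k| :=
    Finset.sum_nonneg fun _ _ => Finset.sum_nonneg fun _ _ => abs_nonneg _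
  have h4 : 0 ≤ frob (M.Z i d l) ^ 2 * |M.sigmaSq α - M.sigmaSq α₀| := by positivity
  unfold covDist
  nlinarith

/-- Differentiability at the single point `α₀` gives a Lipschitz bound against `α₀`, and continuity
there keeps `σ²` away from zero. The expansion uses nothing else about the parametrization near
`α₀`. -/
theorem exists_covDist_le {α₀ : Vec r} (hα₀ : α₀ ∈ M.params)
    (hG : ∀ j k, DifferentiableAt ℝ (fun α => M.G α j k) α₀)
    (hσ : DifferentiableAt ℝ M.sigmaSq α₀) :
    ∃ ρ : ℝ, 0 < ρ ∧ ∃ C : ℝ, 0 ≤ C ∧ ∀ α, ‖α - α₀‖ < ρ →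
      covDist M α α₀ ≤ C * ‖α - α₀‖ ∧ M.sigmaSq α₀ / 2 ≤ M.sigmaSq α := by
  have hs := M.sigmaSq_pos α₀ hα₀
  have h1 : (fun α => covDist M α α₀) =O[𝓝 α₀] fun α => α - α₀ := by
    unfold covDist
    refine Asymptotics.IsBigO.add ?_ hσ.isBigO_sub.abs_left
    exact Asymptotics.IsBigO.fun_sum fun j _ => Asymptotics.IsBigO.fun_sum fun k _ =>
      (hG j k).isBigO_sub.abs_left
  obtain ⟨C, hC⟩ := h1.bound
  have h2 : ∀ᶠ α in 𝓝 α₀, M.sigmaSq α₀ / 2 < M.sigmaSq α :=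
    hσ.continuousAt.eventually (lt_mem_nhds (by linarith))
  obtain ⟨ρ, hρ, h⟩ := Metric.eventually_nhds_iff.1 (hC.and h2)
  refine ⟨ρ, hρ, max C 0, le_max_right _ _, fun α hα => ?_⟩
  obtain ⟨a, b⟩ := h (by rwa [dist_eq_norm])
  refine ⟨?_, b.le⟩
  rw [Real.norm_eq_abs, abs_of_nonneg (covDist_nonneg M α α₀)] at a
  exact a.trans (mul_le_mul_of_nonneg_right (le_max_left _ _) (norm_nonneg _))

theorem measurable_V_entry (i : ℕ) (d : DTR) (j k : Fin (n i)) :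
    Measurable fun x : 𝓛 × Vec r => M.V i d x.1 x.2 j k := by
  simp only [WorkingModel.V, Matrix.add_apply, Matrix.smul_apply, smul_eq_mul]
  refine Measurable.add (measurable_mul_entry (measurable_mul_entry
    (fun a b => (M.measurable_Z i d a b).comp measurable_fst)
    fun a b => (M.measurable_G a b).comp measurable_snd)
    (fun a b => (M.measurable_Z i d b a).comp measurable_fst) j k) ?_
  exact (M.measurable_sigmaSq.comp measurable_snd).mul_const _

theorem measurable_V_inv_entry (i : ℕ) (d : DTR) (j k : Fin (n i)) :
    Measurable fun x : 𝓛 × Vec r => (M.V i d x.1 x.2)⁻¹ j k :=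
  measurable_inv_entry (measurable_V_entry M i d) j k

end MatrixNorm

end SMART

noncomputable section

namespace SMART

/-! ### Scores and information matrices with arbitrary weighting matrices -/

section Score

variable {Ω 𝓛 : Type*} [MeasurableSpace Ω] [MeasurableSpace 𝓛] {n : ℕ → ℕ} {p q r : ℕ}

/-- The weighted score with the inverse working covariance replaced by a function `K` of the
covariates. -/
def score (T : Trial Ω 𝓛 n) (M : WorkingModel 𝓛 n p q r) (μ : Measure Ω)
    (K : ∀ i : ℕ, DTR → 𝓛 → Matrix (Fin (n i)) (Fin (n i)) ℝ) (i : ℕ) (β : Vec p) (ω : Ω) : Vec p :=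
  ∑ d ∈ T.dtrs, T.wTilde μ i d ω •
    (WithLp.toLp 2 ((M.X i d (T.L i ω))ᵀ *ᵥ
      (K i d (T.L i ω) *ᵥ residual T M i d β ω)) : Vec p)

/-- The weighted information matrix with the inverse working covariance replaced by a function `K`
of the covariates. -/
def info (T : Trial Ω 𝓛 n) (M : WorkingModel 𝓛 n p q r) (μ : Measure Ω)
    (K : ∀ i : ℕ, DTR → 𝓛 → Matrix (Fin (n i)) (Fin (n i)) ℝ) (i : ℕ) (ω : Ω) :
    Matrix (Fin p) (Fin p) ℝ :=
  ∑ d ∈ T.dtrs, T.wTilde μ i d ω •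
    ((M.X i d (T.L i ω))ᵀ * K i d (T.L i ω) * M.X i d (T.L i ω))

/-- The sum of the envelopes over the embedded regimens. -/
def envSum (T : Trial Ω 𝓛 n) (M : WorkingModel 𝓛 n p q r) (i : ℕ) (ω : Ω) : ℝ :=
  ∑ d ∈ T.dtrs, envelope T M i d ω

variable (T : Trial Ω 𝓛 n) (M : WorkingModel 𝓛 n p q r) {μ : Measure Ω}
  {K K' : ∀ i : ℕ, DTR → 𝓛 → Matrix (Fin (n i)) (Fin (n i)) ℝ}

theorem score_apply (i : ℕ) (β : Vec p) (ω : Ω) (a : Fin p) :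
    score T M μ K i β ω a = ∑ d ∈ T.dtrs, T.wTilde μ i d ω *
      ((M.X i d (T.L i ω))ᵀ *ᵥ (K i d (T.L i ω) *ᵥ residual T M i d β ω)) a := by
  simp [score]

theorem info_apply (i : ℕ) (ω : Ω) (a b : Fin p) :
    info T M μ K i ω a b = ∑ d ∈ T.dtrs, T.wTilde μ i d ω *
      ((M.X i d (T.L i ω))ᵀ * K i d (T.L i ω) * M.X i d (T.L i ω)) a b := by
  simp [info, Matrix.sum_apply]

theorem score_eq_add_info (i : ℕ) (β β₀ : Vec p) (ω : Ω) :
    score T M μ K i β ω = score T M μ K i β₀ ω +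
      WithLp.toLp 2 (info T M μ K i ω *ᵥ (β₀ - β).ofLp) := by
  simp only [score, info, Matrix.sum_mulVec, WithLp.toLp_sum, ← Finset.sum_add_distrib]
  refine Finset.sum_congr rfl fun d _ => ?_
  rw [Matrix.smul_mulVec, WithLp.toLp_smul, ← smul_add, ← WithLp.toLp_add]
  congr 2
  simp only [residual, Matrix.mulVec_sub, WithLp.ofLp_sub, Matrix.mulVec_mulVec, Matrix.mul_assoc]
  abel

theorem score_sub (i : ℕ) (β : Vec p) (ω : Ω) :
    score T M μ (fun i d l => K i d l - K' i d l) i β ω =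
      score T M μ K i β ω - score T M μ K' i β ω := by
  simp only [score, ← Finset.sum_sub_distrib, ← smul_sub, ← WithLp.toLp_sub, Matrix.sub_mulVec,
    Matrix.mulVec_sub]

theorem score_add (i : ℕ) (β : Vec p) (ω : Ω) :
    score T M μ (fun i d l => K i d l + K' i d l) i β ω =
      score T M μ K i β ω + score T M μ K' i β ω := by
  simp only [score, ← Finset.sum_add_distrib, ← smul_add, ← WithLp.toLp_add, Matrix.add_mulVec,
    Matrix.mulVec_add]

theorem score_smul (c : ℝ) (i : ℕ) (β : Vec p) (ω : Ω) :
    score T M μ (fun i d l => c • K i d l) i β ω = c • score T M μ K i β ω := by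
  simp only [score, Finset.smul_sum, Matrix.smul_mulVec, Matrix.mulVec_smul, WithLp.toLp_smul]
  exact Finset.sum_congr rfl fun d _ => smul_comm _ _ _

theorem score_sum {ι : Type*} (s : Finset ι)
    (F : ι → ∀ i : ℕ, DTR → 𝓛 → Matrix (Fin (n i)) (Fin (n i)) ℝ) (i : ℕ) (β : Vec p) (ω : Ω) :
    score T M μ (fun i d l => ∑ x ∈ s, F x i d l) i β ω = ∑ x ∈ s, score T M μ (F x) i β ω := by
  simp only [score, Matrix.sum_mulVec, Matrix.mulVec_sum, WithLp.toLp_sum, Finset.smul_sum]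
  exact Finset.sum_comm

theorem info_sub (i : ℕ) (ω : Ω) :
    info T M μ (fun i d l => K i d l - K' i d l) i ω =
      info T M μ K i ω - info T M μ K' i ω := by
  simp only [info, ← Finset.sum_sub_distrib, ← smul_sub, Matrix.mul_sub, Matrix.sub_mul]

theorem envelope_nonneg (i : ℕ) (d : DTR) (ω : Ω) : 0 ≤ envelope T M i d ω := by
  have := frob_nonneg (M.X i d (T.L i ω))
  unfold envelope
  positivity

theorem envSum_nonneg (i : ℕ) (ω : Ω) : 0 ≤ envSum T M i ω :=
  Finset.sum_nonneg fun _ _ => envelope_nonneg T M _ _ _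

theorem sum_envelope_sq_le (i : ℕ) (ω : Ω) :
    ∑ d ∈ T.dtrs, envelope T M i d ω ^ 2 ≤ envSum T M i ω ^ 2 :=
  Finset.sum_sq_le_sq_sum_of_nonneg fun d _ => envelope_nonneg T M i d ω

theorem wTilde_nonneg (i : ℕ) (d : DTR) (ω : Ω) : 0 ≤ T.wTilde μ i d ω := by
  unfold Trial.wTilde observable Trial.weight Trial.prob1 Trial.prob2
  split_ifs <;> positivity

theorem exists_wTilde_le (hpos : Positivity T μ) :
    ∃ w : ℝ, 0 ≤ w ∧ ∀ i, ∀ d ∈ T.dtrs, ∀ ω, T.wTilde μ i d ω ≤ w := by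
  obtain ⟨c, hc, h⟩ := hpos
  -- It dominates both the responder bound `c⁻¹` and the slow-responder bound `c⁻²`.
  refine ⟨c⁻¹ * (1 + c⁻¹), by positivity, fun i d hd ω => ?_⟩
  have h1 : (T.prob1 μ i d.1)⁻¹ ≤ c⁻¹ := inv_anti₀ hc ((h i).1 _)
  have h2 : (T.prob2 μ i d)⁻¹ ≤ c⁻¹ := inv_anti₀ hc ((h i).2 d hd)
  have h10 : 0 ≤ (T.prob1 μ i d.1)⁻¹ := inv_nonneg.2 (hc.le.trans ((h i).1 _))
  have h20 : 0 ≤ (T.prob2 μ i d)⁻¹ := inv_nonneg.2 (hc.le.trans ((h i).2 d hd))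
  have h3 : 0 < c⁻¹ := inv_pos.2 hc
  unfold Trial.wTilde observable Trial.weight
  split_ifs <;> nlinarith

/-- A nonzero weight means that the observed path is compatible with `d`, and consistency then
identifies the outcome. The exceptional null set is common to all participants. -/
theorem ae_outcome_eq (hcons : Consistency T μ) :
    ∀ᵐ ω ∂μ, ∀ i, ∀ d ∈ T.dtrs, T.wTilde μ i d ω ≠ 0 → T.Y i ω = T.Ypot i d ω := by
  filter_upwards [ae_all_iff.2 hcons] with ω hω i d hd hw
  obtain ⟨-, h1, h2⟩ := hω i
  have hobs : T.A1 i ω = d.1 ∧ (T.R i ω = true ∨ T.A2 i ω = d.2) := by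
    by_contra hc
    exact hw (by simp [Trial.wTilde, observable, hc])
  cases hR : T.R i ω with
  | true => exact h1 hR d hd hobs.1.symm
  | false =>
    rw [h2 hR, hobs.1, hobs.2.resolve_left (by simp [hR])]

open scoped Matrix.Norms.L2Operator

/-- The observed outcome contributes only where the weight is nonzero and is replaced there by the
potential outcome, to which the moment condition refers. -/
theorem norm_score_le {w : ℝ} (hw : ∀ i, ∀ d ∈ T.dtrs, ∀ ω, T.wTilde μ i d ω ≤ w) {i : ℕ} {ω : Ω}
    (hω : ∀ d ∈ T.dtrs, T.wTilde μ i d ω ≠ 0 → T.Y i ω = T.Ypot i d ω) (β : Vec p) :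
    ‖score T M μ K i β ω‖ ≤ w * (1 + ‖β‖) * ∑ d ∈ T.dtrs, ‖K i d (T.L i ω)‖ *
      (frob (M.X i d (T.L i ω)) ^ 2 + frob (M.X i d (T.L i ω)) * ‖T.Ypot i d ω‖) := by
  rw [Finset.mul_sum]
  refine norm_sum_le_of_le _ fun d hd => ?_
  have hw0 := wTilde_nonneg T (μ := μ) i d ω
  have hww := hw i d hd ω
  have hX0 := frob_nonneg (M.X i d (T.L i ω))
  have hX := l2_opNorm_le_frob (M.X i d (T.L i ω))
  by_cases h0 : T.wTilde μ i d ω = 0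
  · rw [h0, zero_smul, norm_zero]
    have := hw0.trans hww
    positivity
  have hY := hω d hd h0
  have hr : ‖(WithLp.toLp 2 (residual T M i d β ω) : Vec (n i))‖ ≤
      ‖T.Ypot i d ω‖ + frob (M.X i d (T.L i ω)) * ‖β‖ := by
    have e : (WithLp.toLp 2 (residual T M i d β ω) : Vec (n i)) =
        T.Ypot i d ω - WithLp.toLp 2 (M.X i d (T.L i ω) *ᵥ β.ofLp) := by
      rw [residual, hY]; rfl
    rw [e]
    refine (norm_sub_le _ _).trans (add_le_add_right ?_ _)
    exact (Matrix.l2_opNorm_mulVec _ _).trans (by gcongr)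
  have h1 : ‖(WithLp.toLp 2 ((M.X i d (T.L i ω))ᵀ *ᵥ
      (K i d (T.L i ω) *ᵥ residual T M i d β ω)) : Vec p)‖ ≤
      frob (M.X i d (T.L i ω)) * (‖K i d (T.L i ω)‖ *
        (‖T.Ypot i d ω‖ + frob (M.X i d (T.L i ω)) * ‖β‖)) := by
    refine (Matrix.l2_opNorm_mulVec (M.X i d (T.L i ω))ᵀ
      (WithLp.toLp 2 (K i d (T.L i ω) *ᵥ residual T M i d β ω))).trans ?_
    rw [l2_opNorm_transpose]
    gcongr
    exact (Matrix.l2_opNorm_mulVec (K i d (T.L i ω))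
      (WithLp.toLp 2 (residual T M i d β ω))).trans (by gcongr)
  rw [norm_smul, Real.norm_eq_abs, abs_of_nonneg hw0]
  have h2 : frob (M.X i d (T.L i ω)) * (‖K i d (T.L i ω)‖ *
        (‖T.Ypot i d ω‖ + frob (M.X i d (T.L i ω)) * ‖β‖)) ≤
      (1 + ‖β‖) * (‖K i d (T.L i ω)‖ * (frob (M.X i d (T.L i ω)) ^ 2 +
        frob (M.X i d (T.L i ω)) * ‖T.Ypot i d ω‖)) := by
    have h3 : 0 ≤ ‖K i d (T.L i ω)‖ * frob (M.X i d (T.L i ω)) ^ 2 := by positivity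
    have h4 : 0 ≤ ‖β‖ * (‖K i d (T.L i ω)‖ * (frob (M.X i d (T.L i ω)) * ‖T.Ypot i d ω‖)) := by
      positivity
    nlinarith
  calc _ ≤ w * ((1 + ‖β‖) * (‖K i d (T.L i ω)‖ * (frob (M.X i d (T.L i ω)) ^ 2 +
        frob (M.X i d (T.L i ω)) * ‖T.Ypot i d ω‖))) := by
        have := hw0.trans hww
        exact mul_le_mul hww (h1.trans h2) (norm_nonneg _) this
    _ = _ := by ring

theorem abs_info_le {w : ℝ} (hw : ∀ i, ∀ d ∈ T.dtrs, ∀ ω, T.wTilde μ i d ω ≤ w) (i : ℕ) (ω : Ω)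
    (a b : Fin p) :
    |info T M μ K i ω a b| ≤ w * ∑ d ∈ T.dtrs, ‖K i d (T.L i ω)‖ *
      frob (M.X i d (T.L i ω)) ^ 2 := by
  rw [info_apply, Finset.mul_sum]
  refine (Finset.abs_sum_le_sum_abs _ _).trans (Finset.sum_le_sum fun d hd => ?_)
  have hw0 := wTilde_nonneg T (μ := μ) i d ω
  have hww := hw i d hd ω
  have hX0 := frob_nonneg (M.X i d (T.L i ω))
  have hX := l2_opNorm_le_frob (M.X i d (T.L i ω))
  rw [abs_mul, abs_of_nonneg hw0]
  refine mul_le_mul hww ?_ (abs_nonneg _) (hw0.trans hww)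
  refine (abs_entry_le_l2_opNorm _ _ _).trans ((Matrix.l2_opNorm_mul _ _).trans ?_)
  have h1 := Matrix.l2_opNorm_mul (M.X i d (T.L i ω))ᵀ (K i d (T.L i ω))
  rw [l2_opNorm_transpose] at h1
  calc _ ≤ (frob (M.X i d (T.L i ω)) * ‖K i d (T.L i ω)‖) * frob (M.X i d (T.L i ω)) := by
        gcongr
        exact h1.trans (by gcongr)
    _ = _ := by ring

theorem mul_le_mul_envelope {κ k : ℝ} (hκ : 0 ≤ κ) (i : ℕ) (d : DTR) (ω : Ω)
    (hk : k ≤ κ * (1 + frob (M.Z i d (T.L i ω)) ^ 2)) :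
    k * (frob (M.X i d (T.L i ω)) ^ 2 + frob (M.X i d (T.L i ω)) * ‖T.Ypot i d ω‖) ≤
      κ * envelope T M i d ω := by
  have hX0 := frob_nonneg (M.X i d (T.L i ω))
  unfold envelope
  calc _ ≤ κ * (1 + frob (M.Z i d (T.L i ω)) ^ 2) *
        (1 + frob (M.X i d (T.L i ω)) ^ 2 + frob (M.X i d (T.L i ω)) * ‖T.Ypot i d ω‖) := by
        gcongr
        linarith
    _ = _ := by ring

/-- Meant for the second-order remainder of `V⁻¹`, whose norm is of order `(1 + ‖Z‖²)²`. The first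
factor of the envelope is at least one, so squaring it is harmless. -/
theorem mul_le_mul_envelope_sq {κ k : ℝ} (hκ : 0 ≤ κ) (i : ℕ) (d : DTR) (ω : Ω)
    (hk : k ≤ κ * (1 + frob (M.Z i d (T.L i ω)) ^ 2) ^ 2) :
    k * (frob (M.X i d (T.L i ω)) ^ 2 + frob (M.X i d (T.L i ω)) * ‖T.Ypot i d ω‖) ≤
      κ * envelope T M i d ω ^ 2 := by
  have hX0 := frob_nonneg (M.X i d (T.L i ω))
  have h0 : 0 ≤ frob (M.X i d (T.L i ω)) ^ 2 + frob (M.X i d (T.L i ω)) * ‖T.Ypot i d ω‖ := by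
    positivity
  unfold envelope
  calc _ ≤ κ * (1 + frob (M.Z i d (T.L i ω)) ^ 2) ^ 2 *
        (1 + frob (M.X i d (T.L i ω)) ^ 2 + frob (M.X i d (T.L i ω)) * ‖T.Ypot i d ω‖) ^ 2 := by
        gcongr
        nlinarith
    _ = _ := by ring

theorem norm_score_le_envSum {w κ : ℝ} (hw0 : 0 ≤ w) (hκ : 0 ≤ κ)
    (hw : ∀ i, ∀ d ∈ T.dtrs, ∀ ω, T.wTilde μ i d ω ≤ w)
    (hK : ∀ i d l, ‖K i d l‖ ≤ κ * (1 + frob (M.Z i d l) ^ 2)) {i : ℕ} {ω : Ω}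
    (hω : ∀ d ∈ T.dtrs, T.wTilde μ i d ω ≠ 0 → T.Y i ω = T.Ypot i d ω) (β : Vec p) :
    ‖score T M μ K i β ω‖ ≤ w * (1 + ‖β‖) * κ * envSum T M i ω := by
  refine (norm_score_le T M hw hω β).trans ?_
  rw [mul_assoc _ κ, envSum, Finset.mul_sum _ _ κ]
  exact mul_le_mul_of_nonneg_left (Finset.sum_le_sum fun d _ =>
    mul_le_mul_envelope T M hκ i d ω (hK _ _ _)) (by positivity)

theorem norm_score_le_envSum_sq {w κ : ℝ} (hw0 : 0 ≤ w) (hκ : 0 ≤ κ)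
    (hw : ∀ i, ∀ d ∈ T.dtrs, ∀ ω, T.wTilde μ i d ω ≤ w)
    (hK : ∀ i d l, ‖K i d l‖ ≤ κ * (1 + frob (M.Z i d l) ^ 2) ^ 2) {i : ℕ} {ω : Ω}
    (hω : ∀ d ∈ T.dtrs, T.wTilde μ i d ω ≠ 0 → T.Y i ω = T.Ypot i d ω) (β : Vec p) :
    ‖score T M μ K i β ω‖ ≤ w * (1 + ‖β‖) * κ * envSum T M i ω ^ 2 := by
  refine (norm_score_le T M hw hω β).trans ?_
  rw [mul_assoc _ κ]
  gcongr
  refine le_trans ?_ (mul_le_mul_of_nonneg_left (sum_envelope_sq_le T M i ω) hκ)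
  rw [Finset.mul_sum]
  exact Finset.sum_le_sum fun d _ => mul_le_mul_envelope_sq T M hκ i d ω (hK _ _ _)

theorem abs_info_le_envSum {w κ : ℝ} (hw0 : 0 ≤ w) (hκ : 0 ≤ κ)
    (hw : ∀ i, ∀ d ∈ T.dtrs, ∀ ω, T.wTilde μ i d ω ≤ w)
    (hK : ∀ i d l, ‖K i d l‖ ≤ κ * (1 + frob (M.Z i d l) ^ 2)) (i : ℕ) (ω : Ω) (a b : Fin p) :
    |info T M μ K i ω a b| ≤ w * κ * envSum T M i ω := by
  refine (abs_info_le T M hw i ω a b).trans ?_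
  rw [mul_assoc _ κ, envSum, Finset.mul_sum _ _ κ]
  refine mul_le_mul_of_nonneg_left (Finset.sum_le_sum fun d _ => ?_) hw0
  refine le_trans ?_ (mul_le_mul_envelope T M hκ i d ω (hK _ _ _))
  have hX0 := frob_nonneg (M.X i d (T.L i ω))
  gcongr
  exact le_add_of_nonneg_right (by positivity)

/-- The observed data of participant `i`. -/
def obs (i : ℕ) (ω : Ω) : 𝓛 × ℤˣ × Bool × Stage2 × Vec (n i) :=
  (T.L i ω, T.A1 i ω, T.R i ω, T.A2 i ω, T.Y i ω)

theorem measurable_obs (i : ℕ) : Measurable (obs T i) :=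
  (T.measurable_L i).prodMk ((T.measurable_A1 i).prodMk ((T.measurable_R i).prodMk
    ((T.measurable_A2 i).prodMk (T.measurable_Y i))))

theorem measurable_wTilde_obs (i : ℕ) (d : DTR) :
    Measurable fun x : 𝓛 × ℤˣ × Bool × Stage2 × Vec (n i) =>
      observable d x.2.1 x.2.2.1 x.2.2.2.1 * T.weight μ i d x.2.2.1 := by
  have h : Measurable fun y : ℤˣ × Bool × Stage2 =>
      observable d y.1 y.2.1 y.2.2 * T.weight μ i d y.2.1 := measurable_of_countable _
  exact h.comp (g := fun y : ℤˣ × Bool × Stage2 => observable d y.1 y.2.1 y.2.2 *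
    T.weight μ i d y.2.1) (f := fun x : 𝓛 × ℤˣ × Bool × Stage2 × Vec (n i) =>
      (x.2.1, x.2.2.1, x.2.2.2.1)) (by fun_prop)

/-- A score depends on the participant's own observed data only; scores of different participants
thereby inherit independence. -/
theorem exists_score_eq_comp_obs (hK : ∀ i d j k, Measurable fun l => K i d l j k) (i : ℕ)
    (β : Vec p) (a : Fin p) : ∃ Φ : 𝓛 × ℤˣ × Bool × Stage2 × Vec (n i) → ℝ, Measurable Φ ∧
      (fun ω => score T M μ K i β ω a) = Φ ∘ obs T i := by
  refine ⟨fun x => ∑ d ∈ T.dtrs, observable d x.2.1 x.2.2.1 x.2.2.2.1 * T.weight μ i d x.2.2.1 *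
    ((M.X i d x.1)ᵀ *ᵥ (K i d x.1 *ᵥ (x.2.2.2.2.ofLp - M.X i d x.1 *ᵥ β.ofLp))) a, ?_, ?_⟩
  · refine Finset.measurable_fun_sum _ fun d _ => (measurable_wTilde_obs (μ := μ) T i d).mul ?_
    have hX : ∀ j k, Measurable fun x : 𝓛 × ℤˣ × Bool × Stage2 × Vec (n i) => M.X i d x.1 j k :=
      fun j k => (M.measurable_X i d j k).comp measurable_fst
    have hKm : ∀ j k, Measurable fun x : 𝓛 × ℤˣ × Bool × Stage2 × Vec (n i) => K i d x.1 j k :=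
      fun j k => (hK i d j k).comp measurable_fst
    have hY : ∀ k, Measurable fun x : 𝓛 × ℤˣ × Bool × Stage2 × Vec (n i) =>
        x.2.2.2.2.ofLp k := fun k => by fun_prop
    have hr : ∀ k, Measurable fun x : 𝓛 × ℤˣ × Bool × Stage2 × Vec (n i) =>
        (x.2.2.2.2.ofLp - M.X i d x.1 *ᵥ β.ofLp) k := fun k =>
      (hY k).sub (measurable_mulVec_entry (v := fun _ => β.ofLp) hX
        (fun k => measurable_const) k)
    exact measurable_mulVec_entry (A := fun x => (M.X i d x.1)ᵀ) (fun j k => hX k j)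
      (fun k => measurable_mulVec_entry hKm hr k) a
  · ext ω
    rw [score_apply]
    rfl

theorem exists_info_eq_comp_obs (hK : ∀ i d j k, Measurable fun l => K i d l j k) (i : ℕ)
    (a b : Fin p) : ∃ Φ : 𝓛 × ℤˣ × Bool × Stage2 × Vec (n i) → ℝ, Measurable Φ ∧
      (fun ω => info T M μ K i ω a b) = Φ ∘ obs T i := by
  refine ⟨fun x => ∑ d ∈ T.dtrs, observable d x.2.1 x.2.2.1 x.2.2.2.1 * T.weight μ i d x.2.2.1 *
    ((M.X i d x.1)ᵀ * K i d x.1 * M.X i d x.1) a b, ?_, ?_⟩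
  · refine Finset.measurable_fun_sum _ fun d _ => (measurable_wTilde_obs (μ := μ) T i d).mul ?_
    have hX : ∀ j k, Measurable fun x : 𝓛 × ℤˣ × Bool × Stage2 × Vec (n i) => M.X i d x.1 j k :=
      fun j k => (M.measurable_X i d j k).comp measurable_fst
    have hKm : ∀ j k, Measurable fun x : 𝓛 × ℤˣ × Bool × Stage2 × Vec (n i) => K i d x.1 j k :=
      fun j k => (hK i d j k).comp measurable_fst
    have hXK : ∀ j k, Measurable fun x : 𝓛 × ℤˣ × Bool × Stage2 × Vec (n i) =>
        ((M.X i d x.1)ᵀ * K i d x.1) j k :=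
      measurable_mul_entry (A := fun x => (M.X i d x.1)ᵀ) (fun j k => hX k j) hKm
    exact measurable_mul_entry
      (A := fun x : 𝓛 × ℤˣ × Bool × Stage2 × Vec (n i) => (M.X i d x.1)ᵀ * K i d x.1) (B := fun x => M.X i d x.1) hXK hX a b
  · ext ω
    rw [info_apply]
    rfl

theorem measurable_envelope (i : ℕ) (d : DTR) : Measurable (envelope T M i d) := by
  unfold envelope
  have hX : Measurable fun ω => frob (M.X i d (T.L i ω)) :=
    measurable_frob fun j k => (M.measurable_X i d j k).comp (T.measurable_L i)
  have hZ : Measurable fun ω => frob (M.Z i d (T.L i ω)) :=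
    measurable_frob fun j k => (M.measurable_Z i d j k).comp (T.measurable_L i)
  exact (((hX.pow_const 2).const_add 1).add (hX.mul (T.measurable_Ypot i d).norm)).mul
    ((hZ.pow_const 2).const_add 1)

theorem measurable_envSum (i : ℕ) : Measurable (envSum T M i) :=
  Finset.measurable_fun_sum _ fun d _ => measurable_envelope T M i d

end Score

end SMART

end

namespace SMART

/-! ### Limit theorems for averages -/

section Averages

variable {Ω : Type*} {mΩ : MeasurableSpace Ω} {μ : Measure Ω}

theorem integrable_rpow_of_eLpNorm_le {f : Ω → ℝ} {s : ℝ} (hs : 0 < s) {C : ℝ≥0}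
    (hf : AEStronglyMeasurable f μ) (h : eLpNorm f (ENNReal.ofReal s) μ ≤ C) :
    Integrable (fun ω => |f ω| ^ s) μ ∧ ∫ ω, |f ω| ^ s ∂μ ≤ (C : ℝ) ^ s := by
  have hmem : MemLp f (ENNReal.ofReal s) μ := ⟨hf, h.trans_lt ENNReal.coe_lt_top⟩
  have hs0 : ENNReal.ofReal s ≠ 0 := by simpa using hs
  have hi := hmem.integrable_norm_rpow hs0 ENNReal.ofReal_ne_top
  have he := hmem.eLpNorm_eq_integral_rpow_norm hs0 ENNReal.ofReal_ne_top
  simp only [Real.norm_eq_abs, ENNReal.toReal_ofReal hs.le] at hi he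
  refine ⟨hi, ?_⟩
  rw [he] at h
  have h0 : 0 ≤ ∫ ω, |f ω| ^ s ∂μ := integral_nonneg fun ω => by positivity
  have h1 : (∫ ω, |f ω| ^ s ∂μ) ^ s⁻¹ ≤ C := by
    rw [← ENNReal.ofReal_coe_nnreal] at h
    exact (ENNReal.ofReal_le_ofReal_iff C.coe_nonneg).1 h
  calc ∫ ω, |f ω| ^ s ∂μ = ((∫ ω, |f ω| ^ s ∂μ) ^ s⁻¹) ^ s := by
        rw [← Real.rpow_mul h0, inv_mul_cancel₀ hs.ne', Real.rpow_one]
    _ ≤ _ := Real.rpow_le_rpow (by positivity) h1 hs.le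

theorem memLp_and_eLpNorm_le_of_integral_rpow_le {f : Ω → ℝ} {s : ℝ} (hs : 0 < s) {C : ℝ}
    (hf : AEStronglyMeasurable f μ) (hi : Integrable (fun ω => |f ω| ^ s) μ)
    (h : ∫ ω, |f ω| ^ s ∂μ ≤ C) :
    MemLp f (ENNReal.ofReal s) μ ∧ eLpNorm f (ENNReal.ofReal s) μ ≤ (C ^ s⁻¹).toNNReal := by
  have hs0 : ENNReal.ofReal s ≠ 0 := by simpa using hs
  have hmem : MemLp f (ENNReal.ofReal s) μ := by
    rw [← integrable_norm_rpow_iff hf hs0 ENNReal.ofReal_ne_top]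
    simpa only [Real.norm_eq_abs, ENNReal.toReal_ofReal hs.le] using hi
  refine ⟨hmem, ?_⟩
  rw [hmem.eLpNorm_eq_integral_rpow_norm hs0 ENNReal.ofReal_ne_top]
  simp only [Real.norm_eq_abs, ENNReal.toReal_ofReal hs.le]
  exact ENNReal.ofReal_le_ofReal (Real.rpow_le_rpow (integral_nonneg fun ω => by positivity) h
    (by positivity))

theorem SmallInProb.of_tendsto {x : ℕ → ℝ} (h : Tendsto x atTop (𝓝 0)) :
    SmallInProb μ fun N _ => |x N| := fun ε hε => by
  have h1 : ∀ᶠ N in atTop, |x N| ≤ ε := by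
    have := h.abs
    rw [abs_zero] at this
    exact this.eventually_le_const hε
  exact WithHighProb.of_ae (h1.mono fun N hN => Eventually.of_forall fun _ => hN)

/-- Averages of nonnegative random variables with bounded means are bounded in probability. -/
theorem boundedInProb_average {X : ℕ → Ω → ℝ} (hX : ∀ i, Integrable (X i) μ)
    (h0 : ∀ i ω, 0 ≤ X i ω) {C : ℝ} (hC : ∀ i, ∫ ω, X i ω ∂μ ≤ C) :
    BoundedInProb μ fun (N : ℕ) ω => (N : ℝ)⁻¹ * ∑ i ∈ Finset.range N, X i ω := by
  have hC0 : 0 ≤ C := (integral_nonneg fun ω => h0 0 ω).trans (hC 0)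
  refine BoundedInProb.of_integral_le (C := C)
    (fun N => (integrable_finsetSum _ fun i _ => hX i).const_mul _)
    (fun N => Eventually.of_forall fun ω =>
      mul_nonneg (by positivity) (Finset.sum_nonneg fun i _ => h0 i ω)) fun N => ?_
  rw [integral_const_mul, integral_finsetSum _ fun i _ => hX i]
  rcases Nat.eq_zero_or_pos N with rfl | hN
  · simpa using hC0
  · rw [inv_mul_le_iff₀ (by exact_mod_cast hN)]
    refine (Finset.sum_le_sum fun i _ => hC i).trans ?_
    simp

variable [IsProbabilityMeasure μ]

/-- The averages of the means of random variables bounded in `L^s`, `s > 1`, converge to the limit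
in probability of the averages of their conditional means. -/
theorem tendsto_average_integral {F : ℕ → Ω → ℝ} {m : ℕ → MeasurableSpace Ω} (hm : ∀ i, m i ≤ mΩ)
    {s : ℝ} (hs : 1 < s) {C : ℝ} (hF : ∀ i, AEStronglyMeasurable (F i) μ)
    (hi : ∀ i, Integrable (fun ω => |F i ω| ^ s) μ) (hC : ∀ i, ∫ ω, |F i ω| ^ s ∂μ ≤ C) {a : ℝ}
    (h : TendstoInMeasure μ (fun (N : ℕ) ω => (N : ℝ)⁻¹ * ∑ i ∈ Finset.range N, (μ[F i | m i]) ω)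
      atTop fun _ => a) :
    Tendsto (fun N : ℕ => (N : ℝ)⁻¹ * ∑ i ∈ Finset.range N, ∫ ω, F i ω ∂μ) atTop (𝓝 a) := by
  have hs1 : 1 < ENNReal.ofReal s := by
    rw [← ENNReal.ofReal_one]; exact (ENNReal.ofReal_lt_ofReal_iff (by linarith)).2 hs
  have key := fun i => memLp_and_eLpNorm_le_of_integral_rpow_le (by linarith) (hF i) (hi i) (hC i)
  have hce : ∀ i, AEStronglyMeasurable (μ[F i | m i]) μ := fun i =>
    integrable_condExp.aestronglyMeasurable
  have hmeas : ∀ N : ℕ, AEStronglyMeasurable (∑ i ∈ Finset.range N, μ[F i | m i]) μ := fun N =>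
    Finset.aestronglyMeasurable_sum _ fun i _ => hce i
  have heq : ∀ N : ℕ, (fun ω => (N : ℝ)⁻¹ * ∑ i ∈ Finset.range N, (μ[F i | m i]) ω) =
      (N : ℝ)⁻¹ • ∑ i ∈ Finset.range N, μ[F i | m i] := fun N => by
    ext ω; simp
  -- Conditional expectation contracts the `L^s` norm, so the averages remain bounded in `L^s` and
  -- convergence in probability passes to the means.
  have hlim := tendsto_integral_of_tendstoInMeasure (p := ENNReal.ofReal s)
    (C := (C ^ s⁻¹).toNNReal) hs1
    ENNReal.ofReal_ne_top (fun N => by rw [heq]; exact (hmeas N).const_smul _) (fun N => ?_) h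
  · refine hlim.congr fun N => ?_
    rw [integral_const_mul, integral_finsetSum _ fun i _ => integrable_condExp]
    congr 1
    exact Finset.sum_congr rfl fun i _ => integral_condExp (hm i)
  · rw [heq, eLpNorm_const_smul]
    have h1 : eLpNorm (∑ i ∈ Finset.range N, μ[F i | m i]) (ENNReal.ofReal s) μ ≤
        N * ((C ^ s⁻¹).toNNReal : ℝ≥0∞) := by
      refine (eLpNorm_sum_le (fun i _ => hce i) hs1.le).trans ?_
      refine (Finset.sum_le_sum fun i _ => (eLpNorm_condExp_le_eLpNorm (F i) hs1.le).trans
        (key i).2).trans ?_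
      simp
    rcases Nat.eq_zero_or_pos N with rfl | hN
    · simp
    · calc _ ≤ ‖(N : ℝ)⁻¹‖ₑ * (N * ((C ^ s⁻¹).toNNReal : ℝ≥0∞)) := by gcongr
        _ = _ := by
          rw [← mul_assoc, Real.enorm_eq_ofReal (by positivity), ENNReal.ofReal_inv_of_pos
            (by exact_mod_cast hN), ENNReal.ofReal_natCast, ENNReal.inv_mul_cancel
            (by exact_mod_cast hN.ne') (ENNReal.natCast_ne_top N), one_mul]

/-- Chebyshev's bound for normalized sums of independent centered random variables. -/
theorem boundedInProb_inv_sqrt_mul_sum {X : ℕ → Ω → ℝ} (hX : ∀ i, MemLp (X i) 2 μ)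
    (hindep : iIndepFun X μ) (h0 : ∀ i, ∫ ω, X i ω ∂μ = 0) {C : ℝ}
    (hC : ∀ i, ∫ ω, X i ω ^ 2 ∂μ ≤ C) :
    BoundedInProb μ fun N ω => |(√(N : ℝ))⁻¹ * ∑ i ∈ Finset.range N, X i ω| := by
  have hC0 : 0 ≤ C := (integral_nonneg fun ω => sq_nonneg _).trans (hC 0)
  have hS : ∀ N : ℕ, MemLp (∑ i ∈ Finset.range N, X i) 2 μ := fun N =>
    memLp_finsetSum' _ fun i _ => hX i
  have hvar : ∀ N : ℕ, ∫ ω, (∑ i ∈ Finset.range N, X i ω) ^ 2 ∂μ ≤ N * C := fun N => by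
    have h1 := IndepFun.variance_sum (s := Finset.range N) (fun i _ => hX i)
      (fun i _ j _ hij => hindep.indepFun hij)
    rw [variance_of_integral_eq_zero (hS N).aestronglyMeasurable.aemeasurable] at h1
    · simp only [Finset.sum_apply] at h1
      rw [h1]
      calc _ = ∑ i ∈ Finset.range N, ∫ ω, X i ω ^ 2 ∂μ := Finset.sum_congr rfl fun i _ =>
            variance_of_integral_eq_zero (hX i).aestronglyMeasurable.aemeasurable (h0 i)
        _ ≤ ∑ i ∈ Finset.range N, C := Finset.sum_le_sum fun i _ => hC i
        _ = _ := by simp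
    · simp only [Finset.sum_apply]
      rw [integral_finsetSum _ fun i _ => (hX i).integrable one_le_two]
      simp [h0]
  -- Markov's inequality is applied to `1 + x²`, which dominates `|x|`.
  have hbd : BoundedInProb μ fun N ω => 1 + ((√(N : ℝ))⁻¹ * ∑ i ∈ Finset.range N, X i ω) ^ 2 := by
    have hi : ∀ N : ℕ, Integrable (fun ω => ((√(N : ℝ))⁻¹ * ∑ i ∈ Finset.range N, X i ω) ^ 2) μ :=
      fun N => by
        have := ((hS N).const_mul (√(N : ℝ))⁻¹).integrable_sq
        simpa using this
    refine BoundedInProb.of_integral_le (C := 1 + C) (fun N => (integrable_const 1).add (hi N))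
      (fun N => Eventually.of_forall fun ω => by
        change (0 : ℝ) ≤ 1 + _
        positivity) fun N => ?_
    rw [integral_add (integrable_const 1) (hi N)]
    simp only [mul_pow, inv_pow, Real.sq_sqrt (Nat.cast_nonneg N), integral_const_mul]
    have h2 : (N : ℝ)⁻¹ * ∫ ω, (∑ i ∈ Finset.range N, X i ω) ^ 2 ∂μ ≤ C := by
      rcases Nat.eq_zero_or_pos N with rfl | hN
      · simpa using hC0
      · rw [inv_mul_le_iff₀ (by exact_mod_cast hN)]; exact hvar N
    simpa using h2
  refine hbd.mono (WithHighProb.of_ae (Eventually.of_forall fun N => Eventually.of_forall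
    fun ω => ?_))
  nlinarith [sq_abs ((√(N : ℝ))⁻¹ * ∑ i ∈ Finset.range N, X i ω),
    sq_nonneg (|(√(N : ℝ))⁻¹ * ∑ i ∈ Finset.range N, X i ω| - 1)]

/-- A weak law of large numbers for independent square-integrable random variables. -/
theorem smallInProb_average_sub {X : ℕ → Ω → ℝ} (hX : ∀ i, MemLp (X i) 2 μ)
    (hindep : iIndepFun X μ) {C : ℝ} (hC : ∀ i, ∫ ω, X i ω ^ 2 ∂μ ≤ C) {a : ℝ}
    (h : Tendsto (fun N : ℕ => (N : ℝ)⁻¹ * ∑ i ∈ Finset.range N, ∫ ω, X i ω ∂μ) atTop (𝓝 a)) :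
    SmallInProb μ fun N ω => |(N : ℝ)⁻¹ * ∑ i ∈ Finset.range N, X i ω - a| := by
  have h1 := boundedInProb_inv_sqrt_mul_sum (X := fun i ω => X i ω - ∫ ω, X i ω ∂μ) (C := C)
    (fun i => (hX i).sub (memLp_const _)) (hindep.comp (fun i x => x - ∫ ω, X i ω ∂μ)
      (fun i => by fun_prop)) (fun i => by
        rw [integral_sub ((hX i).integrable one_le_two) (integrable_const _)]; simp)
    (fun i => by
      rw [← variance_eq_integral (hX i).aestronglyMeasurable.aemeasurable]
      exact (variance_le_expectation_sq (hX i).aestronglyMeasurable).trans (hC i))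
  have h2 : Tendsto (fun N : ℕ => (√(N : ℝ))⁻¹) atTop (𝓝 0) :=
    tendsto_inv_atTop_zero.comp (Real.tendsto_sqrt_atTop.comp tendsto_natCast_atTop_atTop)
  -- The centered average is `N^(-1/2)` times a normalized sum that is bounded in probability.
  have h3 := (SmallInProb.of_tendsto (μ := μ) h2).mul_bounded h1 fun _ _ => abs_nonneg _
  have h4 : Tendsto (fun N : ℕ => (N : ℝ)⁻¹ * ∑ i ∈ Finset.range N, ∫ ω, X i ω ∂μ - a) atTop
      (𝓝 0) := by simpa using h.sub_const a
  refine (h3.add (SmallInProb.of_tendsto h4)).mono (WithHighProb.of_ae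
    (Eventually.of_forall fun N => Eventually.of_forall fun ω => ?_))
  rw [← abs_mul, ← mul_assoc, ← mul_inv, Real.mul_self_sqrt (Nat.cast_nonneg N)]
  refine le_trans (le_of_eq ?_) (abs_add_le _ _)
  rw [Finset.sum_sub_distrib]
  congr 1
  ring

end Averages

/-! ### Moments and centering of scores -/

section ScoreMoments

variable {Ω 𝓛 : Type*} [MeasurableSpace Ω] [MeasurableSpace 𝓛] {n : ℕ → ℕ} {p q r : ℕ}
  (T : Trial Ω 𝓛 n) (M : WorkingModel 𝓛 n p q r) {μ : Measure Ω}
  {K : ∀ i : ℕ, DTR → 𝓛 → Matrix (Fin (n i)) (Fin (n i)) ℝ}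

theorem iIndepFun_of_eq_comp_obs (hindep : IndependentParticipants T μ) {F : ℕ → Ω → ℝ}
    (hF : ∀ i, ∃ Φ : 𝓛 × ℤˣ × Bool × Stage2 × Vec (n i) → ℝ, Measurable Φ ∧ F i = Φ ∘ obs T i) :
    iIndepFun F μ := by
  choose Φ hΦ hF using hF
  have := iIndepFun.comp hindep Φ hΦ
  convert this using 2 with i
  exact hF i

theorem measurable_score_apply (hK : ∀ i d j k, Measurable fun l => K i d l j k) (i : ℕ)
    (β : Vec p) (a : Fin p) : Measurable fun ω => score T M μ K i β ω a := by
  obtain ⟨Φ, hΦ, h⟩ := exists_score_eq_comp_obs T M (μ := μ) hK i β a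
  rw [h]
  exact hΦ.comp (measurable_obs T i)

theorem measurable_score (hK : ∀ i d j k, Measurable fun l => K i d l j k) (i : ℕ)
    (β : Vec p) : Measurable fun ω => score T M μ K i β ω := by
  have h : Measurable fun ω => (score T M μ K i β ω).ofLp :=
    measurable_pi_lambda _ fun a => measurable_score_apply T M hK i β a
  exact (WithLp.measurable_toLp 2 _).comp h

theorem measurable_info_apply (hK : ∀ i d j k, Measurable fun l => K i d l j k) (i : ℕ)
    (a b : Fin p) : Measurable fun ω => info T M μ K i ω a b := by
  obtain ⟨Φ, hΦ, h⟩ := exists_info_eq_comp_obs T M (μ := μ) hK i a b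
  rw [h]
  exact hΦ.comp (measurable_obs T i)

theorem integrable_of_abs_le_mul {f g : Ω → ℝ} {c : ℝ} (hf : Measurable f)
    (hg : Integrable g μ) (h : ∀ᵐ ω ∂μ, |f ω| ≤ c * g ω) : Integrable f μ :=
  (hg.const_mul c).mono' hf.aestronglyMeasurable (h.mono fun _ h => h)

/-- The moments of order `2 + η` of the sums of the envelopes are bounded by `C`. -/
def EnvelopeMoment (μ : Measure Ω) (η C : ℝ) : Prop :=
  ∀ i, Integrable (fun ω => envSum T M i ω ^ (2 + η)) μ ∧
    ∫ ω, envSum T M i ω ^ (2 + η) ∂μ ≤ C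

variable {η C : ℝ}

theorem integrable_rpow_of_abs_le (hη : 0 ≤ η) (hC : EnvelopeMoment T M μ η C)
    {f : Ω → ℝ} {c : ℝ} {i : ℕ} (hf : Measurable f) (hc : 0 ≤ c)
    (h : ∀ᵐ ω ∂μ, |f ω| ≤ c * envSum T M i ω) : Integrable (fun ω => |f ω| ^ (2 + η)) μ ∧
      ∫ ω, |f ω| ^ (2 + η) ∂μ ≤ c ^ (2 + η) * C := by
  have hle : ∀ᵐ ω ∂μ, |f ω| ^ (2 + η) ≤ c ^ (2 + η) * envSum T M i ω ^ (2 + η) :=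
    h.mono fun ω hω => by
      rw [← Real.mul_rpow hc (envSum_nonneg T M i ω)]
      exact Real.rpow_le_rpow (abs_nonneg _) hω (by linarith)
  have hi := (hC i).1.const_mul (c ^ (2 + η))
  have hi2 : Integrable (fun ω => |f ω| ^ (2 + η)) μ := by
    refine hi.mono' (hf.abs.pow_const _).aestronglyMeasurable (hle.mono fun ω hω => ?_)
    rwa [Real.norm_eq_abs, abs_of_nonneg (by positivity)]
  refine ⟨hi2, (integral_mono_ae hi2 hi hle).trans ?_⟩
  rw [integral_const_mul]
  exact mul_le_mul_of_nonneg_left (hC i).2 (by positivity)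

variable [IsProbabilityMeasure μ]

/-- The moment condition, as a bound on the moments of order `2 + η` of the sum of the envelopes,
with `η ≤ 1`. -/
theorem exists_envSum_moment {α₀ : Vec r} (h : MomentsAndSmoothness T M μ α₀) :
    ∃ η : ℝ, 0 < η ∧ η ≤ 1 ∧ ∃ C : ℝ, EnvelopeMoment T M μ η C := by
  obtain ⟨⟨η, hη, C, hC⟩, -⟩ := h
  -- On a probability space the exponent may be lowered; the Taylor bound behind the central limit
  -- theorem needs `η ≤ 1`.
  refine ⟨min η 1, lt_min hη one_pos, min_le_right _ _,
    ((T.dtrs.card * C : ℝ≥0) : ℝ) ^ (2 + min η 1), fun i => ?_⟩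
  have hpos : 0 < 2 + min η 1 := by
    have : 0 < min η 1 := lt_min hη one_pos
    linarith
  have hle : eLpNorm (envSum T M i) (ENNReal.ofReal (2 + min η 1)) μ ≤
      ((T.dtrs.card * C : ℝ≥0) : ℝ≥0∞) := by
    have e : envSum T M i = ∑ d ∈ T.dtrs, envelope T M i d := by
      ext ω; simp [envSum]
    rw [e]
    refine (eLpNorm_sum_le (fun d _ => (measurable_envelope T M i d).aestronglyMeasurable)
      ?_).trans ?_
    · rw [← ENNReal.ofReal_one]
      refine ENNReal.ofReal_le_ofReal ?_
      have : 0 < min η 1 := lt_min hη one_pos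
      linarith
    · refine (Finset.sum_le_sum fun d hd => (eLpNorm_le_eLpNorm_of_exponent_le
        (ENNReal.ofReal_le_ofReal (by gcongr; exact min_le_left _ _))
        (measurable_envelope T M i d).aestronglyMeasurable).trans (hC i d hd)).trans ?_
      simp
  have := integrable_rpow_of_eLpNorm_le hpos (measurable_envSum T M i).aestronglyMeasurable hle
  simpa only [abs_of_nonneg (envSum_nonneg T M i _)] using this

theorem integrable_envSum_sq (hη : 0 ≤ η) (hC : EnvelopeMoment T M μ η C)
    (i : ℕ) : Integrable (fun ω => envSum T M i ω ^ 2) μ ∧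
    ∫ ω, envSum T M i ω ^ 2 ∂μ ≤ 1 + C := by
  have hle : ∀ ω, envSum T M i ω ^ 2 ≤ 1 + envSum T M i ω ^ (2 + η) := fun ω => by
    simpa only [abs_of_nonneg (envSum_nonneg T M i ω)] using sq_le_one_add_rpow hη (envSum T M i ω)
  have hi := (integrable_const (μ := μ) (1 : ℝ)).add (hC i).1
  have hi2 : Integrable (fun ω => envSum T M i ω ^ 2) μ := by
    refine hi.mono' ((measurable_envSum T M i).pow_const 2).aestronglyMeasurable
      (Eventually.of_forall fun ω => ?_)
    rw [Real.norm_eq_abs, abs_of_nonneg (sq_nonneg _)]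
    exact hle ω
  refine ⟨hi2, (integral_mono hi2 hi hle).trans ?_⟩
  simp only [Pi.add_apply]
  rw [integral_add (integrable_const _) (hC i).1]
  simpa using (hC i).2

theorem integrable_envSum (hη : 0 ≤ η) (hC : EnvelopeMoment T M μ η C)
    (i : ℕ) : Integrable (envSum T M i) μ ∧
    ∫ ω, envSum T M i ω ∂μ ≤ 2 + C := by
  obtain ⟨h1, h2⟩ := integrable_envSum_sq T M hη hC i
  have hle : ∀ ω, envSum T M i ω ≤ 1 + envSum T M i ω ^ 2 := fun ω => by
    nlinarith [sq_nonneg (envSum T M i ω - 1)]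
  have hi := (integrable_const (μ := μ) (1 : ℝ)).add h1
  have hi2 : Integrable (envSum T M i) μ := by
    refine hi.mono' (measurable_envSum T M i).aestronglyMeasurable
      (Eventually.of_forall fun ω => ?_)
    rw [Real.norm_eq_abs, abs_of_nonneg (envSum_nonneg T M i ω)]
    exact hle ω
  refine ⟨hi2, (integral_mono hi2 hi hle).trans ?_⟩
  simp only [Pi.add_apply]
  rw [integral_add (integrable_const _) h1]
  simp
  linarith

theorem integrable_sq_of_abs_le (hη : 0 ≤ η) (hC : EnvelopeMoment T M μ η C)
    {f : Ω → ℝ} {c : ℝ} {i : ℕ} (hf : Measurable f)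
    (h : ∀ᵐ ω ∂μ, |f ω| ≤ c * envSum T M i ω) : MemLp f 2 μ ∧
      ∫ ω, f ω ^ 2 ∂μ ≤ c ^ 2 * (1 + C) := by
  obtain ⟨h1, h2⟩ := integrable_envSum_sq T M hη hC i
  have hle : ∀ᵐ ω ∂μ, f ω ^ 2 ≤ c ^ 2 * envSum T M i ω ^ 2 := h.mono fun ω hω => by
    rw [← sq_abs, ← mul_pow]
    exact pow_le_pow_left₀ (abs_nonneg _) hω 2
  have hi := h1.const_mul (c ^ 2)
  have hi2 : Integrable (fun ω => f ω ^ 2) μ := by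
    refine hi.mono' (hf.pow_const 2).aestronglyMeasurable (hle.mono fun ω hω => ?_)
    rwa [Real.norm_eq_abs, abs_of_nonneg (sq_nonneg _)]
  refine ⟨(memLp_two_iff_integrable_sq hf.aestronglyMeasurable).2 hi2, ?_⟩
  refine (integral_mono_ae hi2 hi hle).trans ?_
  rw [integral_const_mul]
  gcongr

open scoped Matrix.Norms.L2Operator

/-- Scores at the true mean parameter are centered given the baseline covariates, whatever the
weighting matrix. -/
theorem condExp_score_eq_zero [StandardBorelSpace Ω] (hη : 0 ≤ η)
    (hC : EnvelopeMoment T M μ η C) (hdesign : SecondStageDesign T μ)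
    (hrand : SequentialRandomization T μ) (hcons : Consistency T μ) (hpos : Positivity T μ)
    {β : Vec p} (hmean : CorrectMean T M μ β) {κ : ℝ} (hκ : 0 ≤ κ)
    (hKm : ∀ i d j k, Measurable fun l => K i d l j k)
    (hK : ∀ i d l, ‖K i d l‖ ≤ κ * (1 + frob (M.Z i d l) ^ 2)) (i : ℕ) (a : Fin p) :
    μ[fun ω => score T M μ K i β ω a | T.sigmaL i] =ᵐ[μ] 0 := by
  have hm := (T.measurable_L i).comap_le
  obtain ⟨w, hw0, hw⟩ := exists_wTilde_le T hpos
  obtain ⟨c, hc, hposc⟩ := hpos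
  -- Each coordinate of the score is split into entries `e` of the potential residual, centered
  -- given `L`, and coefficients `b`, which are functions of `L` and can be pulled out.
  set e : DTR → Fin (n i) → Ω → ℝ := fun d k ω =>
    (T.Ypot i d ω) k + -(M.X i d (T.L i ω) *ᵥ β.ofLp) k with he
  set b : DTR → Fin (n i) → Ω → ℝ := fun d k ω =>
    ((M.X i d (T.L i ω))ᵀ * K i d (T.L i ω)) a k with hb
  have hbm : ∀ d k, StronglyMeasurable[T.sigmaL i] (b d k) := fun d k => by
    have h1 : Measurable fun l => ((M.X i d l)ᵀ * K i d l) a k :=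
      measurable_mul_entry (A := fun l => (M.X i d l)ᵀ) (fun j k => M.measurable_X i d k j)
        (hKm i d) a k
    exact (h1.comp (comap_measurable (T.L i))).stronglyMeasurable
  have hXm : ∀ d k, Measurable fun l => (M.X i d l *ᵥ β.ofLp) k := fun d k =>
    measurable_mulVec_entry (v := fun _ => β.ofLp) (M.measurable_X i d) (fun _ => measurable_const) k
  have hcent : ∀ d ∈ T.dtrs, ∀ k, Integrable (fun ω => T.wTilde μ i d ω * e d k ω) μ ∧
      μ[fun ω => T.wTilde μ i d ω * e d k ω | T.sigmaL i] =ᵐ[μ] 0 := fun d hd k => by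
    obtain ⟨hint, hce⟩ := hmean i d hd
    have hYk : Integrable (fun ω => (T.Ypot i d ω) k) μ :=
      (EuclideanSpace.proj (𝕜 := ℝ) k).integrable_comp hint
    have hcomm := (EuclideanSpace.proj (𝕜 := ℝ) k : Vec (n i) →L[ℝ] ℝ).comp_condExp_comm hint
      (m := T.sigmaL i)
    have hYce : μ[fun ω => (T.Ypot i d ω) k | T.sigmaL i] =ᵐ[μ]
        fun ω => (M.X i d (T.L i ω) *ᵥ β.ofLp) k := by
      refine hcomm.symm.trans ?_
      filter_upwards [hce] with ω hω
      simp [hω]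
    have hψm : StronglyMeasurable[T.sigmaL i] fun ω => -(M.X i d (T.L i ω) *ᵥ β.ofLp) k :=
      ((hXm d k).comp (comap_measurable (T.L i))).stronglyMeasurable.neg
    have hψi : Integrable (fun ω => -(M.X i d (T.L i ω) *ᵥ β.ofLp) k) μ :=
      ((integrable_condExp (m := T.sigmaL i)).congr hYce).neg
    refine condExp_wTilde_mul_eq_zero T hdesign hrand hd (hc.trans_le ((hposc i).2 d hd)).ne'
      (φ := fun y => y k) (by fun_prop) hYk hψm hψi ?_
    refine (condExp_add hYk hψi _).trans ?_
    rw [condExp_of_stronglyMeasurable hm hψm hψi]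
    filter_upwards [hYce] with ω hω
    simp [hω]
  -- Pulling `b` out of the conditional expectation requires the product to be integrable; the
  -- envelope dominates it.
  have hterm : ∀ d ∈ T.dtrs, ∀ k,
      Integrable (b d k * fun ω => T.wTilde μ i d ω * e d k ω) μ := fun d hd k => by
    refine integrable_of_abs_le_mul (c := w * (1 + ‖β‖) * κ) ?_
      (integrable_envSum T M hη hC i).1 (Eventually.of_forall fun ω => ?_)
    · refine (((hbm d k).mono hm).measurable).mul ((measurable_wTilde T i d).mul ?_)
      have h1 : Measurable fun ω => (T.Ypot i d ω) k := by
        have := T.measurable_Ypot i d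
        fun_prop
      exact h1.add ((hXm d k).comp (T.measurable_L i)).neg
    · have hX0 := frob_nonneg (M.X i d (T.L i ω))
      have hX := l2_opNorm_le_frob (M.X i d (T.L i ω))
      have h1 : |b d k ω| ≤ frob (M.X i d (T.L i ω)) * ‖K i d (T.L i ω)‖ := by
        refine (abs_entry_le_l2_opNorm _ _ _).trans ((Matrix.l2_opNorm_mul _ _).trans ?_)
        rw [l2_opNorm_transpose]
        gcongr
      have h2 : |e d k ω| ≤ ‖T.Ypot i d ω‖ + frob (M.X i d (T.L i ω)) * ‖β‖ := by
        refine (abs_add_le _ _).trans (add_le_add (PiLp.norm_apply_le (T.Ypot i d ω) k) ?_)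
        rw [abs_neg]
        refine (PiLp.norm_apply_le
          (WithLp.toLp 2 (M.X i d (T.L i ω) *ᵥ β.ofLp) : Vec (n i)) k).trans ?_
        exact (Matrix.l2_opNorm_mulVec _ _).trans (by gcongr)
      have h3 := mul_le_mul_envelope T M hκ i d ω (hK i d (T.L i ω))
      have h4 : envelope T M i d ω ≤ envSum T M i ω :=
        Finset.single_le_sum (fun d _ => envelope_nonneg T M i d ω) hd
      have hwn := wTilde_nonneg T (μ := μ) i d ω
      rw [Pi.mul_apply, abs_mul, abs_mul, abs_of_nonneg hwn]
      have h5 : |b d k ω| * |e d k ω| ≤ (1 + ‖β‖) * (‖K i d (T.L i ω)‖ *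
          (frob (M.X i d (T.L i ω)) ^ 2 + frob (M.X i d (T.L i ω)) * ‖T.Ypot i d ω‖)) := by
        have h6 := mul_le_mul h1 h2 (abs_nonneg _) (by positivity)
        have h7 : 0 ≤ ‖K i d (T.L i ω)‖ * frob (M.X i d (T.L i ω)) ^ 2 := by positivity
        have h8 : 0 ≤ ‖β‖ * (‖K i d (T.L i ω)‖ *
          (frob (M.X i d (T.L i ω)) * ‖T.Ypot i d ω‖)) := by positivity
        nlinarith
      calc |b d k ω| * (T.wTilde μ i d ω * |e d k ω|)
          = T.wTilde μ i d ω * (|b d k ω| * |e d k ω|) := by ring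
        _ ≤ w * ((1 + ‖β‖) * (κ * envSum T M i ω)) := by
          refine mul_le_mul (hw i d hd ω) (h5.trans ?_) (by positivity) hw0
          exact mul_le_mul_of_nonneg_left (h3.trans (mul_le_mul_of_nonneg_left h4 hκ))
            (by positivity)
        _ = _ := by ring
  have hsum : (fun ω => score T M μ K i β ω a) =ᵐ[μ]
      ∑ d ∈ T.dtrs, ∑ k, b d k * fun ω => T.wTilde μ i d ω * e d k ω := by
    filter_upwards [ae_outcome_eq T hcons] with ω hω
    rw [score_apply]
    simp only [Finset.sum_apply, Pi.mul_apply]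
    refine Finset.sum_congr rfl fun d hd => ?_
    rcases eq_or_ne (T.wTilde μ i d ω) 0 with h0 | h0
    · simp [h0]
    · rw [Matrix.mulVec_mulVec, Matrix.mulVec, dotProduct, Finset.mul_sum]
      refine Finset.sum_congr rfl fun k _ => ?_
      simp only [hb, he, residual, hω i d hd h0, Pi.sub_apply]
      ring
  refine (condExp_congr_ae hsum).trans ?_
  refine (condExp_finsetSum (fun d hd => integrable_finsetSum' _ fun k _ => hterm d hd k) _).trans ?_
  have hz : ∀ d ∈ T.dtrs, μ[∑ k, b d k * fun ω => T.wTilde μ i d ω * e d k ω | T.sigmaL i]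
      =ᵐ[μ] 0 := fun d hd => by
    refine (condExp_finsetSum (fun k _ => hterm d hd k) _).trans ?_
    have hk : ∀ k, μ[b d k * fun ω => T.wTilde μ i d ω * e d k ω | T.sigmaL i] =ᵐ[μ] 0 := fun k => by
      refine (condExp_mul_of_stronglyMeasurable_left (hbm d k) (hterm d hd k)
        (hcent d hd k).1).trans ?_
      filter_upwards [(hcent d hd k).2] with ω hω
      simp [hω]
    filter_upwards [ae_all_iff.2 hk] with ω hω
    simp [hω]
  filter_upwards [(ae_ball_iff T.dtrs.countable_toSet).2 hz] with ω hω
  simp only [Finset.sum_apply, Pi.zero_apply]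
  exact Finset.sum_eq_zero fun d hd => hω d hd

end ScoreMoments

end SMART

noncomputable section

namespace SMART

/-! ### Expansion of scores in the variance parameter -/

section Expansion

variable {Ω 𝓛 : Type*} [MeasurableSpace Ω] [MeasurableSpace 𝓛] {n : ℕ → ℕ} {p q r : ℕ}
  (T : Trial Ω 𝓛 n) (M : WorkingModel 𝓛 n p q r) {μ : Measure Ω}

/-- The inverse working covariance as a function of the covariates. -/
def invV (α : Vec r) (i : ℕ) (d : DTR) (l : 𝓛) : Matrix (Fin (n i)) (Fin (n i)) ℝ :=
  (M.V i d l α)⁻¹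

/-- The derivative, up to sign, of the inverse working covariance with respect to the entry
`(j, k)` of the covariance of the random effects. -/
def derivG (α : Vec r) (j k : Fin q) (i : ℕ) (d : DTR) (l : 𝓛) : Matrix (Fin (n i)) (Fin (n i)) ℝ :=
  (M.V i d l α)⁻¹ * (M.Z i d l * Matrix.single j k (1 : ℝ) * (M.Z i d l)ᵀ) * (M.V i d l α)⁻¹

/-- The derivative, up to sign, of the inverse working covariance with respect to the residual
variance. -/
def derivSigma (α : Vec r) (i : ℕ) (d : DTR) (l : 𝓛) : Matrix (Fin (n i)) (Fin (n i)) ℝ :=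
  (M.V i d l α)⁻¹ * (M.V i d l α)⁻¹

theorem measurable_invV (α : Vec r) (i : ℕ) (d : DTR) (j k : Fin (n i)) :
    Measurable fun l => invV M α i d l j k :=
  measurable_inv_entry (A := fun l => M.V i d l α)
    (fun j k => (measurable_V_entry M i d j k).comp (g := fun x : 𝓛 × Vec r => M.V i d x.1 x.2 j k)
      (f := fun l => (l, α)) (measurable_id.prodMk measurable_const)) j k

theorem measurable_derivG (α : Vec r) (j k : Fin q) (i : ℕ) (d : DTR) (a b : Fin (n i)) :
    Measurable fun l => derivG M α j k i d l a b :=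
  measurable_mul_entry (measurable_mul_entry (measurable_invV M α i d)
    (measurable_mul_entry (measurable_mul_entry (M.measurable_Z i d)
      (B := fun _ => Matrix.single j k (1 : ℝ)) fun _ _ => measurable_const)
      (B := fun l => (M.Z i d l)ᵀ) fun a b => M.measurable_Z i d b a)) (measurable_invV M α i d) a b

theorem measurable_derivSigma (α : Vec r) (i : ℕ) (d : DTR) (a b : Fin (n i)) :
    Measurable fun l => derivSigma M α i d l a b :=
  measurable_mul_entry (measurable_invV M α i d) (measurable_invV M α i d) a b

theorem U_eq_score_invV (i : ℕ) (β : Vec p) (α : Vec r) (ω : Ω) :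
    U T M μ i β α ω = score T M μ (invV M α) i β ω := rfl

theorem H_eq_info_invV (i : ℕ) (α : Vec r) (ω : Ω) :
    H T M μ i α ω = info T M μ (invV M α) i ω := rfl

open scoped Matrix.Norms.L2Operator

theorem norm_invV_le {α : Vec r} (hα : α ∈ M.params) (i : ℕ) (d : DTR) (l : 𝓛) :
    ‖invV M α i d l‖ ≤ (M.sigmaSq α)⁻¹ * (1 + frob (M.Z i d l) ^ 2) := by
  have h0 := inv_nonneg.2 (M.sigmaSq_pos α hα).le
  have h := norm_V_inv_le M hα i d l
  refine h.trans (le_mul_of_one_le_right h0 ?_)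
  nlinarith [sq_nonneg (frob (M.Z i d l))]

theorem norm_derivSigma_le {α : Vec r} (hα : α ∈ M.params) (i : ℕ) (d : DTR) (l : 𝓛) :
    ‖derivSigma M α i d l‖ ≤ (M.sigmaSq α)⁻¹ ^ 2 * (1 + frob (M.Z i d l) ^ 2) := by
  have h0 := inv_nonneg.2 (M.sigmaSq_pos α hα).le
  have h := norm_V_inv_le M hα i d l
  calc _ ≤ ‖(M.V i d l α)⁻¹‖ * ‖(M.V i d l α)⁻¹‖ := Matrix.l2_opNorm_mul _ _
    _ ≤ (M.sigmaSq α)⁻¹ * (M.sigmaSq α)⁻¹ := by gcongr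
    _ ≤ _ := by
      rw [sq]
      exact le_mul_of_one_le_right (mul_nonneg h0 h0) (by nlinarith [sq_nonneg (frob (M.Z i d l))])

theorem norm_derivG_le {α : Vec r} (hα : α ∈ M.params) (j k : Fin q) (i : ℕ) (d : DTR) (l : 𝓛) :
    ‖derivG M α j k i d l‖ ≤ (M.sigmaSq α)⁻¹ ^ 2 * (1 + frob (M.Z i d l) ^ 2) := by
  have h0 := inv_nonneg.2 (M.sigmaSq_pos α hα).le
  have h := norm_V_inv_le M hα i d l
  have hZ := l2_opNorm_le_frob (M.Z i d l)
  have hZ0 := frob_nonneg (M.Z i d l)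
  have hs : ‖(Matrix.single j k (1 : ℝ) : Matrix (Fin q) (Fin q) ℝ)‖ ≤ 1 := by
    refine (l2_opNorm_le_frob _).trans ((frob_le_sum_abs _).trans ?_)
    simp only [Matrix.single_apply]
    rw [Finset.sum_eq_single j (by
        intro b _ hb
        exact Finset.sum_eq_zero fun x _ => by simp [hb.symm]) (by simp),
      Finset.sum_eq_single k (by intro b _ hb; simp [hb.symm]) (by simp)]
    simp
  have h1 : ‖M.Z i d l * Matrix.single j k (1 : ℝ) * (M.Z i d l)ᵀ‖ ≤
      frob (M.Z i d l) * 1 * frob (M.Z i d l) := by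
    refine (Matrix.l2_opNorm_mul _ _).trans ?_
    rw [l2_opNorm_transpose]
    gcongr
    exact (Matrix.l2_opNorm_mul _ _).trans (by gcongr)
  calc _ ≤ ‖(M.V i d l α)⁻¹ * (M.Z i d l * Matrix.single j k (1 : ℝ) * (M.Z i d l)ᵀ)‖ *
        ‖(M.V i d l α)⁻¹‖ := Matrix.l2_opNorm_mul _ _
    _ ≤ ((M.sigmaSq α)⁻¹ * (frob (M.Z i d l) * 1 * frob (M.Z i d l))) * (M.sigmaSq α)⁻¹ := by
      gcongr
      exact (Matrix.l2_opNorm_mul _ _).trans (by gcongr)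
    _ ≤ _ := by nlinarith [mul_nonneg h0 h0]

/-- `V` is linear in `(G, σ²)`. A random `α` therefore enters only through scalars common to all
participants, which can be taken out of the sums over participants. -/
theorem V_sub_eq (i : ℕ) (d : DTR) (l : 𝓛) (α α₀ : Vec r) :
    M.V i d l α - M.V i d l α₀ = (∑ x : Fin q × Fin q, (M.G α x.1 x.2 - M.G α₀ x.1 x.2) •
      (M.Z i d l * Matrix.single x.1 x.2 (1 : ℝ) * (M.Z i d l)ᵀ)) +
      (M.sigmaSq α - M.sigmaSq α₀) • (1 : Matrix (Fin (n i)) (Fin (n i)) ℝ) := by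
  have e : M.G α - M.G α₀ = ∑ x : Fin q × Fin q,
      (M.G α x.1 x.2 - M.G α₀ x.1 x.2) • Matrix.single x.1 x.2 (1 : ℝ) := by
    conv_lhs => rw [Matrix.matrix_eq_sum_single (M.G α - M.G α₀)]
    rw [Fintype.sum_prod_type]
    simp [Matrix.smul_single]
  have e2 : M.V i d l α - M.V i d l α₀ = M.Z i d l * (M.G α - M.G α₀) * (M.Z i d l)ᵀ +
      (M.sigmaSq α - M.sigmaSq α₀) • (1 : Matrix (Fin (n i)) (Fin (n i)) ℝ) := by
    simp only [WorkingModel.V, Matrix.mul_sub, Matrix.sub_mul, sub_smul]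
    abel
  rw [e2, e, Matrix.mul_sum, Matrix.sum_mul]
  simp only [Matrix.mul_smul, Matrix.smul_mul]

/-- The remainder of the first-order expansion of the inverse working covariance. -/
def remV (α α₀ : Vec r) (i : ℕ) (d : DTR) (l : 𝓛) : Matrix (Fin (n i)) (Fin (n i)) ℝ :=
  (M.V i d l α)⁻¹ * (M.V i d l α - M.V i d l α₀) * (M.V i d l α₀)⁻¹ *
    (M.V i d l α - M.V i d l α₀) * (M.V i d l α₀)⁻¹

theorem invV_sub_eq {α α₀ : Vec r} (hα : α ∈ M.params) (hα₀ : α₀ ∈ M.params) (i : ℕ) (d : DTR)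
    (l : 𝓛) : invV M α i d l - invV M α₀ i d l = remV M α α₀ i d l -
      ((∑ x : Fin q × Fin q, (M.G α x.1 x.2 - M.G α₀ x.1 x.2) • derivG M α₀ x.1 x.2 i d l) +
        (M.sigmaSq α - M.sigmaSq α₀) • derivSigma M α₀ i d l) := by
  have h := inv_sub_inv_eq_second_order (isUnit_det_V M hα i d l) (isUnit_det_V M hα₀ i d l)
  unfold invV remV derivG derivSigma
  rw [h]
  congr 1
  conv_lhs => rw [V_sub_eq M i d l α α₀]
  rw [Matrix.mul_add, Matrix.add_mul, Matrix.mul_sum, Matrix.sum_mul]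
  simp only [Matrix.mul_smul, Matrix.smul_mul, Matrix.mul_one]

theorem norm_remV_le {α α₀ : Vec r} (hα : α ∈ M.params) (hα₀ : α₀ ∈ M.params) (i : ℕ) (d : DTR)
    (l : 𝓛) : ‖remV M α α₀ i d l‖ ≤ (M.sigmaSq α)⁻¹ * (M.sigmaSq α₀)⁻¹ ^ 2 *
      covDist M α α₀ ^ 2 * (1 + frob (M.Z i d l) ^ 2) ^ 2 := by
  have h0 := inv_nonneg.2 (M.sigmaSq_pos α hα).le
  have h1 := inv_nonneg.2 (M.sigmaSq_pos α₀ hα₀).le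
  have hV := norm_V_inv_le M hα i d l
  have hV0 := norm_V_inv_le M hα₀ i d l
  have hD := norm_V_sub_le M i d l α α₀
  have hc := covDist_nonneg M α α₀
  have hmul : ∀ {A B : Matrix (Fin (n i)) (Fin (n i)) ℝ} {a b : ℝ}, 0 ≤ a → ‖A‖ ≤ a → ‖B‖ ≤ b →
      ‖A * B‖ ≤ a * b := fun {A B a b} ha hA hB =>
    (Matrix.l2_opNorm_mul A B).trans (mul_le_mul hA hB (norm_nonneg _) ha)
  have hE : 0 ≤ (1 + frob (M.Z i d l) ^ 2) * covDist M α α₀ := by positivity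
  refine (hmul ?_ (hmul ?_ (hmul ?_ (hmul h0 hV hD) hV0) hD) hV0).trans (le_of_eq (by ring)) <;>
    positivity

theorem norm_invV_sub_le {α α₀ : Vec r} (hα : α ∈ M.params) (hα₀ : α₀ ∈ M.params) (i : ℕ)
    (d : DTR) (l : 𝓛) : ‖invV M α i d l - invV M α₀ i d l‖ ≤ (M.sigmaSq α)⁻¹ * (M.sigmaSq α₀)⁻¹ *
      covDist M α α₀ * (1 + frob (M.Z i d l) ^ 2) := by
  have h0 := inv_nonneg.2 (M.sigmaSq_pos α hα).le
  unfold invV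
  rw [inv_sub_inv_eq (isUnit_det_V M hα i d l) (isUnit_det_V M hα₀ i d l), norm_neg]
  have hc := covDist_nonneg M α α₀
  calc _ ≤ ‖(M.V i d l α)⁻¹ * (M.V i d l α - M.V i d l α₀)‖ * ‖(M.V i d l α₀)⁻¹‖ :=
        Matrix.l2_opNorm_mul _ _
    _ ≤ ((M.sigmaSq α)⁻¹ * ((1 + frob (M.Z i d l) ^ 2) * covDist M α α₀)) * (M.sigmaSq α₀)⁻¹ := by
      gcongr
      · exact (Matrix.l2_opNorm_mul _ _).trans (by
          gcongr
          · exact norm_V_inv_le M hα i d l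
          · exact norm_V_sub_le M i d l α α₀)
      · exact norm_V_inv_le M hα₀ i d l
    _ = _ := by ring

theorem abs_sum_H_sub_le {w : ℝ} (hw0 : 0 ≤ w)
    (hw : ∀ i, ∀ d ∈ T.dtrs, ∀ ω, T.wTilde μ i d ω ≤ w) {α α₀ : Vec r} (hα : α ∈ M.params)
    (hα₀ : α₀ ∈ M.params) (N : ℕ) (ω : Ω) (a b : Fin p) :
    |∑ i ∈ Finset.range N, H T M μ i α ω a b - ∑ i ∈ Finset.range N, H T M μ i α₀ ω a b| ≤
      w * ((M.sigmaSq α)⁻¹ * (M.sigmaSq α₀)⁻¹ * covDist M α α₀) *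
        ∑ i ∈ Finset.range N, envSum T M i ω := by
  have h0 := inv_nonneg.2 (M.sigmaSq_pos α hα).le
  have h1 := inv_nonneg.2 (M.sigmaSq_pos α₀ hα₀).le
  have hc := covDist_nonneg M α α₀
  rw [← Finset.sum_sub_distrib, Finset.mul_sum]
  refine (Finset.abs_sum_le_sum_abs _ _).trans (Finset.sum_le_sum fun i _ => ?_)
  have e : H T M μ i α ω a b - H T M μ i α₀ ω a b =
      info T M μ (fun i d l => invV M α i d l - invV M α₀ i d l) i ω a b := by
    rw [info_sub]; rfl
  rw [e]
  exact abs_info_le_envSum T M hw0 (by positivity) hw (norm_invV_sub_le M hα hα₀) i ω a b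

/-- The linear part is kept as norms of sums of scores with weights fixed at `α₀`: at the true `β`
these are centered and of order `√N`, which a termwise bound would miss. Only the quadratic
remainder is bounded term by term. -/
theorem norm_sum_U_sub_le {w : ℝ} (hw0 : 0 ≤ w)
    (hw : ∀ i, ∀ d ∈ T.dtrs, ∀ ω, T.wTilde μ i d ω ≤ w) {α α₀ : Vec r} (hα : α ∈ M.params)
    (hα₀ : α₀ ∈ M.params) (N : ℕ) {ω : Ω}
    (hω : ∀ i, ∀ d ∈ T.dtrs, T.wTilde μ i d ω ≠ 0 → T.Y i ω = T.Ypot i d ω) (β : Vec p) :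
    ‖∑ i ∈ Finset.range N, U T M μ i β α ω - ∑ i ∈ Finset.range N, U T M μ i β α₀ ω‖ ≤
      covDist M α α₀ * ((∑ x : Fin q × Fin q,
        ‖∑ i ∈ Finset.range N, score T M μ (derivG M α₀ x.1 x.2) i β ω‖) +
        ‖∑ i ∈ Finset.range N, score T M μ (derivSigma M α₀) i β ω‖) +
      w * (1 + ‖β‖) * ((M.sigmaSq α)⁻¹ * (M.sigmaSq α₀)⁻¹ ^ 2 * covDist M α α₀ ^ 2) *
        ∑ i ∈ Finset.range N, envSum T M i ω ^ 2 := by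
  have h0 := inv_nonneg.2 (M.sigmaSq_pos α hα).le
  have h1 := inv_nonneg.2 (M.sigmaSq_pos α₀ hα₀).le
  have hc := covDist_nonneg M α α₀
  have e : ∑ i ∈ Finset.range N, U T M μ i β α ω - ∑ i ∈ Finset.range N, U T M μ i β α₀ ω =
      ∑ i ∈ Finset.range N, score T M μ (remV M α α₀) i β ω -
      ((∑ x : Fin q × Fin q, (M.G α x.1 x.2 - M.G α₀ x.1 x.2) •
        ∑ i ∈ Finset.range N, score T M μ (derivG M α₀ x.1 x.2) i β ω) +
      (M.sigmaSq α - M.sigmaSq α₀) •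
        ∑ i ∈ Finset.range N, score T M μ (derivSigma M α₀) i β ω) := by
    have hi : ∀ i, U T M μ i β α ω - U T M μ i β α₀ ω = score T M μ (remV M α α₀) i β ω -
        ((∑ x : Fin q × Fin q, (M.G α x.1 x.2 - M.G α₀ x.1 x.2) •
          score T M μ (derivG M α₀ x.1 x.2) i β ω) +
        (M.sigmaSq α - M.sigmaSq α₀) • score T M μ (derivSigma M α₀) i β ω) := fun i => by
      rw [U_eq_score_invV, U_eq_score_invV, ← score_sub]
      simp only [invV_sub_eq M hα hα₀]
      rw [score_sub, score_add, score_smul, score_sum]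
      simp only [score_smul]
    rw [← Finset.sum_sub_distrib]
    simp only [hi, Finset.sum_sub_distrib, Finset.sum_add_distrib, Finset.smul_sum]
    rw [Finset.sum_comm (s := Finset.range N)]
  rw [e]
  have hlin : ‖(∑ x : Fin q × Fin q, (M.G α x.1 x.2 - M.G α₀ x.1 x.2) •
        ∑ i ∈ Finset.range N, score T M μ (derivG M α₀ x.1 x.2) i β ω) +
      (M.sigmaSq α - M.sigmaSq α₀) •
        ∑ i ∈ Finset.range N, score T M μ (derivSigma M α₀) i β ω‖ ≤
      covDist M α α₀ * ((∑ x : Fin q × Fin q,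
        ‖∑ i ∈ Finset.range N, score T M μ (derivG M α₀ x.1 x.2) i β ω‖) +
        ‖∑ i ∈ Finset.range N, score T M μ (derivSigma M α₀) i β ω‖) := by
    have hG0 : 0 ≤ ∑ j, ∑ k, |M.G α j k - M.G α₀ j k| :=
      Finset.sum_nonneg fun _ _ => Finset.sum_nonneg fun _ _ => abs_nonneg _
    rw [mul_add]
    refine (norm_add_le _ _).trans (add_le_add ?_ ?_)
    · rw [Finset.mul_sum]
      refine norm_sum_le_of_le _ fun x _ => ?_
      rw [norm_smul, Real.norm_eq_abs]
      refine mul_le_mul_of_nonneg_right ?_ (norm_nonneg _)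
      refine le_trans ?_ (le_add_of_nonneg_right (abs_nonneg _))
      rw [← Fintype.sum_prod_type']
      exact Finset.single_le_sum (f := fun x : Fin q × Fin q => |M.G α x.1 x.2 - M.G α₀ x.1 x.2|)
        (fun _ _ => abs_nonneg _) (Finset.mem_univ x)
    · rw [norm_smul, Real.norm_eq_abs]
      exact mul_le_mul_of_nonneg_right (le_add_of_nonneg_left hG0) (norm_nonneg _)
  have hrem : ‖∑ i ∈ Finset.range N, score T M μ (remV M α α₀) i β ω‖ ≤
      w * (1 + ‖β‖) * ((M.sigmaSq α)⁻¹ * (M.sigmaSq α₀)⁻¹ ^ 2 * covDist M α α₀ ^ 2) *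
        ∑ i ∈ Finset.range N, envSum T M i ω ^ 2 := by
    rw [Finset.mul_sum]
    exact norm_sum_le_of_le _ fun i _ => norm_score_le_envSum_sq T M hw0 (by positivity) hw
      (norm_remV_le M hα hα₀) (hω i) β
  refine (norm_sub_le _ _).trans ?_
  linarith

end Expansion

end SMART

end

namespace SMART

/-! ### Projections, quadratic forms and symmetry -/

theorem norm_le_sum_abs {k : ℕ} (v : Vec k) : ‖v‖ ≤ ∑ a, |v a| := by
  rw [EuclideanSpace.norm_eq]
  refine Real.sqrt_le_iff.2 ⟨Finset.sum_nonneg fun _ _ => abs_nonneg _, ?_⟩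
  simpa using Finset.sum_sq_le_sq_sum_of_nonneg (s := Finset.univ) (f := fun a => |v a|)
    fun a _ => abs_nonneg _

/-- The Cramér–Wold device: the vector limit reduces to scalar sums. -/
theorem charFun_map_eq_charFun_map_inner {Ω : Type*} [MeasurableSpace Ω] {μ : Measure Ω} {k : ℕ}
    {Z : Ω → Vec k} (hZ : AEMeasurable Z μ) (t : Vec k) :
    charFun (μ.map Z) t = charFun (μ.map fun ω => inner ℝ (Z ω) t) 1 := by
  rw [charFun_apply, charFun_apply, integral_map hZ (by fun_prop), integral_map (by fun_prop)
    (by fun_prop)]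
  simp

theorem sum_mul_sq_eq {k : ℕ} (s u : Fin k → ℝ) :
    (∑ a, s a * u a) ^ 2 = ∑ a, ∑ b, s a * s b * (u a * u b) := by
  rw [sq, Finset.sum_mul_sum]
  exact Finset.sum_congr rfl fun a _ => Finset.sum_congr rfl fun b _ => by ring

theorem dotProduct_mulVec_eq_sum {k : ℕ} (s : Fin k → ℝ) (A : Matrix (Fin k) (Fin k) ℝ) :
    s ⬝ᵥ A *ᵥ s = ∑ a, ∑ b, s a * s b * A a b := by
  simp only [dotProduct, Matrix.mulVec, Finset.mul_sum]
  exact Finset.sum_congr rfl fun a _ => Finset.sum_congr rfl fun b _ => by ring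

section Symmetry

variable {Ω 𝓛 : Type*} [MeasurableSpace Ω] [MeasurableSpace 𝓛] {n : ℕ → ℕ} {p q r : ℕ}
  {μ : Measure Ω}

theorem V_isSymm (M : WorkingModel 𝓛 n p q r) {α : Vec r} (hα : α ∈ M.params) (i : ℕ) (d : DTR)
    (l : 𝓛) : (M.V i d l α)ᵀ = M.V i d l α := by
  simpa using (V_posDef M hα i d l).isHermitian.eq

theorem H_isSymm (T : Trial Ω 𝓛 n) (M : WorkingModel 𝓛 n p q r) {α : Vec r} (hα : α ∈ M.params)
    (i : ℕ) (ω : Ω) : (H T M μ i α ω)ᵀ = H T M μ i α ω := by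
  simp only [H, Matrix.transpose_sum, Matrix.transpose_smul, Matrix.transpose_mul,
    Matrix.transpose_transpose, Matrix.transpose_nonsing_inv, V_isSymm M hα, Matrix.mul_assoc]

end Symmetry

/-! ### Limits of sums of scores and of information matrices -/

section Limits

variable {Ω 𝓛 : Type*} [MeasurableSpace Ω] [StandardBorelSpace Ω] [MeasurableSpace 𝓛] {n : ℕ → ℕ}
  {p q r : ℕ}

/-- The conditions under which sums of scores and of information matrices have limits: the causal
assumptions, the model for the marginal means, with parameter `β`, and moments of order `2 + η`. -/
structure ModelConditions (T : Trial Ω 𝓛 n) (M : WorkingModel 𝓛 n p q r) (μ : Measure Ω)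
    [IsProbabilityMeasure μ] (β : Vec p) (η C : ℝ) : Prop where
  indep : IndependentParticipants T μ
  design : SecondStageDesign T μ
  mean : CorrectMean T M μ β
  rand : SequentialRandomization T μ
  cons : Consistency T μ
  pos : Positivity T μ
  eta_pos : 0 < η
  eta_le_one : η ≤ 1
  moment : EnvelopeMoment T M μ η C

variable {T : Trial Ω 𝓛 n} {M : WorkingModel 𝓛 n p q r} {μ : Measure Ω} [IsProbabilityMeasure μ]
  {β : Vec p} {η C κ : ℝ} {K : ∀ i : ℕ, DTR → 𝓛 → Matrix (Fin (n i)) (Fin (n i)) ℝ}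

open scoped Matrix.Norms.L2Operator

theorem ModelConditions.exists_ae_abs_score_le (h : ModelConditions T M μ β η C) (hκ : 0 ≤ κ)
    (hK : ∀ i d l, ‖K i d l‖ ≤ κ * (1 + frob (M.Z i d l) ^ 2)) :
    ∃ c, 0 ≤ c ∧ ∀ i, ∀ᵐ ω ∂μ, ∀ a, |score T M μ K i β ω a| ≤ c * envSum T M i ω := by
  obtain ⟨w, hw0, hw⟩ := exists_wTilde_le T h.pos
  refine ⟨w * (1 + ‖β‖) * κ, by positivity, fun i => ?_⟩
  filter_upwards [ae_outcome_eq T h.cons] with ω hω a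
  rw [← Real.norm_eq_abs]
  exact (PiLp.norm_apply_le _ a).trans (norm_score_le_envSum T M hw0 hκ hw hK (hω i) β)

theorem ModelConditions.integral_score_eq_zero (h : ModelConditions T M μ β η C) (hκ : 0 ≤ κ)
    (hKm : ∀ i d j k, Measurable fun l => K i d l j k)
    (hK : ∀ i d l, ‖K i d l‖ ≤ κ * (1 + frob (M.Z i d l) ^ 2)) (i : ℕ) (a : Fin p) :
    ∫ ω, score T M μ K i β ω a ∂μ = 0 := by
  rw [← integral_condExp (T.measurable_L i).comap_le, integral_congr_ae
    (condExp_score_eq_zero T M h.eta_pos.le h.moment h.design h.rand h.cons h.pos h.mean hκ hKm hK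
      i a)]
  simp

/-- Centering, independence and second moments allow Chebyshev's inequality in each coordinate. It
is applied to `V⁻¹` and also to its derivatives, where it makes the first-order effect of estimating
`α` vanish. -/
theorem ModelConditions.boundedInProb_sum_score (h : ModelConditions T M μ β η C) (hκ : 0 ≤ κ)
    (hKm : ∀ i d j k, Measurable fun l => K i d l j k)
    (hK : ∀ i d l, ‖K i d l‖ ≤ κ * (1 + frob (M.Z i d l) ^ 2)) :
    BoundedInProb μ fun N ω => (√(N : ℝ))⁻¹ * ‖∑ i ∈ Finset.range N, score T M μ K i β ω‖ := by
  obtain ⟨c, -, hb⟩ := h.exists_ae_abs_score_le hκ hK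
  have key := fun a i => integrable_sq_of_abs_le T M h.eta_pos.le h.moment
    (measurable_score_apply T M (μ := μ) hKm i β a) ((hb i).mono fun ω hω => hω a)
  have hsum := BoundedInProb.sum Finset.univ fun a _ => boundedInProb_inv_sqrt_mul_sum
    (fun i => (key a i).1)
    (iIndepFun_of_eq_comp_obs T h.indep fun i => exists_score_eq_comp_obs T M hKm i β a)
    (fun i => h.integral_score_eq_zero hκ hKm hK i a) fun i => (key a i).2
  refine hsum.mono (.of_ae (Eventually.of_forall fun N => Eventually.of_forall fun ω => ?_))
  have h0 : 0 ≤ (√(N : ℝ))⁻¹ := by positivity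
  simp only [abs_mul, abs_of_nonneg h0, ← Finset.mul_sum]
  refine mul_le_mul_of_nonneg_left ((norm_le_sum_abs _).trans (le_of_eq ?_)) h0
  simp

theorem ModelConditions.tendsto_average_integral_H (h : ModelConditions T M μ β η C) {α : Vec r}
    (hα : α ∈ M.params) {A : Matrix (Fin p) (Fin p) ℝ}
    (hA : LimitMeanCond T μ (fun i => H T M μ i α) A) (a b : Fin p) :
    Tendsto (fun N : ℕ => (N : ℝ)⁻¹ * ∑ i ∈ Finset.range N, ∫ ω, H T M μ i α ω a b ∂μ) atTop
      (𝓝 (A a b)) ∧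
    SmallInProb μ fun N ω => |(N : ℝ)⁻¹ * ∑ i ∈ Finset.range N, H T M μ i α ω a b - A a b| := by
  obtain ⟨w, hw0, hw⟩ := exists_wTilde_le T h.pos
  have hκ : 0 ≤ (M.sigmaSq α)⁻¹ := inv_nonneg.2 (M.sigmaSq_pos α hα).le
  have hm : ∀ i, Measurable fun ω => H T M μ i α ω a b := fun i =>
    measurable_info_apply T M (measurable_invV M α) i a b
  have hb : ∀ i, ∀ᵐ ω ∂μ, |H T M μ i α ω a b| ≤ w * (M.sigmaSq α)⁻¹ * envSum T M i ω := fun i =>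
    Eventually.of_forall fun ω => abs_info_le_envSum T M hw0 hκ hw (norm_invV_le M hα) i ω a b
  have key := fun i => integrable_rpow_of_abs_le T M h.eta_pos.le h.moment (hm i)
    (mul_nonneg hw0 hκ) (hb i)
  have hlim := tendsto_average_integral (fun i => (T.measurable_L i).comap_le)
    (by linarith [h.eta_pos] : 1 < 2 + η) (fun i => (hm i).aestronglyMeasurable)
    (fun i => (key i).1) (fun i => (key i).2) (hA a b)
  have hsq := fun i => integrable_sq_of_abs_le T M h.eta_pos.le h.moment (hm i) (hb i)
  exact ⟨hlim, smallInProb_average_sub (fun i => (hsq i).1)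
    (iIndepFun_of_eq_comp_obs T h.indep fun i =>
      exists_info_eq_comp_obs T M (measurable_invV M α) i a b) (fun i => (hsq i).2) hlim⟩

/-- Symmetry of each `H` passes to the limit of the means; it is needed to write the sandwich with
`J⁻¹` on both sides. -/
theorem ModelConditions.limit_H_isSymm (h : ModelConditions T M μ β η C) {α : Vec r}
    (hα : α ∈ M.params) {A : Matrix (Fin p) (Fin p) ℝ}
    (hA : LimitMeanCond T μ (fun i => H T M μ i α) A) : Aᵀ = A := by
  ext a b
  refine tendsto_nhds_unique (h.tendsto_average_integral_H hα hA b a).1 ?_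
  have e : ∀ i ω, H T M μ i α ω b a = H T M μ i α ω a b := fun i ω =>
    congrFun (congrFun (H_isSymm T M hα i ω) a) b
  simp only [e]
  exact (h.tendsto_average_integral_H hα hA a b).1

theorem ModelConditions.tendsto_average_integral_score_mul (h : ModelConditions T M μ β η C)
    (hκ : 0 ≤ κ) (hKm : ∀ i d j k, Measurable fun l => K i d l j k)
    (hK : ∀ i d l, ‖K i d l‖ ≤ κ * (1 + frob (M.Z i d l) ^ 2)) {I : Matrix (Fin p) (Fin p) ℝ}
    (hI : LimitMeanCond T μ (fun i ω => Matrix.vecMulVec (score T M μ K i β ω).ofLp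
      (score T M μ K i β ω).ofLp) I) (a b : Fin p) :
    (∀ i, Integrable (fun ω => score T M μ K i β ω a * score T M μ K i β ω b) μ) ∧
    Tendsto (fun N : ℕ => (N : ℝ)⁻¹ * ∑ i ∈ Finset.range N,
      ∫ ω, score T M μ K i β ω a * score T M μ K i β ω b ∂μ) atTop (𝓝 (I a b)) := by
  obtain ⟨c, hc0, hb⟩ := h.exists_ae_abs_score_le hκ hK
  have hη := h.eta_pos
  have hm : ∀ i, Measurable fun ω => score T M μ K i β ω a * score T M μ K i β ω b := fun i =>
    (measurable_score_apply T M hKm i β a).mul (measurable_score_apply T M hKm i β b)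
  have hsq := fun a i => integrable_sq_of_abs_le T M h.eta_pos.le h.moment
    (measurable_score_apply T M (μ := μ) hKm i β a) ((hb i).mono fun ω hω => hω a)
  refine ⟨fun i => (hsq a i).1.integrable_mul (hsq b i).1, ?_⟩
  -- A product of two scores is dominated by the squared envelope, and `2 + η = 2 (1 + η / 2)`: the
  -- moment beyond the second is what makes these products uniformly integrable.
  have hle : ∀ i, ∀ᵐ ω ∂μ, |score T M μ K i β ω a * score T M μ K i β ω b| ^ (1 + η / 2) ≤
      c ^ (2 + η) * envSum T M i ω ^ (2 + η) := fun i => by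
    filter_upwards [hb i] with ω hω
    have hE := envSum_nonneg T M i ω
    have e : (2 + η) = 2 * (1 + η / 2) := by ring
    rw [← Real.mul_rpow hc0 hE, e, Real.rpow_mul (mul_nonneg hc0 hE), abs_mul]
    refine Real.rpow_le_rpow (by positivity) ?_ (by linarith)
    rw [Real.rpow_two, sq]
    exact mul_le_mul (hω a) (hω b) (abs_nonneg _) (mul_nonneg hc0 hE)
  have hint : ∀ i, Integrable (fun ω => c ^ (2 + η) * envSum T M i ω ^ (2 + η)) μ := fun i =>
    (h.moment i).1.const_mul _
  have hint' : ∀ i, Integrable (fun ω => |score T M μ K i β ω a * score T M μ K i β ω b| ^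
      (1 + η / 2)) μ := fun i =>
    (hint i).mono' ((hm i).abs.pow_const _).aestronglyMeasurable ((hle i).mono fun ω hω => by
      rwa [Real.norm_eq_abs, abs_of_nonneg (by positivity)])
  refine tendsto_average_integral (fun i => (T.measurable_L i).comap_le)
    (by linarith : 1 < 1 + η / 2) (C := c ^ (2 + η) * C) (fun i => (hm i).aestronglyMeasurable)
    hint' (fun i => ?_) (hI a b)
  refine (integral_mono_ae (hint' i) (hint i) (hle i)).trans ?_
  rw [integral_const_mul]
  exact mul_le_mul_of_nonneg_left (h.moment i).2 (by positivity)

theorem ModelConditions.tendsto_average_integral_sq (h : ModelConditions T M μ β η C)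
    (hκ : 0 ≤ κ) (hKm : ∀ i d j k, Measurable fun l => K i d l j k)
    (hK : ∀ i d l, ‖K i d l‖ ≤ κ * (1 + frob (M.Z i d l) ^ 2)) {I : Matrix (Fin p) (Fin p) ℝ}
    (hI : LimitMeanCond T μ (fun i ω => Matrix.vecMulVec (score T M μ K i β ω).ofLp
      (score T M μ K i β ω).ofLp) I) (s : Fin p → ℝ) :
    Tendsto (fun N : ℕ => (N : ℝ)⁻¹ * ∑ i ∈ Finset.range N,
      ∫ ω, (∑ a, s a * score T M μ K i β ω a) ^ 2 ∂μ) atTop (𝓝 (s ⬝ᵥ I *ᵥ s)) := by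
  have key := h.tendsto_average_integral_score_mul hκ hKm hK hI
  have e : ∀ i, ∫ ω, (∑ a, s a * score T M μ K i β ω a) ^ 2 ∂μ =
      ∑ a, ∑ b, s a * s b * ∫ ω, score T M μ K i β ω a * score T M μ K i β ω b ∂μ := fun i => by
    simp only [sum_mul_sq_eq]
    rw [integral_finsetSum _ fun a _ => integrable_finsetSum _ fun b _ =>
      ((key a b).1 i).const_mul _]
    refine Finset.sum_congr rfl fun a _ => ?_
    rw [integral_finsetSum _ fun b _ => ((key a b).1 i).const_mul _]
    exact Finset.sum_congr rfl fun b _ => integral_const_mul _ _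
  have hl := tendsto_finsetSum Finset.univ fun a _ => tendsto_finsetSum Finset.univ
    fun b _ => (key a b).2.const_mul (s a * s b)
  rw [dotProduct_mulVec_eq_sum]
  refine hl.congr fun N => ?_
  simp only [e]
  rw [Finset.sum_comm (s := Finset.range N), Finset.mul_sum]
  refine Finset.sum_congr rfl fun a _ => ?_
  rw [Finset.sum_comm (s := Finset.range N), Finset.mul_sum]
  refine Finset.sum_congr rfl fun b _ => ?_
  rw [← Finset.mul_sum]
  ring

/-- The limit inherits symmetry and nonnegativity from second moments of scores. The formula for the
Gaussian characteristic function requires it. -/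
theorem ModelConditions.limit_score_posSemidef (h : ModelConditions T M μ β η C)
    (hκ : 0 ≤ κ) (hKm : ∀ i d j k, Measurable fun l => K i d l j k)
    (hK : ∀ i d l, ‖K i d l‖ ≤ κ * (1 + frob (M.Z i d l) ^ 2)) {I : Matrix (Fin p) (Fin p) ℝ}
    (hI : LimitMeanCond T μ (fun i ω => Matrix.vecMulVec (score T M μ K i β ω).ofLp
      (score T M μ K i β ω).ofLp) I) : I.PosSemidef := by
  refine .of_dotProduct_mulVec_nonneg ?_ fun s => ?_
  · ext a b
    simp only [Matrix.conjTranspose_apply, star_trivial]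
    refine tendsto_nhds_unique (h.tendsto_average_integral_score_mul hκ hKm hK hI b a).2 ?_
    simp only [fun i ω => mul_comm (score T M μ K i β ω b) (score T M μ K i β ω a)]
    exact (h.tendsto_average_integral_score_mul hκ hKm hK hI a b).2
  · rw [star_trivial]
    exact ge_of_tendsto' (h.tendsto_average_integral_sq hκ hKm hK hI s) fun N =>
      mul_nonneg (by positivity) (Finset.sum_nonneg fun i _ => integral_nonneg fun ω => sq_nonneg _)

theorem ModelConditions.tendsto_charFun_sum_score (h : ModelConditions T M μ β η C)
    (hκ : 0 ≤ κ) (hKm : ∀ i d j k, Measurable fun l => K i d l j k)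
    (hK : ∀ i d l, ‖K i d l‖ ≤ κ * (1 + frob (M.Z i d l) ^ 2)) {I : Matrix (Fin p) (Fin p) ℝ}
    (hI : LimitMeanCond T μ (fun i ω => Matrix.vecMulVec (score T M μ K i β ω).ofLp
      (score T M μ K i β ω).ofLp) I) (s : Fin p → ℝ) :
    Tendsto (fun N : ℕ => charFun (μ.map fun ω => (√(N : ℝ))⁻¹ * ∑ i ∈ Finset.range N,
      ∑ a, s a * score T M μ K i β ω a) 1) atTop
      (𝓝 (Complex.exp (-((s ⬝ᵥ I *ᵥ s : ℝ) / 2)))) := by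
  obtain ⟨c, hc0, hb⟩ := h.exists_ae_abs_score_le hκ hK
  have hm : ∀ i, Measurable fun ω => ∑ a, s a * score T M μ K i β ω a := fun i =>
    Finset.measurable_fun_sum _ fun a _ => (measurable_score_apply T M hKm i β a).const_mul _
  have hbs : ∀ i, ∀ᵐ ω ∂μ, |∑ a, s a * score T M μ K i β ω a| ≤
      ((∑ a, |s a|) * c) * envSum T M i ω := fun i => by
    filter_upwards [hb i] with ω hω
    refine (Finset.abs_sum_le_sum_abs _ _).trans ?_
    rw [mul_assoc, Finset.sum_mul]
    exact Finset.sum_le_sum fun a _ => by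
      rw [abs_mul]; exact mul_le_mul_of_nonneg_left (hω a) (abs_nonneg _)
  have key := fun i => integrable_rpow_of_abs_le T M h.eta_pos.le h.moment (hm i)
    (mul_nonneg (Finset.sum_nonneg fun a _ => abs_nonneg _) hc0) (hbs i)
  have hsq := fun a i => integrable_sq_of_abs_le T M h.eta_pos.le h.moment
    (measurable_score_apply T M (μ := μ) hKm i β a) ((hb i).mono fun ω hω => hω a)
  refine tendsto_charFun_inv_sqrt_mul_sum h.eta_pos h.eta_le_one (fun i => (hm i).aemeasurable)
    (iIndepFun_of_eq_comp_obs T h.indep fun i => ?_) (fun i => (key i).1) (fun i => (key i).2)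
    (fun i => ?_) (h.tendsto_average_integral_sq hκ hKm hK hI s)
  · choose Φ hΦ hΦe using fun a => exists_score_eq_comp_obs T M (μ := μ) hKm i β a
    refine ⟨fun x => ∑ a, s a * Φ a x, Finset.measurable_fun_sum _ fun a _ =>
      (hΦ a).const_mul _, ?_⟩
    funext ω
    exact Finset.sum_congr rfl fun a _ => by rw [congrFun (hΦe a) ω]; rfl
  · rw [integral_finsetSum _ fun a _ => ((hsq a i).1.integrable one_le_two).const_mul _]
    exact Finset.sum_eq_zero fun a _ => by
      rw [integral_const_mul, h.integral_score_eq_zero hκ hKm hK i a, mul_zero]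

theorem ModelConditions.tendstoInDistribution_sum_score (h : ModelConditions T M μ β η C)
    (hκ : 0 ≤ κ) (hKm : ∀ i d j k, Measurable fun l => K i d l j k)
    (hK : ∀ i d l, ‖K i d l‖ ≤ κ * (1 + frob (M.Z i d l) ^ 2)) {I : Matrix (Fin p) (Fin p) ℝ}
    (hI : LimitMeanCond T μ (fun i ω => Matrix.vecMulVec (score T M μ K i β ω).ofLp
      (score T M μ K i β ω).ofLp) I) (A : Matrix (Fin p) (Fin p) ℝ) :
    TendstoInDistribution (fun (N : ℕ) ω => (WithLp.toLp 2 (A *ᵥ ((√(N : ℝ))⁻¹ •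
      ∑ i ∈ Finset.range N, score T M μ K i β ω).ofLp) : Vec p)) atTop (id : Vec p → Vec p)
      (fun _ => μ) (multivariateGaussian 0 (A * I * Aᵀ)) := by
  have hmeas : ∀ N : ℕ, Measurable fun ω => (WithLp.toLp 2 (A *ᵥ ((√(N : ℝ))⁻¹ •
      ∑ i ∈ Finset.range N, score T M μ K i β ω).ofLp) : Vec p) := fun N => by
    have h0 : Measurable fun ω => ∑ i ∈ Finset.range N, score T M μ K i β ω :=
      Finset.measurable_fun_sum _ fun i _ => measurable_score T M hKm i β
    have h1 : Measurable fun ω => (√(N : ℝ))⁻¹ • ∑ i ∈ Finset.range N, score T M μ K i β ω :=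
      (measurable_const_smul _).comp h0
    have h2 : Continuous fun v : Vec p => (WithLp.toLp 2 (A *ᵥ v.ofLp) : Vec p) := by fun_prop
    exact h2.measurable.comp h1
  refine ⟨fun N => (hmeas N).aemeasurable, aemeasurable_id, ?_⟩
  refine ProbabilityMeasure.tendsto_iff_tendsto_charFun.2 fun t => ?_
  have hPSD : (A * I * Aᵀ).PosSemidef := by
    simpa using (h.limit_score_posSemidef hκ hKm hK hI).mul_mul_conjTranspose_same A
  -- Projecting `A S` on `t` is projecting `S` on `Aᵀ t`.
  have hlim := h.tendsto_charFun_sum_score hκ hKm hK hI (Aᵀ *ᵥ t.ofLp)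
  have e1 : charFun ((multivariateGaussian 0 (A * I * Aᵀ)).map id) t =
      Complex.exp (-(((Aᵀ *ᵥ t.ofLp) ⬝ᵥ I *ᵥ (Aᵀ *ᵥ t.ofLp) : ℝ) / 2)) := by
    rw [Measure.map_id, charFun_multivariateGaussian hPSD]
    congr 1
    rw [inner_zero_right, Matrix.mulVec_transpose, ← Matrix.dotProduct_mulVec,
      ← Matrix.mulVec_transpose, Matrix.mulVec_mulVec, Matrix.mulVec_mulVec]
    simp
  simp only [ProbabilityMeasure.coe_mk, e1]
  refine hlim.congr fun N => ?_
  rw [charFun_map_eq_charFun_map_inner (hmeas N).aemeasurable]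
  congr 2
  funext ω
  simp only [EuclideanSpace.inner_eq_star_dotProduct, star_trivial, WithLp.ofLp_smul,
    Matrix.mulVec_smul, dotProduct_smul, smul_eq_mul]
  rw [Matrix.dotProduct_mulVec, ← Matrix.mulVec_transpose, WithLp.ofLp_sum]
  congr 1
  simp only [dotProduct, Finset.sum_apply, Finset.mul_sum]
  exact Finset.sum_comm

end Limits

/-! ### The estimating equation: algebra and solvability -/

section Algebra

open scoped Matrix.Norms.L2Operator

theorem norm_mulVec_le_sum_abs {k : ℕ} (A : Matrix (Fin k) (Fin k) ℝ) (v : Vec k) :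
    ‖(WithLp.toLp 2 (A *ᵥ v.ofLp) : Vec k)‖ ≤ (∑ a, ∑ b, |A a b|) * ‖v‖ :=
  (Matrix.l2_opNorm_mulVec A v).trans (mul_le_mul_of_nonneg_right
    ((l2_opNorm_le_frob A).trans (frob_le_sum_abs A)) (norm_nonneg _))

theorem abs_dotProduct_le {k : ℕ} (v w : Vec k) : |v.ofLp ⬝ᵥ w.ofLp| ≤ ‖v‖ * ‖w‖ := by
  have h := abs_real_inner_le_norm w v
  rw [EuclideanSpace.inner_eq_star_dotProduct, star_trivial, mul_comm] at h
  exact h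

theorem mul_norm_le_norm_mulVec {k : ℕ} {A : Matrix (Fin k) (Fin k) ℝ} {c : ℝ} {v : Vec k}
    (h : c * ‖v‖ ^ 2 ≤ v.ofLp ⬝ᵥ (A *ᵥ v.ofLp)) :
    c * ‖v‖ ≤ ‖(WithLp.toLp 2 (A *ᵥ v.ofLp) : Vec k)‖ := by
  rcases (norm_nonneg v).eq_or_lt with h0 | h0
  · rw [← h0]; simp
  · have h1 := (le_abs_self _).trans (abs_dotProduct_le v (WithLp.toLp 2 (A *ᵥ v.ofLp)))
    have h2 : c * ‖v‖ ^ 2 ≤ ‖v‖ * ‖(WithLp.toLp 2 (A *ᵥ v.ofLp) : Vec k)‖ := h.trans h1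
    refine le_of_mul_le_mul_left ?_ h0
    linarith

variable {Ω 𝓛 : Type*} [MeasurableSpace Ω] [MeasurableSpace 𝓛] {n : ℕ → ℕ} {p q r : ℕ}
  {T : Trial Ω 𝓛 n} {M : WorkingModel 𝓛 n p q r} {μ : Measure Ω}

theorem dotProduct_sum_H_mulVec (α : Vec r) (N : ℕ) (ω : Ω) (v : Fin p → ℝ) :
    v ⬝ᵥ (∑ i ∈ Finset.range N, H T M μ i α ω) *ᵥ v =
      ∑ i ∈ Finset.range N, ∑ d ∈ T.dtrs, T.wTilde μ i d ω *
        ((M.X i d (T.L i ω) *ᵥ v) ⬝ᵥ (M.V i d (T.L i ω) α)⁻¹ *ᵥ (M.X i d (T.L i ω) *ᵥ v)) := by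
  simp only [H, Matrix.sum_mulVec, dotProduct_sum, Matrix.smul_mulVec, dotProduct_smul, smul_eq_mul]
  refine Finset.sum_congr rfl fun i _ => Finset.sum_congr rfl fun d _ => ?_
  rw [← Matrix.mulVec_mulVec, ← Matrix.mulVec_mulVec, Matrix.dotProduct_mulVec,
    Matrix.vecMul_transpose]

/-- The form at `α` is a sum of nonnegative terms. As `V(α)⁻¹` is positive definite, its vanishing
forces `X v = 0` wherever the weight is nonzero, a condition free of `α`. -/
theorem dotProduct_sum_H_eq_zero {α α' : Vec r} (hα : α ∈ M.params) {N : ℕ}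
    {ω : Ω} {v : Fin p → ℝ} (h : v ⬝ᵥ (∑ i ∈ Finset.range N, H T M μ i α ω) *ᵥ v = 0) :
    v ⬝ᵥ (∑ i ∈ Finset.range N, H T M μ i α' ω) *ᵥ v = 0 := by
  rw [dotProduct_sum_H_mulVec] at h ⊢
  have hnn : ∀ i d, 0 ≤ T.wTilde μ i d ω *
      ((M.X i d (T.L i ω) *ᵥ v) ⬝ᵥ (M.V i d (T.L i ω) α)⁻¹ *ᵥ (M.X i d (T.L i ω) *ᵥ v)) :=
    fun i d => mul_nonneg (wTilde_nonneg T i d ω) (by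
      simpa using (V_posDef M hα i d (T.L i ω)).inv.posSemidef.dotProduct_mulVec_nonneg
        (M.X i d (T.L i ω) *ᵥ v))
  rw [Finset.sum_eq_zero_iff_of_nonneg fun i _ => Finset.sum_nonneg fun d _ => hnn i d] at h
  refine Finset.sum_eq_zero fun i hi => Finset.sum_eq_zero fun d hd => ?_
  have h1 := (Finset.sum_eq_zero_iff_of_nonneg fun d _ => hnn i d).1 (h i hi) d hd
  rcases mul_eq_zero.1 h1 with h2 | h2
  · rw [h2, zero_mul]
  · have h3 : M.X i d (T.L i ω) *ᵥ v = 0 := by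
      by_contra hne
      have := (V_posDef M hα i d (T.L i ω)).inv.dotProduct_mulVec_pos hne
      rw [star_trivial] at this
      exact this.ne' h2
    simp [h3]

/-- Nondegeneracy at one fixed `α'` carries over to every admissible `α`, near or far. This gives
solvability before `α̂` is known to converge. -/
theorem isUnit_det_sum_H {α α' : Vec r} (hα : α ∈ M.params) {N : ℕ} {ω : Ω}
    (h : ∀ v : Fin p → ℝ, v ≠ 0 → v ⬝ᵥ (∑ i ∈ Finset.range N, H T M μ i α' ω) *ᵥ v ≠ 0) :
    IsUnit (∑ i ∈ Finset.range N, H T M μ i α ω).det := by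
  rw [isUnit_iff_ne_zero]
  intro h0
  obtain ⟨v, hv, h1⟩ := Matrix.exists_mulVec_eq_zero_iff.2 h0
  exact h v hv (dotProduct_sum_H_eq_zero hα (by rw [h1, dotProduct_zero]))

theorem sum_U_eq_add (β β₀ : Vec p) (α : Vec r) (N : ℕ) (ω : Ω) :
    ∑ i ∈ Finset.range N, U T M μ i β α ω = ∑ i ∈ Finset.range N, U T M μ i β₀ α ω +
      WithLp.toLp 2 ((∑ i ∈ Finset.range N, H T M μ i α ω) *ᵥ (β₀ - β).ofLp) := by
  rw [Matrix.sum_mulVec, WithLp.toLp_sum, ← Finset.sum_add_distrib]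
  refine Finset.sum_congr rfl fun i _ => ?_
  rw [U_eq_score_invV, U_eq_score_invV, H_eq_info_invV]
  exact score_eq_add_info T M i β β₀ ω

theorem sum_U_betaHat {α : Vec r} {N : ℕ} {ω : Ω}
    (h : IsUnit (∑ i ∈ Finset.range N, H T M μ i α ω).det) :
    ∑ i ∈ Finset.range N, U T M μ i (betaHat T M μ N α ω) α ω = 0 := by
  rw [sum_U_eq_add _ 0]
  have e : ∑ i ∈ Finset.range N, U T M μ i 0 α ω = WithLp.toLp 2 (∑ i ∈ Finset.range N,
      ∑ d ∈ T.dtrs, T.wTilde μ i d ω •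
        ((M.X i d (T.L i ω))ᵀ *ᵥ ((M.V i d (T.L i ω) α)⁻¹ *ᵥ (T.Y i ω).ofLp))) := by
    simp [U, residual, WithLp.toLp_sum]
  rw [e, ← WithLp.toLp_add, zero_sub, WithLp.ofLp_neg, Matrix.mulVec_neg, betaHat,
    Matrix.mulVec_mulVec, Matrix.mul_nonsing_inv _ h, Matrix.one_mulVec, add_neg_cancel,
    WithLp.toLp_zero]

theorem measurable_betaHat {αhat : Ω → Vec r} (hα : Measurable αhat) (N : ℕ) :
    Measurable fun ω => betaHat T M μ N (αhat ω) ω := by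
  have hV : ∀ i d j k, Measurable fun ω => (M.V i d (T.L i ω) (αhat ω))⁻¹ j k := fun i d j k =>
    (measurable_V_inv_entry M i d j k).comp
      (g := fun x : 𝓛 × Vec r => (M.V i d x.1 x.2)⁻¹ j k) (f := fun ω => (T.L i ω, αhat ω))
      ((T.measurable_L i).prodMk hα)
  have hX : ∀ i d j k, Measurable fun ω => M.X i d (T.L i ω) j k := fun i d j k =>
    (M.measurable_X i d j k).comp (T.measurable_L i)
  have hw : ∀ i d, Measurable fun ω => T.wTilde μ i d ω := fun i d => measurable_wTilde T i d
  have hH : ∀ a b, Measurable fun ω => (∑ i ∈ Finset.range N, H T M μ i (αhat ω) ω) a b := by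
    intro a b
    simp only [Matrix.sum_apply, H, Matrix.smul_apply, smul_eq_mul]
    exact Finset.measurable_fun_sum _ fun i _ => Finset.measurable_fun_sum _ fun d _ =>
      (hw i d).mul (measurable_mul_entry (measurable_mul_entry (fun a b => hX i d b a) (hV i d))
        (hX i d) a b)
  refine (WithLp.measurable_toLp 2 _).comp (measurable_pi_lambda _ fun a => ?_)
  refine measurable_mulVec_entry (measurable_inv_entry hH) (fun b => ?_) a
  simp only [Finset.sum_apply, Pi.smul_apply, smul_eq_mul]
  refine Finset.measurable_fun_sum _ fun i _ => Finset.measurable_fun_sum _ fun d _ =>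
    (hw i d).mul (measurable_mulVec_entry (fun a b => hX i d b a) (fun j =>
      measurable_mulVec_entry (hV i d) (fun k => ?_) j) b)
  exact (measurable_pi_apply k).comp ((WithLp.measurable_ofLp 2 _).comp (T.measurable_Y i))

end Algebra

theorem SmallInProb.const_nonpos {Ω : Type*} [MeasurableSpace Ω] {μ : Measure Ω}
    [IsProbabilityMeasure μ] {x : ℝ} (h : SmallInProb μ fun _ _ => x) : x ≤ 0 := by
  by_contra! hx
  have h1 := h (x / 2) (half_pos hx)
  have h2 : ¬ x ≤ x / 2 := by linarith
  simp only [WithHighProb, h2, not_false_eq_true, Set.ofPred_true, measure_univ] at h1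
  exact one_ne_zero (tendsto_nhds_unique tendsto_const_nhds h1)

/-! ### Identification of the limiting estimating function -/

section Identification

variable {Ω 𝓛 : Type*} [MeasurableSpace Ω] [StandardBorelSpace Ω] [MeasurableSpace 𝓛] {n : ℕ → ℕ}
  {p q r : ℕ} {T : Trial Ω 𝓛 n} {M : WorkingModel 𝓛 n p q r} {μ : Measure Ω}
  [IsProbabilityMeasure μ] {β : Vec p} {η C : ℝ}

/-- `U` is affine in the mean parameter with slope `-H`, and its value at the true parameter is
centered. -/
theorem ModelConditions.condExp_U_apply (h : ModelConditions T M μ β η C) {α : Vec r}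
    (hα : α ∈ M.params) (β' : Vec p) (i : ℕ) :
    ∀ᵐ ω ∂μ, ∀ a, (μ[U T M μ i β' α | T.sigmaL i]) ω a =
      ∑ b, (β - β') b * (μ[fun ω' => H T M μ i α ω' a b | T.sigmaL i]) ω := by
  obtain ⟨w, hw0, hw⟩ := exists_wTilde_le T h.pos
  have hκ : 0 ≤ (M.sigmaSq α)⁻¹ := inv_nonneg.2 (M.sigmaSq_pos α hα).le
  have hKm := measurable_invV M α
  have hE := (integrable_envSum T M h.eta_pos.le h.moment i).1
  have hU : Integrable (U T M μ i β' α) μ := by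
    refine (hE.const_mul (w * (1 + ‖β'‖) * (M.sigmaSq α)⁻¹)).mono'
      (measurable_score T M hKm i β').aestronglyMeasurable ?_
    filter_upwards [ae_outcome_eq T h.cons] with ω hω
    exact norm_score_le_envSum T M hw0 hκ hw (norm_invV_le M hα) (hω i) β'
  obtain ⟨c, -, hb⟩ := h.exists_ae_abs_score_le hκ (norm_invV_le M hα)
  have hS : ∀ a, Integrable (fun ω => score T M μ (invV M α) i β ω a) μ := fun a =>
    integrable_of_abs_le_mul (measurable_score_apply T M hKm i β a) hE
      ((hb i).mono fun ω hω => hω a)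
  have hH : ∀ a b, Integrable (fun ω => H T M μ i α ω a b) μ := fun a b =>
    integrable_of_abs_le_mul (measurable_info_apply T M hKm i a b) hE
      (Eventually.of_forall fun ω =>
        abs_info_le_envSum T M hw0 hκ hw (norm_invV_le M hα) i ω a b)
  refine ae_all_iff.2 fun a => ?_
  have h1 := ContinuousLinearMap.comp_condExp_comm (m := T.sigmaL i) hU
    (EuclideanSpace.proj a : Vec p →L[ℝ] ℝ)
  have e : (EuclideanSpace.proj a : Vec p →L[ℝ] ℝ) ∘ U T M μ i β' α =
      (fun ω => score T M μ (invV M α) i β ω a) +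
        ∑ b, (β - β') b • fun ω => H T M μ i α ω a b := by
    funext ω
    simp only [Function.comp_apply, Pi.add_apply, Finset.sum_apply, Pi.smul_apply, smul_eq_mul,
      PiLp.proj_apply]
    rw [U_eq_score_invV, score_eq_add_info T M i β' β ω]
    simp only [PiLp.add_apply, Matrix.mulVec, dotProduct]
    congr 1
    exact Finset.sum_congr rfl fun b _ => mul_comm _ _
  rw [e] at h1
  have h2 := condExp_add (hS a) (integrable_finsetSum' Finset.univ fun b _ =>
    (hH a b).smul ((β - β') b)) (T.sigmaL i)
  have h3 := condExp_finsetSum (s := Finset.univ) (fun b _ => (hH a b).smul ((β - β') b))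
    (T.sigmaL i)
  have h4 := ae_all_iff.2 fun b => condExp_smul (μ := μ) ((β - β') b)
    (fun ω => H T M μ i α ω a b) (T.sigmaL i)
  have h5 := condExp_score_eq_zero T M h.eta_pos.le h.moment h.design h.rand h.cons h.pos h.mean hκ
    hKm (norm_invV_le M hα) i a
  filter_upwards [h1, h2, h3, h4, h5] with ω h1 h2 h3 h4 h5
  rw [Pi.add_apply, h5, h3, Pi.zero_apply, zero_add, Finset.sum_apply] at h2
  rw [h2] at h1
  refine Eq.trans h1 (Finset.sum_congr rfl fun b _ => ?_)
  rw [h4 b]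
  rfl

/-- With coercivity of `A`, this makes the true parameter a well separated zero of the limit. -/
theorem ModelConditions.limit_U_eq (h : ModelConditions T M μ β η C) {α : Vec r}
    (hα : α ∈ M.params) {A : Matrix (Fin p) (Fin p) ℝ}
    (hA : LimitMeanCond T μ (fun i => H T M μ i α) A) {β' x : Vec p}
    (hx : TendstoInMeasure μ (fun (N : ℕ) ω => (N : ℝ)⁻¹ • (∑ i ∈ Finset.range N,
      (μ[U T M μ i β' α | T.sigmaL i]) ω)) atTop fun _ => x) :
    x = WithLp.toLp 2 (A *ᵥ (β - β').ofLp) := by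
  ext a
  have h1 := tendstoInMeasure_iff_smallInProb.1 hx
  have h2 := SmallInProb.sum Finset.univ fun b _ =>
    (tendstoInMeasure_iff_smallInProb.1 (hA a b)).mul_bounded
      (boundedInProb_const |(β - β') b|) fun _ _ => norm_nonneg _
  have h3 : SmallInProb μ fun _ _ => |x a - (A *ᵥ (β - β').ofLp) a| := by
    refine (h1.add h2).mono (.of_ae (Eventually.of_forall fun N => ?_))
    filter_upwards [ae_all_iff.2 fun i => h.condExp_U_apply hα β' i] with ω hω
    have e : ((N : ℝ)⁻¹ • ∑ i ∈ Finset.range N, (μ[U T M μ i β' α | T.sigmaL i]) ω) a -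
        (A *ᵥ (β - β').ofLp) a = ∑ b, ((N : ℝ)⁻¹ * ∑ i ∈ Finset.range N,
          (μ[fun ω' => H T M μ i α ω' a b | T.sigmaL i]) ω - A a b) * (β - β') b := by
      rw [PiLp.smul_apply, WithLp.ofLp_sum, Finset.sum_apply]
      simp only [hω, sub_mul, Finset.sum_sub_distrib, smul_eq_mul]
      congr 1
      rw [Finset.sum_comm, Finset.mul_sum]
      refine Finset.sum_congr rfl fun b _ => ?_
      rw [← Finset.mul_sum]
      ring
    have h4 := PiLp.norm_apply_le ((N : ℝ)⁻¹ • (∑ i ∈ Finset.range N,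
      (μ[U T M μ i β' α | T.sigmaL i]) ω) - x) a
    rw [PiLp.sub_apply, Real.norm_eq_abs, abs_sub_comm] at h4
    have h5 := (congrArg abs e).trans_le (Finset.abs_sum_le_sum_abs _ _)
    simp only [abs_mul] at h5
    have h6 := abs_sub_le (x a) (((N : ℝ)⁻¹ • (∑ i ∈ Finset.range N,
      (μ[U T M μ i β' α | T.sigmaL i]) ω)) a) ((A *ᵥ (β - β').ofLp) a)
    simp only [Real.norm_eq_abs]
    linarith
  exact sub_eq_zero.1 (abs_eq_zero.1 (h3.const_nonpos.antisymm (abs_nonneg _)))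

end Identification

/-! ### Self-bounding inequalities and random arguments -/

section Probability

variable {Ω : Type*} [MeasurableSpace Ω] {μ : Measure Ω}

/-- If `z ≤ u y + t` and `c y ≤ s + z`, where `u` and `t` tend to zero and `s` is bounded, then `z`
tends to zero. -/
theorem SmallInProb.of_self_bound {u t s y z : ℕ → Ω → ℝ} {c : ℝ} (hc : 0 < c)
    (hu : SmallInProb μ u) (ht : SmallInProb μ t) (hs : BoundedInProb μ s)
    (hu0 : ∀ N ω, 0 ≤ u N ω) (ht0 : ∀ N ω, 0 ≤ t N ω) (hs0 : ∀ N ω, 0 ≤ s N ω)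
    (hy0 : ∀ N ω, 0 ≤ y N ω)
    (h1 : WithHighProb μ fun N ω => z N ω ≤ u N ω * y N ω + t N ω)
    (h2 : WithHighProb μ fun N ω => c * y N ω ≤ s N ω + z N ω) : SmallInProb μ z := by
  -- On the event `u ≤ c / 2`, the first bound inserted into the second gives `c y ≤ s + t + (c / 2)
  -- y`, hence this bound for `y`.
  have hb : BoundedInProb μ fun N ω => 2 / c * (s N ω + t N ω) :=
    (boundedInProb_const (2 / c)).mul (hs.add ht.boundedInProb) (fun _ _ => by positivity)
      fun N ω => add_nonneg (hs0 N ω) (ht0 N ω)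
  refine ((hu.mul_bounded hb hu0).add ht).mono ?_
  refine ((hu (c / 2) (half_pos hc)).and (h1.and h2)).of_imp fun N ω hω => ?_
  obtain ⟨h3, h4, h5⟩ := hω
  have h6 : y N ω ≤ 2 / c * (s N ω + t N ω) := by
    have h7 : u N ω * y N ω ≤ c / 2 * y N ω := mul_le_mul_of_nonneg_right h3 (hy0 N ω)
    rw [div_mul_eq_mul_div, le_div_iff₀ hc]
    linarith
  have h8 := mul_le_mul_of_nonneg_left h6 (hu0 N ω)
  linarith

theorem RootNConsistent.boundedInProb_ratio {p r : ℕ} {B : Set (Vec p)} {β₀ : Vec p}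
    {αhatAt : ℕ → Vec p → Ω → Vec r} {αstar : Vec p → Vec r}
    (h : RootNConsistent μ B β₀ αhatAt αstar) {b : ℕ → Ω → Vec p}
    (hb : WithHighProb μ fun N ω => b N ω ∈ B) (hsmall : SmallInProb μ fun N ω => ‖b N ω - β₀‖) :
    BoundedInProb μ fun N ω => ‖αhatAt N (b N ω) ω - αhatAt N β₀ ω‖ / ‖b N ω - β₀‖ := by
  obtain ⟨-, δ, hδ, h⟩ := h
  intro ε hε
  obtain ⟨K, hK⟩ := h (ε / 2) (by positivity)
  -- The local bound is uniform in `β`, so it applies at the random point `b`. Where `b = β₀` the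
  -- quotient is `0` by convention, which the maximum covers.
  refine ⟨max K 0, ?_⟩
  filter_upwards [hK, (hb.and (hsmall (δ / 2) (half_pos hδ))).exists_eventually_le (half_pos hε)]
    with N h1 h2
  refine (measure_mono fun ω hω => ?_).trans ((measure_union_le _ _).trans
    ((add_le_add h1 h2).trans_eq ?_))
  · by_contra hc
    rw [Set.mem_union, not_or] at hc
    obtain ⟨hc1, hc2⟩ := hc
    simp only [Set.mem_ofPred_eq, not_exists, not_and, not_lt] at hω hc1
    replace hc2 : b N ω ∈ B ∧ ‖b N ω - β₀‖ ≤ δ / 2 := not_not.1 hc2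
    have h3 := hc1 _ hc2.1 (by linarith [hc2.2])
    rcases (norm_nonneg (b N ω - β₀)).eq_or_lt with h0 | h0
    · rw [← h0, div_zero] at hω
      exact absurd hω (not_lt.2 (le_max_right _ _))
    · rw [lt_div_iff₀ h0] at hω
      exact absurd (h3.trans (mul_le_mul_of_nonneg_right (le_max_left K 0) h0.le)) (not_le.2 hω)
  · rw [← ENNReal.ofReal_add (by positivity) (by positivity), add_halves]

theorem smallInProb_inv_sqrt : SmallInProb μ fun N _ => (√(N : ℝ))⁻¹ := by
  have h : Tendsto (fun N : ℕ => (√(N : ℝ))⁻¹) atTop (𝓝 0) :=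
    tendsto_inv_atTop_zero.comp (Real.tendsto_sqrt_atTop.comp tendsto_natCast_atTop_atTop)
  exact (SmallInProb.of_tendsto h).mono
    (.of_ae (Eventually.of_forall fun _ => Eventually.of_forall fun _ => le_abs_self _))

end Probability

theorem isUnit_det_of_coercive {k : ℕ} {A : Matrix (Fin k) (Fin k) ℝ} {c : ℝ} (hc : 0 < c)
    (h : ∀ v : Vec k, c * ‖v‖ ^ 2 ≤ v.ofLp ⬝ᵥ (A *ᵥ v.ofLp)) : IsUnit A.det := by
  rw [isUnit_iff_ne_zero]
  intro h0
  obtain ⟨v, hv, h1⟩ := Matrix.exists_mulVec_eq_zero_iff.2 h0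
  have h2 := h (WithLp.toLp 2 v)
  rw [WithLp.ofLp_toLp, h1, dotProduct_zero] at h2
  have h3 : 0 < ‖(WithLp.toLp 2 v : Vec k)‖ := norm_pos_iff.2 (by simpa using hv)
  have : 0 < c * ‖(WithLp.toLp 2 v : Vec k)‖ ^ 2 := by positivity
  linarith

theorem inv_mul_sqrt_eq (N : ℕ) : (N : ℝ)⁻¹ * √(N : ℝ) = (√(N : ℝ))⁻¹ := by
  rcases Nat.eq_zero_or_pos N with rfl | hN
  · simp
  · have : 0 < √(N : ℝ) := Real.sqrt_pos.2 (by exact_mod_cast hN)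
    have h2 : √(N : ℝ) * √(N : ℝ) = N := Real.mul_self_sqrt (by positivity)
    field_simp
    rw [sq, h2]

/-! ### Linearization of the estimating equation -/

section Expansion

variable {Ω 𝓛 : Type*} [MeasurableSpace Ω] [MeasurableSpace 𝓛] {n : ℕ → ℕ} {p q r : ℕ}
  {T : Trial Ω 𝓛 n} {M : WorkingModel 𝓛 n p q r} {μ : Measure Ω} {α₀ : Vec r}
  {A : Matrix (Fin p) (Fin p) ℝ} {αhat : ℕ → Ω → Vec r}

theorem withHighProb_covDist_le (hα₀ : α₀ ∈ M.params)
    (hG : ∀ j k, DifferentiableAt ℝ (fun α => M.G α j k) α₀) (hσ : DifferentiableAt ℝ M.sigmaSq α₀)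
    (hmem : WithHighProb μ fun N ω => αhat N ω ∈ M.params)
    (hδ : SmallInProb μ fun N ω => ‖αhat N ω - α₀‖) :
    ∃ D, 0 ≤ D ∧ WithHighProb μ fun N ω => αhat N ω ∈ M.params ∧
      covDist M (αhat N ω) α₀ ≤ D * ‖αhat N ω - α₀‖ ∧
      (M.sigmaSq (αhat N ω))⁻¹ ≤ (M.sigmaSq α₀ / 2)⁻¹ := by
  obtain ⟨ρ, hρ, D, hD, hle⟩ := exists_covDist_le M hα₀ hG hσ
  refine ⟨D, hD, (hmem.and (hδ (ρ / 2) (half_pos hρ))).of_imp fun N ω hω => ?_⟩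
  have h1 := hle (αhat N ω) (by linarith [hω.2])
  exact ⟨hω.1, h1.1, inv_anti₀ (half_pos (M.sigmaSq_pos α₀ hα₀)) h1.2⟩

/-- Since `U` is affine in `β`, the expansion is exact. Two errors remain: the averaged `H` against
`A`, and `α` against `α₀` in the score at `β`. -/
theorem norm_linearization_le {β b : Vec p} {α : Vec r} {N : ℕ} {ω : Ω}
    (hU : ∑ i ∈ Finset.range N, U T M μ i b α ω = 0) :
    ‖(WithLp.toLp 2 (A *ᵥ (√(N : ℝ) • (b - β)).ofLp) : Vec p) -
      (√(N : ℝ))⁻¹ • ∑ i ∈ Finset.range N, U T M μ i β α₀ ω‖ ≤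
    (∑ j, ∑ k, |((N : ℝ)⁻¹ • (∑ i ∈ Finset.range N, H T M μ i α ω) - A) j k|) *
      ‖√(N : ℝ) • (b - β)‖ + (√(N : ℝ))⁻¹ * ‖∑ i ∈ Finset.range N, U T M μ i β α ω -
        ∑ i ∈ Finset.range N, U T M μ i β α₀ ω‖ := by
  have h1 : ∑ i ∈ Finset.range N, U T M μ i β α ω =
      WithLp.toLp 2 ((∑ i ∈ Finset.range N, H T M μ i α ω) *ᵥ (b - β).ofLp) := by
    rw [sum_U_eq_add b β α N ω] at hU
    rw [eq_neg_of_add_eq_zero_left hU, ← WithLp.toLp_neg, ← Matrix.mulVec_neg, ← WithLp.ofLp_neg,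
      neg_sub]
  have h2 : (WithLp.toLp 2 (A *ᵥ (√(N : ℝ) • (b - β)).ofLp) : Vec p) -
      (√(N : ℝ))⁻¹ • ∑ i ∈ Finset.range N, U T M μ i β α₀ ω =
      -(WithLp.toLp 2 (((N : ℝ)⁻¹ • (∑ i ∈ Finset.range N, H T M μ i α ω) - A) *ᵥ
        (√(N : ℝ) • (b - β)).ofLp)) + (√(N : ℝ))⁻¹ • (∑ i ∈ Finset.range N, U T M μ i β α ω -
        ∑ i ∈ Finset.range N, U T M μ i β α₀ ω) := by
    rw [h1]
    generalize b - β = v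
    rw [smul_sub, Matrix.sub_mulVec, WithLp.toLp_sub, Matrix.smul_mulVec, WithLp.ofLp_smul,
      Matrix.mulVec_smul (∑ i ∈ Finset.range N, H T M μ i α ω), smul_smul, inv_mul_sqrt_eq,
      WithLp.toLp_smul]
    abel
  rw [h2]
  refine (norm_add_le _ _).trans (add_le_add ?_ ?_)
  · rw [norm_neg]
    exact norm_mulVec_le_sum_abs _ _
  · rw [norm_smul, Real.norm_of_nonneg (by positivity)]

/-- The quadratic remainder, of size `√N ‖α - α₀‖²` times an average, is written as `‖α - α₀‖` times
`√N ‖α - α₀‖`: one factor will be small while the other is controlled by the rate condition. -/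
theorem inv_sqrt_mul_norm_sum_U_sub_le {w D : ℝ} (hw0 : 0 ≤ w)
    (hw : ∀ i, ∀ d ∈ T.dtrs, ∀ ω, T.wTilde μ i d ω ≤ w) {α : Vec r} (hα : α ∈ M.params)
    (hα₀ : α₀ ∈ M.params) (hcov : covDist M α α₀ ≤ D * ‖α - α₀‖)
    (hσ : (M.sigmaSq α)⁻¹ ≤ (M.sigmaSq α₀ / 2)⁻¹) (N : ℕ) {ω : Ω}
    (hω : ∀ i, ∀ d ∈ T.dtrs, T.wTilde μ i d ω ≠ 0 → T.Y i ω = T.Ypot i d ω) (β : Vec p) :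
    (√(N : ℝ))⁻¹ * ‖∑ i ∈ Finset.range N, U T M μ i β α ω -
      ∑ i ∈ Finset.range N, U T M μ i β α₀ ω‖ ≤
    ‖α - α₀‖ * (D * ((∑ x : Fin q × Fin q, (√(N : ℝ))⁻¹ *
      ‖∑ i ∈ Finset.range N, score T M μ (derivG M α₀ x.1 x.2) i β ω‖) +
      (√(N : ℝ))⁻¹ * ‖∑ i ∈ Finset.range N, score T M μ (derivSigma M α₀) i β ω‖)) +
    ‖α - α₀‖ * (w * (1 + ‖β‖) * ((M.sigmaSq α₀ / 2)⁻¹ * (M.sigmaSq α₀)⁻¹ ^ 2 * D ^ 2) *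
      ((N : ℝ)⁻¹ * ∑ i ∈ Finset.range N, envSum T M i ω ^ 2)) * (√(N : ℝ) * ‖α - α₀‖) := by
  have hs := norm_sum_U_sub_le T M hw0 hw hα hα₀ N hω β
  have hσ0 := M.sigmaSq_pos α₀ hα₀
  have hcd := covDist_nonneg M α α₀
  have hQ0 : 0 ≤ ∑ i ∈ Finset.range N, envSum T M i ω ^ 2 :=
    Finset.sum_nonneg fun i _ => sq_nonneg _
  have hsq : (N : ℝ)⁻¹ * √(N : ℝ) = (√(N : ℝ))⁻¹ := inv_mul_sqrt_eq N
  have hsq0 : 0 ≤ (√(N : ℝ))⁻¹ := by positivity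
  rw [← Finset.mul_sum, ← mul_add]
  have hV0 : 0 ≤ (∑ x : Fin q × Fin q, ‖∑ i ∈ Finset.range N,
      score T M μ (derivG M α₀ x.1 x.2) i β ω‖) +
      ‖∑ i ∈ Finset.range N, score T M μ (derivSigma M α₀) i β ω‖ := by positivity
  generalize (∑ x : Fin q × Fin q, ‖∑ i ∈ Finset.range N,
    score T M μ (derivG M α₀ x.1 x.2) i β ω‖) +
      ‖∑ i ∈ Finset.range N, score T M μ (derivSigma M α₀) i β ω‖ = V at hs hV0 ⊢
  generalize ∑ i ∈ Finset.range N, envSum T M i ω ^ 2 = Q at hs hQ0 ⊢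
  have hs2 : ‖∑ i ∈ Finset.range N, U T M μ i β α ω - ∑ i ∈ Finset.range N, U T M μ i β α₀ ω‖ ≤
      D * ‖α - α₀‖ * V + w * (1 + ‖β‖) * ((M.sigmaSq α₀ / 2)⁻¹ * (M.sigmaSq α₀)⁻¹ ^ 2 *
        (D * ‖α - α₀‖) ^ 2) * Q := by
    refine hs.trans (add_le_add (mul_le_mul_of_nonneg_right hcov hV0) ?_)
    gcongr
  refine (mul_le_mul_of_nonneg_left hs2 hsq0).trans (le_of_eq ?_)
  rw [← hsq]
  ring

end Expansion

/-! ### Solvability and asymptotic linearity -/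

section Main

variable {Ω 𝓛 : Type*} [MeasurableSpace Ω] [StandardBorelSpace Ω] [MeasurableSpace 𝓛] {n : ℕ → ℕ}
  {p q r : ℕ} {T : Trial Ω 𝓛 n} {M : WorkingModel 𝓛 n p q r} {μ : Measure Ω}
  [IsProbabilityMeasure μ] {β : Vec p} {η C c : ℝ} {α₀ : Vec r} {A : Matrix (Fin p) (Fin p) ℝ}
  {αhat : ℕ → Ω → Vec r}

theorem ModelConditions.smallInProb_sum_abs_H_sub (h : ModelConditions T M μ β η C)
    (hα₀ : α₀ ∈ M.params) (hA : LimitMeanCond T μ (fun i => H T M μ i α₀) A) :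
    SmallInProb μ fun N ω => ∑ a, ∑ b,
      |(N : ℝ)⁻¹ * ∑ i ∈ Finset.range N, H T M μ i α₀ ω a b - A a b| :=
  SmallInProb.sum _ fun a _ => SmallInProb.sum _ fun b _ =>
    (h.tendsto_average_integral_H hα₀ hA a b).2

theorem ModelConditions.withHighProb_isUnit_det (h : ModelConditions T M μ β η C)
    (hα₀ : α₀ ∈ M.params) (hA : LimitMeanCond T μ (fun i => H T M μ i α₀) A) (hc : 0 < c)
    (hcA : ∀ v : Vec p, c * ‖v‖ ^ 2 ≤ v.ofLp ⬝ᵥ (A *ᵥ v.ofLp))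
    (hmem : WithHighProb μ fun N ω => αhat N ω ∈ M.params) :
    WithHighProb μ fun N ω => IsUnit (∑ i ∈ Finset.range N, H T M μ i (αhat N ω) ω).det := by
  refine (hmem.and (h.smallInProb_sum_abs_H_sub hα₀ hA (c / 2) (half_pos hc))).of_imp
    fun N ω hω => isUnit_det_sum_H hω.1 (α' := α₀) fun v hv h0 => ?_
  -- If the empirical form vanished at `v`, the form of `A` would be minus that of the deviation,
  -- which is at most `(c / 2) ‖v‖²`; this contradicts coercivity.
  have e : (WithLp.toLp 2 v : Vec p).ofLp ⬝ᵥ A *ᵥ (WithLp.toLp 2 v : Vec p).ofLp =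
      -(v ⬝ᵥ ((N : ℝ)⁻¹ • (∑ i ∈ Finset.range N, H T M μ i α₀ ω) - A) *ᵥ v) := by
    rw [Matrix.sub_mulVec, Matrix.smul_mulVec, dotProduct_sub, dotProduct_smul, h0]
    simp
  have h1 := hcA (WithLp.toLp 2 v)
  rw [e] at h1
  have h2 := (neg_le_abs _).trans (abs_dotProduct_le (WithLp.toLp 2 v) (WithLp.toLp 2
    (((N : ℝ)⁻¹ • (∑ i ∈ Finset.range N, H T M μ i α₀ ω) - A) *ᵥ v)))
  have h3 := norm_mulVec_le_sum_abs ((N : ℝ)⁻¹ • (∑ i ∈ Finset.range N, H T M μ i α₀ ω) - A)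
    (WithLp.toLp 2 v)
  have h4 : ∑ a, ∑ b, |((N : ℝ)⁻¹ • (∑ i ∈ Finset.range N, H T M μ i α₀ ω) - A) a b| ≤ c / 2 := by
    simpa only [Matrix.sub_apply, Matrix.smul_apply, Matrix.sum_apply, smul_eq_mul] using hω.2
  have h5 : 0 < ‖(WithLp.toLp 2 v : Vec p)‖ := norm_pos_iff.2 (by simpa using hv)
  have h6 := mul_le_mul_of_nonneg_left (h3.trans (mul_le_mul_of_nonneg_right h4 h5.le)) h5.le
  have h7 : 0 < c * ‖(WithLp.toLp 2 v : Vec p)‖ ^ 2 := by positivity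
  simp only at h1 h2 h6
  nlinarith

theorem ModelConditions.smallInProb_sum_abs_H_estimated_sub (h : ModelConditions T M μ β η C)
    (hα₀ : α₀ ∈ M.params) (hA : LimitMeanCond T μ (fun i => H T M μ i α₀) A)
    (hG : ∀ j k, DifferentiableAt ℝ (fun α => M.G α j k) α₀) (hσ : DifferentiableAt ℝ M.sigmaSq α₀)
    (hmem : WithHighProb μ fun N ω => αhat N ω ∈ M.params)
    (hδ : SmallInProb μ fun N ω => ‖αhat N ω - α₀‖) :
    SmallInProb μ fun N ω => ∑ a, ∑ b,
      |((N : ℝ)⁻¹ • (∑ i ∈ Finset.range N, H T M μ i (αhat N ω) ω) - A) a b| := by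
  obtain ⟨w, hw0, hw⟩ := exists_wTilde_le T h.pos
  obtain ⟨D, hD, hcov⟩ := withHighProb_covDist_le hα₀ hG hσ hmem hδ
  have hσ0 := M.sigmaSq_pos α₀ hα₀
  have hE := boundedInProb_average (μ := μ)
    (fun i => (integrable_envSum T M h.eta_pos.le h.moment i).1) (envSum_nonneg T M)
    fun i => (integrable_envSum T M h.eta_pos.le h.moment i).2
  have hE0 : ∀ (N : ℕ) ω, 0 ≤ (N : ℝ)⁻¹ * ∑ i ∈ Finset.range N, envSum T M i ω := fun N ω =>
    mul_nonneg (by positivity) (Finset.sum_nonneg fun i _ => envSum_nonneg T M i ω)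
  have hs := hδ.mul_bounded ((boundedInProb_const (w * ((M.sigmaSq α₀ / 2)⁻¹ *
    (M.sigmaSq α₀)⁻¹ * D))).mul hE (fun _ _ => by positivity) hE0) fun _ _ => norm_nonneg _
  refine SmallInProb.sum _ fun a _ => SmallInProb.sum _ fun b _ =>
    (((h.tendsto_average_integral_H hα₀ hA a b).2).add hs).mono (hcov.of_imp fun N ω hω => ?_)
  obtain ⟨h1, h2, h3⟩ := hω
  have hN : (0 : ℝ) ≤ (N : ℝ)⁻¹ := by positivity
  have hSE : 0 ≤ ∑ i ∈ Finset.range N, envSum T M i ω :=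
    Finset.sum_nonneg fun i _ => envSum_nonneg T M i ω
  have h4 := abs_sum_H_sub_le T M hw0 hw h1 hα₀ N ω a b
  have h5 : w * ((M.sigmaSq (αhat N ω))⁻¹ * (M.sigmaSq α₀)⁻¹ * covDist M (αhat N ω) α₀) *
      ∑ i ∈ Finset.range N, envSum T M i ω ≤ w * ((M.sigmaSq α₀ / 2)⁻¹ * (M.sigmaSq α₀)⁻¹ *
        (D * ‖αhat N ω - α₀‖)) * ∑ i ∈ Finset.range N, envSum T M i ω := by
    have := covDist_nonneg M (αhat N ω) α₀
    gcongr
  have h6 := mul_le_mul_of_nonneg_left (h4.trans h5) hN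
  simp only [Matrix.sub_apply, Matrix.smul_apply, Matrix.sum_apply, smul_eq_mul]
  have h7 := abs_sub_le ((N : ℝ)⁻¹ * ∑ i ∈ Finset.range N, H T M μ i (αhat N ω) ω a b)
    ((N : ℝ)⁻¹ * ∑ i ∈ Finset.range N, H T M μ i α₀ ω a b) (A a b)
  rw [← mul_sub, abs_mul, abs_of_nonneg hN] at h7
  refine h7.trans ?_
  rw [add_comm]
  refine add_le_add le_rfl (h6.trans (le_of_eq (by ring)))

theorem ModelConditions.exists_norm_sum_U_sub_le (h : ModelConditions T M μ β η C)
    (hα₀ : α₀ ∈ M.params) (hG : ∀ j k, DifferentiableAt ℝ (fun α => M.G α j k) α₀)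
    (hσ : DifferentiableAt ℝ M.sigmaSq α₀)
    (hmem : WithHighProb μ fun N ω => αhat N ω ∈ M.params)
    (hδ : SmallInProb μ fun N ω => ‖αhat N ω - α₀‖) :
    ∃ W E : ℕ → Ω → ℝ, BoundedInProb μ W ∧ BoundedInProb μ E ∧ (∀ N ω, 0 ≤ W N ω) ∧
      (∀ N ω, 0 ≤ E N ω) ∧ WithHighProb μ fun N ω =>
        (√(N : ℝ))⁻¹ * ‖∑ i ∈ Finset.range N, U T M μ i β (αhat N ω) ω -
          ∑ i ∈ Finset.range N, U T M μ i β α₀ ω‖ ≤ ‖αhat N ω - α₀‖ * W N ω +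
            ‖αhat N ω - α₀‖ * E N ω * (√(N : ℝ) * ‖αhat N ω - α₀‖) := by
  obtain ⟨w, hw0, hw⟩ := exists_wTilde_le T h.pos
  obtain ⟨D, hD, hcov⟩ := withHighProb_covDist_le hα₀ hG hσ hmem hδ
  have hσ0 := M.sigmaSq_pos α₀ hα₀
  have hκ2 : 0 ≤ (M.sigmaSq α₀)⁻¹ ^ 2 := by positivity
  have hE := boundedInProb_average (μ := μ)
    (fun i => (integrable_envSum_sq T M h.eta_pos.le h.moment i).1) (fun _ _ => sq_nonneg _)
    fun i => (integrable_envSum_sq T M h.eta_pos.le h.moment i).2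
  have hE0 : ∀ (N : ℕ) (ω : Ω), 0 ≤ (N : ℝ)⁻¹ * ∑ i ∈ Finset.range N, envSum T M i ω ^ 2 :=
    fun N ω => mul_nonneg (by positivity) (Finset.sum_nonneg fun i _ => sq_nonneg _)
  have hW := (BoundedInProb.sum Finset.univ fun (x : Fin q × Fin q) _ =>
    h.boundedInProb_sum_score hκ2 (measurable_derivG M α₀ x.1 x.2)
      (norm_derivG_le M hα₀ x.1 x.2)).add
    (h.boundedInProb_sum_score hκ2 (measurable_derivSigma M α₀) (norm_derivSigma_le M hα₀))
  refine ⟨_, _, (boundedInProb_const D).mul hW (fun _ _ => hD) fun N ω => by positivity,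
    (boundedInProb_const (w * (1 + ‖β‖) * ((M.sigmaSq α₀ / 2)⁻¹ * (M.sigmaSq α₀)⁻¹ ^ 2 *
      D ^ 2))).mul hE (fun _ _ => by positivity) hE0,
    fun N ω => by positivity, fun N ω => mul_nonneg (by positivity) (hE0 N ω), ?_⟩
  refine (hcov.and (.of_ae (Eventually.of_forall fun N =>
    ae_outcome_eq T h.cons))).of_imp fun N ω hω => ?_
  exact inv_sqrt_mul_norm_sum_U_sub_le hw0 hw hω.1.1 hα₀ hω.1.2.1 hω.1.2.2 N hω.2 β

/-- No rate is required of `b` beforehand: `hrate` bounds `√N ‖α̂ - α₀‖` in terms of `√N ‖b - β‖`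
itself, and the extra factor `‖α̂ - α₀‖` makes that contribution small enough to be absorbed. -/
theorem ModelConditions.smallInProb_linearization (h : ModelConditions T M μ β η C)
    (hα₀ : α₀ ∈ M.params) (hA : LimitMeanCond T μ (fun i => H T M μ i α₀) A) (hc : 0 < c)
    (hcA : ∀ v : Vec p, c * ‖v‖ ^ 2 ≤ v.ofLp ⬝ᵥ (A *ᵥ v.ofLp))
    (hG : ∀ j k, DifferentiableAt ℝ (fun α => M.G α j k) α₀) (hσ : DifferentiableAt ℝ M.sigmaSq α₀)
    (hmem : WithHighProb μ fun N ω => αhat N ω ∈ M.params)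
    (hδ : SmallInProb μ fun N ω => ‖αhat N ω - α₀‖) {b : ℕ → Ω → Vec p} {k e : ℕ → Ω → ℝ}
    (hk : BoundedInProb μ k) (he : BoundedInProb μ e) (hk0 : ∀ N ω, 0 ≤ k N ω)
    (he0 : ∀ N ω, 0 ≤ e N ω)
    (hrate : WithHighProb μ fun N ω =>
      √(N : ℝ) * ‖αhat N ω - α₀‖ ≤ k N ω * ‖√(N : ℝ) • (b N ω - β)‖ + e N ω)
    (hU : WithHighProb μ fun N ω => ∑ i ∈ Finset.range N, U T M μ i (b N ω) (αhat N ω) ω = 0) :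
    SmallInProb μ fun N ω => ‖√(N : ℝ) • (b N ω - β) - WithLp.toLp 2 (A⁻¹ *ᵥ
      ((√(N : ℝ))⁻¹ • ∑ i ∈ Finset.range N, U T M μ i β α₀ ω).ofLp)‖ := by
  obtain ⟨W, E, hW, hE, hW0, hE0, hle⟩ := h.exists_norm_sum_U_sub_le hα₀ hG hσ hmem hδ
  have hS : BoundedInProb μ fun N ω =>
      ‖(√(N : ℝ))⁻¹ • ∑ i ∈ Finset.range N, U T M μ i β α₀ ω‖ := by
    have h1 := h.boundedInProb_sum_score (inv_nonneg.2 (M.sigmaSq_pos α₀ hα₀).le)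
      (measurable_invV M α₀) (norm_invV_le M hα₀)
    simpa only [U_eq_score_invV, norm_smul, norm_inv, Real.norm_of_nonneg (Real.sqrt_nonneg _)] using h1
  have hδ0 : ∀ N ω, 0 ≤ ‖αhat N ω - α₀‖ := fun _ _ => norm_nonneg _
  have hu := (h.smallInProb_sum_abs_H_estimated_sub hα₀ hA hG hσ hmem hδ).add
    (hδ.mul_bounded (hE.mul hk hE0 hk0) hδ0)
  have ht := (hδ.mul_bounded hW hδ0).add (hδ.mul_bounded (hE.mul he hE0 he0) hδ0)
  have hz : SmallInProb μ fun N ω => ‖(WithLp.toLp 2 (A *ᵥ (√(N : ℝ) • (b N ω - β)).ofLp) : Vec p) -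
      (√(N : ℝ))⁻¹ • ∑ i ∈ Finset.range N, U T M μ i β α₀ ω‖ := by
    refine SmallInProb.of_self_bound (y := fun N ω => ‖√(N : ℝ) • (b N ω - β)‖) hc hu ht hS
      (fun N ω => add_nonneg (Finset.sum_nonneg fun _ _ => Finset.sum_nonneg fun _ _ =>
        abs_nonneg _) (mul_nonneg (hδ0 N ω) (mul_nonneg (hE0 N ω) (hk0 N ω))))
      (fun N ω => add_nonneg (mul_nonneg (hδ0 N ω) (hW0 N ω))
        (mul_nonneg (hδ0 N ω) (mul_nonneg (hE0 N ω) (he0 N ω))))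
      (fun _ _ => norm_nonneg _) (fun _ _ => norm_nonneg _) ?_ ?_
    · refine (hle.and (hrate.and hU)).of_imp fun N ω hω => ?_
      obtain ⟨h1, h2, h3⟩ := hω
      have h4 := norm_linearization_le (A := A) (α₀ := α₀) (β := β) h3
      have h5 := mul_le_mul_of_nonneg_left h2 (mul_nonneg (hδ0 N ω) (hE0 N ω))
      linarith
    · refine .of_ae (Eventually.of_forall fun N => Eventually.of_forall fun ω => ?_)
      refine (mul_norm_le_norm_mulVec (hcA (√(N : ℝ) • (b N ω - β)))).trans ?_
      have := norm_add_le ((√(N : ℝ))⁻¹ • ∑ i ∈ Finset.range N, U T M μ i β α₀ ω)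
        ((WithLp.toLp 2 (A *ᵥ (√(N : ℝ) • (b N ω - β)).ofLp) : Vec p) -
          (√(N : ℝ))⁻¹ • ∑ i ∈ Finset.range N, U T M μ i β α₀ ω)
      rwa [add_sub_cancel] at this
  have hAu := isUnit_det_of_coercive hc hcA
  -- Coercivity turns the bound on `A` applied to the error into a bound on the error, at the cost
  -- of `c⁻¹`.
  refine (hz.mul_bounded (boundedInProb_const c⁻¹) fun _ _ => norm_nonneg _).mono
    (.of_ae (Eventually.of_forall fun N => Eventually.of_forall fun ω => ?_))
  have h1 := mul_norm_le_norm_mulVec (hcA (√(N : ℝ) • (b N ω - β) - WithLp.toLp 2 (A⁻¹ *ᵥ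
    ((√(N : ℝ))⁻¹ • ∑ i ∈ Finset.range N, U T M μ i β α₀ ω).ofLp)))
  rw [WithLp.ofLp_sub, Matrix.mulVec_sub, WithLp.ofLp_toLp, Matrix.mulVec_mulVec,
    Matrix.mul_nonsing_inv _ hAu, Matrix.one_mulVec, WithLp.toLp_sub, WithLp.toLp_ofLp] at h1
  rw [← div_eq_mul_inv, le_div_iff₀ hc, mul_comm]
  exact h1

end Main

end SMART

/-! ### The main theorem -/

theorem theorem4p1 {Ω 𝓛 : Type*} [MeasurableSpace Ω] [StandardBorelSpace Ω] [MeasurableSpace 𝓛]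
    (μ : Measure Ω) [IsProbabilityMeasure μ] {n : ℕ → ℕ} {p q r : ℕ}
    (T : SMART.Trial Ω 𝓛 n) (M : SMART.WorkingModel 𝓛 n p q r)
    (hindep : SMART.IndependentParticipants T μ)
    (hdesign : SMART.SecondStageDesign T μ)
    -- parameter space and true value of the mean parameter
    (B : Set (SMART.Vec p)) (βstar : SMART.Vec p) (hβstar : βstar ∈ B)
    -- marginal mean model, sequential randomization, consistency, positivity
    (hmean : SMART.CorrectMean T M μ βstar)
    (hrand : SMART.SequentialRandomization T μ)
    (hcons : SMART.Consistency T μ)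
    (hpos : SMART.Positivity T μ)
    -- the estimators of the variance parameter
    (αhatAt : ℕ → SMART.Vec p → Ω → SMART.Vec r) (αhat : ℕ → Ω → SMART.Vec r)
    (hαhat_meas : ∀ N, Measurable (αhat N))
    (hest : SMART.PseudoLikelihoodEstimators T M μ B αhatAt αhat)
    -- regularity conditions
    (αstar : SMART.Vec p → SMART.Vec r) (hαstar : ∀ β ∈ B, αstar β ∈ M.params)
    (hrate : SMART.RootNConsistent μ B βstar αhatAt αstar)
    (m : SMART.Vec p → SMART.Vec p)
    (hunif : SMART.UniformConvergence T M μ B αhatAt αstar m)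
    (hsmooth : SMART.MomentsAndSmoothness T M μ (αstar βstar))
    -- the matrices `J = J(β*)` and `I`
    (J : SMART.Vec p → Matrix (Fin p) (Fin p) ℝ)
    (hJ : SMART.UniformlyNonsingular T M μ B αstar J)
    (I : Matrix (Fin p) (Fin p) ℝ)
    (hI : SMART.LimitMeanCond T μ
      (fun i ω => Matrix.vecMulVec (SMART.U T M μ i βstar (αstar βstar) ω).ofLp
        (SMART.U T M μ i βstar (αstar βstar) ω).ofLp) I) :
    -- `β̂(α̂)` solves the estimating equations, with probability tending to one
    (SMART.WithHighProb μ fun N ω => (∑ i ∈ Finset.range N,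
      SMART.U T M μ i (SMART.betaHat T M μ N (αhat N ω) ω) (αhat N ω) ω) = 0) ∧
    -- consistency
    TendstoInMeasure μ (fun N ω => SMART.betaHat T M μ N (αhat N ω) ω) atTop
      (fun _ => βstar) ∧
    -- asymptotic normality
    TendstoInDistribution
      (fun (N : ℕ) ω => √(N : ℝ) • (SMART.betaHat T M μ N (αhat N ω) ω - βstar)) atTop
      (id : SMART.Vec p → SMART.Vec p) (fun _ => μ)
      (multivariateGaussian 0 ((J βstar)⁻¹ * I * (J βstar)⁻¹)) := by
  obtain ⟨η, hη, hη1, C, hC⟩ := SMART.exists_envSum_moment T M hsmooth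
  have h : SMART.ModelConditions T M μ βstar η C :=
    ⟨hindep, hdesign, hmean, hrand, hcons, hpos, hη, hη1, hC⟩
  obtain ⟨-, ⟨hmem', hfix⟩⟩ := hest
  obtain ⟨hJlim, c, hc, hcJ⟩ := hJ
  have hα₀ := hαstar βstar hβstar
  have hA := hJlim βstar hβstar
  have hcA := hcJ βstar hβstar
  have hmem : SMART.WithHighProb μ fun N ω => αhat N ω ∈ M.params :=
    hmem'.of_imp fun _ _ h => h.1
  have hsolve : SMART.WithHighProb μ fun N ω => ∑ i ∈ Finset.range N,
      SMART.U T M μ i (SMART.betaHat T M μ N (αhat N ω) ω) (αhat N ω) ω = 0 :=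
    (h.withHighProb_isUnit_det hα₀ hA hc hcA hmem).of_imp fun _ _ h => SMART.sum_U_betaHat h
  -- As `α̂ = α̂(β̂)`, the averaged estimating function at `β̂` is zero. Uniform convergence at
  -- level `c ε` then bounds `J(β̂)(β* - β̂)`, and coercivity divides by `c`.
  have hsmall : SMART.SmallInProb μ fun N ω =>
      ‖SMART.betaHat T M μ N (αhat N ω) ω - βstar‖ := fun ε hε => by
    refine (hsolve.and (hfix.and (hunif.2 (c * ε) (by positivity)))).of_imp fun N ω hω => ?_
    obtain ⟨h1, ⟨h2, h3⟩, h4⟩ := hω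
    have h5 := h4 _ h2
    rw [h3, h1, smul_zero, zero_sub, norm_neg,
      h.limit_U_eq (hαstar _ h2) (hJlim _ h2) (hunif.1 _ h2)] at h5
    have h6 := (SMART.mul_norm_le_norm_mulVec (hcJ _ h2 _)).trans h5
    refine (norm_sub_rev _ _).trans_le ?_
    exact le_of_mul_le_mul_left h6 hc
  have hk := hrate.boundedInProb_ratio (hfix.of_imp fun _ _ h => h.1) hsmall
  have he := hrate.1 βstar hβstar
  -- The triangle inequality through `α̂(β*)`, with the first distance written as `‖β̂ - β*‖` times
  -- the quotient that is bounded in probability. It gives both consistency of `α̂` and the rate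
  -- condition.
  have hdist : SMART.WithHighProb μ fun N ω => ‖αhat N ω - αstar βstar‖ ≤
      ‖SMART.betaHat T M μ N (αhat N ω) ω - βstar‖ *
        (‖αhatAt N (SMART.betaHat T M μ N (αhat N ω) ω) ω - αhatAt N βstar ω‖ /
          ‖SMART.betaHat T M μ N (αhat N ω) ω - βstar‖) +
      ‖αhatAt N βstar ω - αstar βstar‖ := hfix.of_imp fun N ω hω => by
    have h1 := norm_sub_le_norm_sub_add_norm_sub (αhat N ω) (αhatAt N βstar ω) (αstar βstar)
    rcases eq_or_ne ‖SMART.betaHat T M μ N (αhat N ω) ω - βstar‖ 0 with h0 | h0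
    · have h2 : αhat N ω = αhatAt N βstar ω := by
        rw [← hω.2, sub_eq_zero.1 (norm_eq_zero.1 h0)]
      rw [h2, sub_self, norm_zero, zero_add] at h1
      rw [h0, zero_mul, zero_add, h2]
    · rw [mul_div_cancel₀ _ h0, hω.2]
      exact h1
  have hδ : SMART.SmallInProb μ fun N ω => ‖αhat N ω - αstar βstar‖ := by
    refine ((hsmall.mul_bounded hk fun _ _ => norm_nonneg _).add
      (SMART.smallInProb_inv_sqrt.mul_bounded he fun _ _ => by positivity)).mono ?_
    refine (hdist.and (.of_ae ((eventually_gt_atTop 0).mono fun N hN =>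
      Eventually.of_forall fun _ => hN))).of_imp fun N ω hω => hω.1.trans (le_of_eq ?_)
    have hN : √(N : ℝ) ≠ 0 := (Real.sqrt_pos.2 (by exact_mod_cast hω.2)).ne'
    rw [inv_mul_cancel_left₀ hN]
  have hlin := h.smallInProb_linearization hα₀ hA hc hcA hsmooth.2.1 hsmooth.2.2 hmem hδ hk he
    (fun _ _ => by positivity) (fun _ _ => by positivity) (hdist.of_imp fun N ω hω => by
      rw [norm_smul, Real.norm_of_nonneg (Real.sqrt_nonneg _)]
      refine (mul_le_mul_of_nonneg_left hω (Real.sqrt_nonneg (N : ℝ))).trans (le_of_eq ?_)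
      ring) hsolve
  refine ⟨hsolve, SMART.tendstoInMeasure_iff_smallInProb.2 hsmall, ?_⟩
  have hclt := h.tendstoInDistribution_sum_score (inv_nonneg.2 (M.sigmaSq_pos _ hα₀).le)
    (SMART.measurable_invV M (αstar βstar)) (SMART.norm_invV_le M hα₀) hI (J βstar)⁻¹
  rw [Matrix.transpose_nonsing_inv, h.limit_H_isSymm hα₀ hA] at hclt
  -- Slutsky: the normalized error differs from the linear statistic by a term tending to zero in
  -- probability.
  refine tendstoInDistribution_of_tendstoInMeasure_sub _ _ hclt ?_ fun N => ?_
  · rw [SMART.tendstoInMeasure_iff_smallInProb]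
    simpa [SMART.U_eq_score_invV] using hlin
  · exact ((measurable_const_smul _).comp
      ((SMART.measurable_betaHat (hαhat_meas N) N).sub_const _)).aemeasurable
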